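/- **Setting.** A point set $P$ is a finite subset of $\mathbb{R}^2$; it is in general position if no three of its points are collinear. For $|P|=n$, let $\mathbb{I}_P$ be the set of all $n!$ arrays $I$ of length $n$ that store $P$ (indices start at $0$). The hull list of $I$ is the sequence $(h_1,\dots,h_k)$ of indices such that $I[h_1],\dots,I[h_k]$ are, without repetition, the points of $P$ on the boundary of the convex hull of $P$, in clockwise cyclic order, starting with the leftmost one (the lower one of two leftmost points). A witness list of $I$ is a sequence $(a_i,b_i,c_i)_{i}$ of $n$ integer triples with $a_i=b_i=c_i=-1$ if $I[i]$ lies on the boundary of the convex hull, and otherwise such that $a_i,b_i,c_i$ are indices of $I$ and $I[i]$ lies in the interior of the triangle $I[a_i]\,I[b_i]\,I[c_i]$. **Algorithms.** Fix a set $\mathcal{C}$ of comparisons, that is, of yes/no questions about finite tuples of points, that contains at least the comparison of two $x$-coordinates, the comparison of two $y$-coordinates, and the test whether $(p_2-p_1)\times(p_4-p_3)>0$ for four points. A comparison-based algorithm consists of a (deterministic) machine for every array size $n$ that can access the input array only by instructions that ask a comparison from $\mathcal{C}$ about some of its entries and branch accordingly; its other instructions append one entry to the hull list, write one triple of the witness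 list, halt, or do anything that does not depend on the points. It is correct if, for every $P$ in general position and every $I\in\mathbb{I}_P$, it halts with the hull list of $I$ and a complete witness list of $I$ as output. Let $\mathcal{A}$ be the set of all correct comparison-based algorithms. The running time $\rho(A,I)$ is the number of instructions that $A$ executes on input $I$ (including the halting one), and $\mathrm{universal}(A,P):=\max_{I\in\mathbb{I}_P}\rho(A,I)$. **The Kirkpatrick–McQueen–Seidel algorithm.** It finds the leftmost point $l$ and the rightmost point $r$ of $P$ (equal $x$-coordinates are ordered by $y$), and runs the following recursive procedure on the points on or above the line $lr$ with the segment $(l,r)$ and, after a rotation of the plane by a half-turn, on the points on or below it with the segment $(r,l)$ (not reporting $l$ and $r$ again). On input $(S,(p_\ell,p_r))$: if $p_\ell=p_r$, report $p_\ell$ as the next hull point (with witness entry $(-1,-1,-1)$). Otherwise, find the median $m$ of $S$ in left-to-right order by deterministic linear-time selection (medians of groups of five); find, by Kirkpatrick and Seidel's linear-time pruning procedure, the bridge, that is, the upper hull edge $(p_i,p_j)$ of $S$ such that $p_i$ is not to the right of $m$ and $p_j$ is to the right of $m$; let $S_1$ and $S_2$ be the sets of points of $S$ on or above the line $p_\ell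 p_i$ and on or above the line $p_jp_r$, respectively (if $p_\ell=p_i$, then $S_1=\{p_\ell\}$; if $p_j=p_r$, then $S_2=\{p_r\}$); recurse on $(S_1,(p_\ell,p_i))$ and on $(S_2,(p_j,p_r))$; and give to every point of $S\setminus(S_1\cup S_2)$ as its witness one of the triangles $p_\ell p_jp_i$, $p_\ell p_rp_j$. **Theorem.** The Kirkpatrick–McQueen–Seidel algorithm is universally optimal over $\mathcal{A}$: it belongs to $\mathcal{A}$, and there is a constant $c$ such that for every point set $P$ in general position and every $A'\in\mathcal{A}$, $$\mathrm{universal}(\mathrm{KMS},P)\;\le\; c\cdot \mathrm{universal}(A',P).$$ -/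

import Mathlib

namespace PlanarHull

/-! ### Planar point sets, hull lists, witness lists -/

/-- Points of the plane. -/
abbrev Point := ℝ × ℝ

/-- The cross product of two planar vectors. -/
def cross (u v : Point) : ℝ := u.1 * v.2 - u.2 * v.1

/-- `p` is not to the right of `q`; among points on a common vertical line, the lower one counts
as the one further left. -/
def LeftOf (p q : Point) : Prop := p.1 < q.1 ∨ (p.1 = q.1 ∧ p.2 ≤ q.2)

/-- No three distinct points of `P` are collinear (a `Finset` has no duplicates). -/
def GeneralPosition (P : Finset Point) : Prop :=
  ∀ a ∈ P, ∀ b ∈ P, ∀ c ∈ P, a ≠ b → a ≠ c → b ≠ c → ¬ Collinear ℝ {a, b, c}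

/-- The arrays of size `|P|` that store `P`: all orderings of the points of `P`. -/
abbrev InputArray (P : Finset Point) := Fin P.card ≃ {p : Point // p ∈ P}

/-- The entries of an input array, as points. -/
def InputArray.points {P : Finset Point} (I : InputArray P) : Fin P.card → Point :=
  fun i => (I i : Point)

/-- The `i`-th entry of the array lies on the boundary of the convex hull of all entries. -/
def OnHull {n : ℕ} (I : Fin n → Point) (i : Fin n) : Prop :=
  I i ∈ frontier (convexHull ℝ (Set.range I))

/-- `H = (h₀, …, h_{k-1})` is the hull list of the array `I`: its entries are, without repetition,
the indices of the points on the boundary of the convex hull, in cyclic (clockwise) order, that is,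
all other points lie strictly to the right of the directed segment from each entry to the
cyclically next one; and the first entry is the leftmost hull point. -/
def IsHullList {n : ℕ} (I : Fin n → Point) (H : List ℤ) : Prop :=
  ∃ (k : ℕ) (h : Fin k → Fin n),
    H = List.ofFn (fun t => ((h t : ℕ) : ℤ)) ∧
    Function.Injective h ∧
    Set.range h = {i | OnHull I i} ∧
    (∀ t : Fin k, ∀ i : Fin n, i ≠ h t → i ≠ h (finRotate k t) →
      cross (I (h (finRotate k t)) - I (h t)) (I i - I (h t)) < 0) ∧
    (∀ t : Fin k, (t : ℕ) = 0 → ∀ s : Fin k, LeftOf (I (h t)) (I (h s)))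

/-- `W` is a witness list of the array `I`: hull points have the entry `(-1, -1, -1)`; every other
point has an entry consisting of the indices of three points of the array whose triangle contains
the point in its interior. -/
def IsWitnessList {n : ℕ} (I : Fin n → Point) (W : Fin n → ℤ × ℤ × ℤ) : Prop :=
  ∀ i : Fin n,
    (OnHull I i → W i = (-1, -1, -1)) ∧
    (¬ OnHull I i → ∃ a b c : Fin n,
      W i = (((a : ℕ) : ℤ), ((b : ℕ) : ℤ), ((c : ℕ) : ℤ)) ∧
      I i ∈ interior (convexHull ℝ {I a, I b, I c}))

/-! ### Comparison-based algorithms and their running time -/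

/-- A comparison: a yes/no question about a finite tuple of points. -/
structure Comparison where
  arity : ℕ
  holds : (Fin arity → Point) → Prop

/-- The instructions of a machine with control states `σ` on arrays of size `n`. Besides halting,
an instruction is a comparison of entries of the input array, with a two-way branch; or the writing
of one entry of the output (the hull list is written from left to right, the witness list in
any order); or any other instruction, which is a step that cannot depend on the points. -/
inductive Instr (n : ℕ) (σ : Type) : Type
  | halt : Instr n σ
  | step (next : σ) : Instr n σ
  | compare (c : Comparison) (args : Fin c.arity → Fin n) (yes no : σ) : Instr n σ
  | appendHull (i : ℤ) (next : σ) : Instr n σ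
  | storeWitness (i : Fin n) (t : ℤ × ℤ × ℤ) (next : σ) : Instr n σ

/-- A machine for arrays of size `n`. A control state comprises everything that the machine
remembers (program counter, registers, memory); the input array is accessible by comparisons
only. -/
structure Machine (n : ℕ) where
  State : Type
  start : State
  instr : State → Instr n State

/-- The output written so far; `none` marks an entry of the witness list not yet written. -/
structure Output (n : ℕ) where
  hull : List ℤ
  witness : Fin n → Option (ℤ × ℤ × ℤ)

/-- The output before the first instruction. -/
def Output.empty (n : ℕ) : Output n := ⟨[], fun _ => none⟩

/-- Append an entry to the hull list. -/
def Output.appendHull {n : ℕ} (o : Output n) (i : ℤ) : Output n :=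
  { o with hull := o.hull ++ [i] }

/-- Write (or overwrite) an entry of the witness list. -/
def Output.storeWitness {n : ℕ} (o : Output n) (i : Fin n) (t : ℤ × ℤ × ℤ) : Output n :=
  { o with witness := Function.update o.witness i (some t) }

/-- `Run M I s o t o'`: on the input array `I`, the machine `M`, started in state `s` with the
output `o` already written, executes exactly `t` instructions (the halting instruction included)
and halts with the output `o'`. -/
inductive Run {n : ℕ} (M : Machine n) (I : Fin n → Point) :
    M.State → Output n → ℕ → Output n → Prop
  | halt {s : M.State} {o : Output n} (h : M.instr s = Instr.halt) : Run M I s o 1 o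
  | step {s s' : M.State} {o o' : Output n} {t : ℕ} (h : M.instr s = Instr.step s')
      (r : Run M I s' o t o') : Run M I s o (t + 1) o'
  | compareYes {s y z : M.State} {o o' : Output n} {t : ℕ} {c : Comparison}
      {a : Fin c.arity → Fin n} (h : M.instr s = Instr.compare c a y z)
      (hc : c.holds fun j => I (a j)) (r : Run M I y o t o') : Run M I s o (t + 1) o'
  | compareNo {s y z : M.State} {o o' : Output n} {t : ℕ} {c : Comparison}
      {a : Fin c.arity → Fin n} (h : M.instr s = Instr.compare c a y z)
      (hc : ¬ c.holds fun j => I (a j)) (r : Run M I z o t o') : Run M I s o (t + 1) o'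
  | appendHull {s s' : M.State} {o o' : Output n} {t : ℕ} {i : ℤ}
      (h : M.instr s = Instr.appendHull i s')
      (r : Run M I s' (o.appendHull i) t o') : Run M I s o (t + 1) o'
  | storeWitness {s s' : M.State} {o o' : Output n} {t : ℕ} {i : Fin n} {w : ℤ × ℤ × ℤ}
      (h : M.instr s = Instr.storeWitness i w s')
      (r : Run M I s' (o.storeWitness i w) t o') : Run M I s o (t + 1) o'

/-- An algorithm: a machine for every size of the input array. No uniformity in the size is
required. -/
def Algorithm := (n : ℕ) → Machine n

/-- All comparisons made by the algorithm belong to the repertoire `𝒞`. -/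
def Algorithm.UsesOnly (A : Algorithm) (𝒞 : Set Comparison) : Prop :=
  ∀ (n : ℕ) (s : (A n).State) (c : Comparison) (a : Fin c.arity → Fin n) (y z : (A n).State),
    (A n).instr s = Instr.compare c a y z → c ∈ 𝒞

/-- An algorithm is correct if on every array that stores a point set in general position it halts
and outputs the hull list and a (complete) witness list of the array. -/
def Algorithm.Correct (A : Algorithm) : Prop :=
  ∀ P : Finset Point, GeneralPosition P → ∀ I : InputArray P,
    ∃ (t : ℕ) (o : Output P.card) (W : Fin P.card → ℤ × ℤ × ℤ),
      Run (A P.card) I.points (A P.card).start (Output.empty P.card) t o ∧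
      IsHullList I.points o.hull ∧
      (∀ i, o.witness i = some (W i)) ∧
      IsWitnessList I.points W

/-- The correct comparison-based convex hull algorithms, where the permitted comparisons are those
in `𝒞`. -/
def correctAlgorithms (𝒞 : Set Comparison) : Set Algorithm :=
  {A | A.UsesOnly 𝒞 ∧ A.Correct}

/-- The running time: the number of instructions executed until the algorithm halts (`⊤` if it does
not halt). -/
noncomputable def Algorithm.runningTime (A : Algorithm) {n : ℕ} (I : Fin n → Point) : ℕ∞ :=
  ⨅ (t : ℕ) (_ : ∃ o, Run (A n) I (A n).start (Output.empty n) t o), (t : ℕ∞)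

/-- The universal running time on `P`: the maximum of the running times over all arrays that
store `P`. -/
noncomputable def Algorithm.universal (A : Algorithm) (P : Finset Point) : ℕ∞ :=
  ⨆ I : InputArray P, A.runningTime I.points

/-- `A` is universally optimal over the class `𝒜`. -/
def UniversallyOptimal (𝒜 : Set Algorithm) (A : Algorithm) : Prop :=
  A ∈ 𝒜 ∧ ∃ c : ℕ, ∀ P : Finset Point, GeneralPosition P → ∀ A' ∈ 𝒜,
    A.universal P ≤ (c : ℕ∞) * A'.universal P

/-! ### A notation for programs -/

/-- Comparison of two `x`-coordinates. -/
def compareX : Comparison := ⟨2, fun p => (p 0).1 < (p 1).1⟩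

/-- Comparison of two `y`-coordinates. -/
def compareY : Comparison := ⟨2, fun p => (p 0).2 < (p 1).2⟩

/-- Comparison of the directions of two segments: the direction from `p 2` to `p 3` is to the left
of the direction from `p 0` to `p 1`. -/
def compareDir : Comparison := ⟨4, fun p => 0 < cross (p 1 - p 0) (p 3 - p 2)⟩

/-- The comparisons made by the Kirkpatrick–McQueen–Seidel algorithm. -/
def basicComparisons : Set Comparison := {compareX, compareY, compareDir}

/-- Programs that make basic comparisons only and that return a value in `α`. -/
inductive Prog (n : ℕ) (α : Type) : Type
  | ret (a : α) : Prog n α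
  | step (next : Prog n α) : Prog n α
  | xLess (i j : Fin n) (next : Bool → Prog n α) : Prog n α
  | yLess (i j : Fin n) (next : Bool → Prog n α) : Prog n α
  | dirLess (p q r s : Fin n) (next : Bool → Prog n α) : Prog n α
  | appendHull (i : ℤ) (next : Prog n α) : Prog n α
  | storeWitness (i : Fin n) (t : ℤ × ℤ × ℤ) (next : Prog n α) : Prog n α

/-- Sequential composition. -/
def Prog.bind {n : ℕ} {α β : Type} : Prog n α → (α → Prog n β) → Prog n β
  | .ret a, f => f a
  | .step p, f => .step (p.bind f)
  | .xLess i j k, f => .xLess i j fun b => (k b).bind f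
  | .yLess i j k, f => .yLess i j fun b => (k b).bind f
  | .dirLess p q r s k, f => .dirLess p q r s fun b => (k b).bind f
  | .appendHull i p, f => .appendHull i (p.bind f)
  | .storeWitness i t p, f => .storeWitness i t (p.bind f)

instance (n : ℕ) : Monad (Prog n) where
  pure := Prog.ret
  bind := Prog.bind

/-- The machine that executes a program, one instruction for each of its operations. -/
def Prog.toMachine {n : ℕ} (p : Prog n Unit) : Machine n where
  State := Prog n Unit
  start := p
  instr
    | .ret _ => .halt
    | .step q => .step q
    | .xLess i j k => .compare compareX ![i, j] (k true) (k false)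
    | .yLess i j k => .compare compareY ![i, j] (k true) (k false)
    | .dirLess p q r s k => .compare compareDir ![p, q, r, s] (k true) (k false)
    | .appendHull i q => .appendHull i q
    | .storeWitness i t q => .storeWitness i t q

/-! ### The Kirkpatrick–McQueen–Seidel algorithm

Accounting: points are handled by their indices in the input array, and sets of points are linked
lists of indices. Every call of one of the recursive functions below, in particular every visit of
a list cell, executes at least one instruction, and it performs, besides the instructions and
calls that are written out, only a bounded number of elementary operations on indices, natural
numbers, pairs and first cells of lists. The arguments called `fuel` only bound the depth of
the recursion; they are initialised with the number of all points, which is never exhausted. -/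

namespace KMS

variable {n : ℕ} {α : Type}

/-- One instruction that does not touch the points. -/
def tick : Prog n Unit := .step (.ret ())

/-- Is `i` to the left of `j`? -/
def isLeft (i j : Fin n) : Prog n Bool := do
  if ← .xLess i j .ret then return true
  else if ← .xLess j i .ret then return false
  else .yLess i j .ret

/-- Is `i` before `j` in the left-to-right order of the plane, or, if `flip`, of the plane rotated
by a half-turn? -/
def before (flip : Bool) (i j : Fin n) : Prog n Bool :=
  if flip then isLeft j i else isLeft i j

/-- Is `x` strictly to the left of the directed line from `p` to `q` (that is, above it if `q` is to
the right of `p`)? -/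
def above (p q x : Fin n) : Prog n Bool := .dirLess p q p x .ret

/-- Is the slope of the first segment smaller than that of the second one? Both are directed from
left to right. -/
def slopeLess (e f : Fin n × Fin n) : Prog n Bool := .dirLess e.1 e.2 f.1 f.2 .ret

/-! #### Selection of the element of a given rank, by medians of groups of five -/

/-- Insert `a` into a sorted list. -/
def insert (less : α → α → Prog n Bool) (a : α) : List α → Prog n (List α)
  | [] => do tick; return [a]
  | b :: l => do
    tick
    if ← less a b then return a :: b :: l
    else
      let l' ← insert less a l
      return b :: l'

/-- Insertion sort; only applied to lists of length at most five. -/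
def sort (less : α → α → Prog n Bool) : List α → Prog n (List α)
  | [] => do tick; return []
  | a :: l => do
    tick
    let l' ← sort less l
    insert less a l'

/-- The medians of the successive groups of five elements (up to four last elements are
left out). -/
def medians (less : α → α → Prog n Bool) : List α → Prog n (List α)
  | a :: b :: c :: d :: e :: l => do
    tick
    let s ← sort less [a, b, c, d, e]
    let ms ← medians less l
    match s with
    | _ :: _ :: m :: _ => return m :: ms
    | _ => return ms
  | _ => do tick; return []

/-- Split a list into the elements that are smaller than, equivalent to, and larger than `p`. -/
def split (less : α → α → Prog n Bool) (p : α) : List α → Prog n (List α × List α × List α)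
  | [] => do tick; return ([], [], [])
  | a :: l => do
    tick
    let (lo, eq, hi) ← split less p l
    if ← less a p then return (a :: lo, eq, hi)
    else if ← less p a then return (lo, eq, a :: hi)
    else return (lo, a :: eq, hi)

/-- The length of a list. -/
def length : List α → Prog n ℕ
  | [] => do tick; return 0
  | _ :: l => do
    tick
    let k ← length l
    return k + 1

/-- The entry of a list at position `k`, counted from `0` (`d` if there is none). -/
def nth (d : α) : ℕ → List α → Prog n α
  | _, [] => do tick; return d
  | 0, a :: _ => do tick; return a
  | k + 1, _ :: l => do tick; nth d k l

/-- The element of rank `k`, counted from `0`, of a list (`d` if there is none). -/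
def select (less : α → α → Prog n Bool) (d : α) : (fuel : ℕ) → (k : ℕ) → List α → Prog n α
  | 0, _, _ => return d
  | fuel + 1, k, l => do
    tick
    match l with
    | _ :: _ :: _ :: _ :: _ :: _ :: _ =>
      let ms ← medians less l
      let g ← length ms
      let p ← select less d fuel (g / 2) ms
      let (lo, eq, hi) ← split less p l
      let a ← length lo
      let b ← length eq
      if k < a then select less d fuel k lo
      else if k < a + b then return p
      else select less d fuel (k - (a + b)) hi
    | _ =>
      let s ← sort less l
      nth d k s

/-! #### Bridge finding, by pruning -/

/-- Pair up the points of a list, each pair directed from left to right; the second component holds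
the last point if their number is odd. -/
def pairUp (flip : Bool) : List (Fin n) → Prog n (List (Fin n × Fin n) × List (Fin n))
  | a :: b :: l => do
    tick
    let (ps, rest) ← pairUp flip l
    if ← before flip a b then return ((a, b) :: ps, rest)
    else return ((b, a) :: ps, rest)
  | l => do tick; return ([], l)

/-- Scan a list for the leftmost and the rightmost among its points on the upper supporting line
that is parallel to the segment `e`; `u` and `v` are these two points for the part of the list that
has been scanned before. -/
def support (flip : Bool) (e : Fin n × Fin n) : (u v : Fin n) → List (Fin n) →
    Prog n (Fin n × Fin n)
  | u, v, [] => do tick; return (u, v)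
  | u, v, x :: l => do
    tick
    if ← slopeLess e (u, x) then support flip e x x l
    else if ← slopeLess e (x, u) then support flip e u v l
    else if ← before flip x u then support flip e x v l
    else if ← before flip v x then support flip e u x l
    else support flip e u v l

/-- Add the left endpoints of the pairs to a list. -/
def addLeft : List (Fin n × Fin n) → List (Fin n) → Prog n (List (Fin n))
  | [], acc => do tick; return acc
  | (a, _) :: ps, acc => do tick; addLeft ps (a :: acc)

/-- Add the right endpoints of the pairs to a list. -/
def addRight : List (Fin n × Fin n) → List (Fin n) → Prog n (List (Fin n))
  | [], acc => do tick; return acc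
  | (_, b) :: ps, acc => do tick; addRight ps (b :: acc)

/-- Add both endpoints of the pairs to a list. -/
def addBoth : List (Fin n × Fin n) → List (Fin n) → Prog n (List (Fin n))
  | [], acc => do tick; return acc
  | (a, b) :: ps, acc => do tick; addBoth ps (a :: b :: acc)

/-- The edge of the upper hull of the points in `S` whose left endpoint is not to the right of `m`
and whose right endpoint is to the right of `m`. (Points of both kinds occur in `S`.) -/
def bridge (flip : Bool) (m : Fin n) : (fuel : ℕ) → (S : List (Fin n)) → Prog n (Fin n × Fin n)
  | 0, _ => return (m, m)
  | fuel + 1, S => do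
    tick
    match S with
    | [] => return (m, m)
    | [_] => return (m, m)
    | [a, b] =>
      if ← before flip a b then return (a, b) else return (b, a)
    | a :: S' =>
      let (pairs, rest) ← pairUp flip S
      let g ← length pairs
      let e ← select slopeLess (m, m) n (g / 2) pairs
      let (small, equal, large) ← split slopeLess e pairs
      let (u, v) ← support flip e a a S'
      if ← before flip m u then
        -- the bridge is steeper than `e`
        let c₁ ← addBoth large rest
        let c₂ ← addLeft equal c₁
        let c₃ ← addLeft small c₂
        bridge flip m fuel c₃
      else if ← before flip m v then return (u, v)
      else
        -- the bridge is less steep than `e`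
        let c₁ ← addBoth small rest
        let c₂ ← addRight equal c₁
        let c₃ ← addRight large c₂
        bridge flip m fuel c₃

/-! #### The recursion -/

/-- Is `x` on or above the line from `p` to `q`? (If `p = q`, then only `x = p` qualifies. By general
position, no third point is on the line.) -/
def onOrAbove (p q x : Fin n) : Prog n Bool := do
  if x = p ∨ x = q then return true else above p q x

/-- Split a list into the points on or above the line from `pl` to `pi`, those on or above the line
from `pj` to `pr`, and the others. -/
def divide (pl pi pj pr : Fin n) : List (Fin n) →
    Prog n (List (Fin n) × List (Fin n) × List (Fin n))
  | [] => do tick; return ([], [], [])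
  | x :: l => do
    tick
    let (s₁, s₂, s) ← divide pl pi pj pr l
    if ← onOrAbove pl pi x then return (x :: s₁, s₂, s)
    else if ← onOrAbove pj pr x then return (s₁, x :: s₂, s)
    else return (s₁, s₂, x :: s)

/-- Give to every point of the list a witness, namely one of the two triangles into which the
quadrangle `pl pr pj pi` is divided by its diagonal from `pl` to `pj`. -/
def giveWitness (pl pr pj pi : Fin n) : List (Fin n) → Prog n Unit
  | [] => tick
  | x :: l => do
    tick
    if ← above pl pj x then
      .storeWitness x (((pl : ℕ) : ℤ), ((pj : ℕ) : ℤ), ((pi : ℕ) : ℤ)) (.ret ())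
    else
      .storeWitness x (((pl : ℕ) : ℤ), ((pr : ℕ) : ℤ), ((pj : ℕ) : ℤ)) (.ret ())
    giveWitness pl pr pj pi l

/-- Report a hull vertex. The second pass (`flip`) does not repeat the leftmost point `l` and the
rightmost point `r` of the whole point set. -/
def report (flip : Bool) (l r x : Fin n) : Prog n Unit := do
  .storeWitness x (-1, -1, -1) (.ret ())
  if flip ∧ (x = l ∨ x = r) then return ()
  else .appendHull ((x : ℕ) : ℤ) (.ret ())

/-- The recursive algorithm: `S` consists of the points on or above the line from `pl` to `pr`. -/
def hull (flip : Bool) (l r : Fin n) : (fuel : ℕ) → (S : List (Fin n)) → (pl pr : Fin n) →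
    Prog n Unit
  | 0, _, _, _ => return ()
  | fuel + 1, S, pl, pr => do
    tick
    if pl = pr then report flip l r pl
    else
      let k ← length S
      let m ← select (before flip) pl n ((k - 1) / 2) S
      let (pi, pj) ← bridge flip m n S
      let (s₁, s₂, s) ← divide pl pi pj pr S
      hull flip l r fuel s₁ pl pi
      hull flip l r fuel s₂ pj pr
      giveWitness pl pr pj pi s

/-- Read the input array: make a list of its indices. -/
def load : List (Fin n) → Prog n (List (Fin n))
  | [] => do tick; return []
  | x :: l => do
    tick
    let l' ← load l
    return x :: l'

/-- The first point, in the left-to-right order (or its reverse, if `flip`), among `x` and the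
points in the list. -/
def first (flip : Bool) : (x : Fin n) → List (Fin n) → Prog n (Fin n)
  | x, [] => do tick; return x
  | x, y :: l => do
    tick
    if ← before flip y x then first flip y l else first flip x l

/-- The points above, and the points below, the line from `l` to `r`. -/
def sides (l r : Fin n) : List (Fin n) → Prog n (List (Fin n) × List (Fin n))
  | [] => do tick; return ([], [])
  | x :: xs => do
    tick
    let (up, low) ← sides l r xs
    if x = l ∨ x = r then return (up, low)
    else if ← above l r x then return (x :: up, low)
    else return (up, x :: low)

/-- The whole program: find the leftmost point `l` and the rightmost point `r`, and compute the
upper hull, from `l` to `r`, and, in the plane rotated by a half-turn, the lower hull, from `r`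
to `l`. -/
def program : (n : ℕ) → Prog n Unit
  | 0 => return ()
  | n + 1 => do
    let all ← load (List.finRange (n + 1))
    let l ← first false 0 all
    let r ← first true 0 all
    if l = r then report false l r l
    else
      let (up, low) ← sides l r all
      hull false l r (n + 1) (l :: r :: up) l r
      hull true l r (n + 1) (r :: l :: low) r l

end KMS

/-- The Kirkpatrick–McQueen–Seidel algorithm. -/
def kirkpatrickMcQueenSeidel : Algorithm := fun n => (KMS.program n).toMachine

end PlanarHull

/-! Both running times are compared with one quantity attached to the point set: the total depth D
at which points leave the recursion tree of the algorithm.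

Upper bound. Selection, bridge finding, division and witness writing are linear in the list of the
current call, so a pass costs a constant times the sum of depth plus one over its points
(`KMS.Frame.hull_step`, `KMS.Frame.hull_cost`). Label every point with the address of the last call
it takes part in. The median split halves the lists, so at most about 2|S| / 2^d points share a
given address of length d. Moreover the list of a call consists of all input points on or above a
chord between two hull vertices. Hence whatever exceeds a listed point in the direction normal to
that chord is itself in the list, and its label extends the address of the call. This is the
property isolated in `IsCapLabelling`.

Lower bound. Within T instructions a machine produces at most 2^T different outputs
(`exists_outputs`), while there are n! arrays, so it suffices to bound the number of arrays for
which one output is right. The hull list fixes the positions of the hull points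
(`IsHullList.eq_of_onHull`). An inner point is interior to its witness triangle, so some corner
exceeds it in the direction of its label (`exists_cross_lt`), and its label is a prefix of the label
of that corner. Knowing which of the three corners this is, and the length of every label, one
recovers all labels from the outside inwards (`exists_code`). There are 3^n corner choices and at
most 4^n (4/3)^D sequences of lengths. Once the labels are known, each entry ranges over a class of
at most 4n / 2^length points, which leaves (4n)^n / 2^D arrays. Since 4/3 < 2, the product decays
like (2/3)^D. Comparison with n! ≥ (n/3)^n gives D = O(T + n), and n < T because every witness entry
has to be written (`lower_bound`).

Correctness is proved in sheared coordinates, in which no two points share a vertical line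
(`KMS.exists_frame`). There the bridge is the unique upper hull edge across the median line, and the
points discarded by a call fill a quadrangle that its diagonal cuts into two witness triangles. -/

namespace PlanarHull

/-! ### Runs of machines -/

section Runs

variable {n : ℕ} {M : Machine n} {I : Fin n → Point}

/-- The machine is deterministic. -/
theorem Run.unique {s : M.State} {o o₁ o₂ : Output n} {t₁ t₂ : ℕ} (h₁ : Run M I s o t₁ o₁)
    (h₂ : Run M I s o t₂ o₂) : t₁ = t₂ ∧ o₁ = o₂ := by
  induction h₁ generalizing t₂ o₂ with
  | halt h => cases h₂ <;> simp_all
  | step h _ ih =>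
    cases h₂ with
    | step h' r' =>
      rw [h] at h'; cases h'
      obtain ⟨rfl, rfl⟩ := ih r'; exact ⟨rfl, rfl⟩
    | _ => simp_all
  | compareYes h hc _ ih =>
    cases h₂ with
    | compareYes h' hc' r' =>
      rw [h] at h'; cases h'
      obtain ⟨rfl, rfl⟩ := ih r'; exact ⟨rfl, rfl⟩
    | compareNo h' hc' r' => rw [h] at h'; cases h'; exact absurd hc hc'
    | _ => simp_all
  | compareNo h hc _ ih =>
    cases h₂ with
    | compareNo h' hc' r' =>
      rw [h] at h'; cases h'
      obtain ⟨rfl, rfl⟩ := ih r'; exact ⟨rfl, rfl⟩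
    | compareYes h' hc' r' => rw [h] at h'; cases h'; exact absurd hc' hc
    | _ => simp_all
  | appendHull h _ ih =>
    cases h₂ with
    | appendHull h' r' =>
      rw [h] at h'; cases h'
      obtain ⟨rfl, rfl⟩ := ih r'; exact ⟨rfl, rfl⟩
    | _ => simp_all
  | storeWitness h _ ih =>
    cases h₂ with
    | storeWitness h' r' =>
      rw [h] at h'; cases h'
      obtain ⟨rfl, rfl⟩ := ih r'; exact ⟨rfl, rfl⟩
    | _ => simp_all

theorem Algorithm.runningTime_le {A : Algorithm} {I : Fin n → Point} {t : ℕ} {o : Output n}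
    (h : Run (A n) I (A n).start (Output.empty n) t o) : A.runningTime I ≤ t :=
  iInf₂_le t ⟨o, h⟩

theorem Algorithm.runningTime_eq {A : Algorithm} {I : Fin n → Point} {t : ℕ} {o : Output n}
    (h : Run (A n) I (A n).start (Output.empty n) t o) : A.runningTime I = t := by
  refine le_antisymm (runningTime_le h) (le_iInf₂ ?_)
  rintro t' ⟨o', h'⟩
  rw [(Run.unique h h').1]

/-- The outputs that a machine can produce in at most `T` instructions number at most `2 ^ T`. -/
theorem exists_outputs (M : Machine n) (T : ℕ) (s : M.State) (o : Output n) :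
    ∃ F : Finset (Output n), F.card ≤ 2 ^ T ∧
      ∀ I t o', Run M I s o t o' → t ≤ T → o' ∈ F := by
  classical
  induction T generalizing s o with
  | zero =>
    refine ⟨∅, by simp, fun I t o' h ht => ?_⟩
    cases h <;> omega
  | succ T ih =>
    have hpow : 2 ^ (T + 1) = 2 ^ T + 2 ^ T := by ring
    have hpos : 0 < 2 ^ T := by positivity
    cases hs : M.instr s with
    | halt =>
      refine ⟨{o}, by simp; omega, fun I t o' h ht => ?_⟩
      cases h <;> simp_all
    | step s' =>
      obtain ⟨F, hF, h⟩ := ih s' o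
      refine ⟨F, by omega, fun I t o' hr ht => ?_⟩
      cases hr with
      | step h' r => rw [hs] at h'; cases h'; exact h I _ _ r (by omega)
      | _ => simp_all
    -- The points influence the run only here, by one bit; every other instruction has a single
    -- successor, so only comparisons double the number of outputs.
    | compare c a y z =>
      obtain ⟨F, hF, h⟩ := ih y o
      obtain ⟨G, hG, h2⟩ := ih z o
      refine ⟨F ∪ G, (Finset.card_union_le _ _).trans (by omega), fun I t o' hr ht => ?_⟩
      rw [Finset.mem_union]
      cases hr with
      | compareYes h' _ r => rw [hs] at h'; cases h'; exact .inl (h I _ _ r (by omega))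
      | compareNo h' _ r => rw [hs] at h'; cases h'; exact .inr (h2 I _ _ r (by omega))
      | _ => simp_all
    | appendHull i s' =>
      obtain ⟨F, hF, h⟩ := ih s' (o.appendHull i)
      refine ⟨F, by omega, fun I t o' hr ht => ?_⟩
      cases hr with
      | appendHull h' r => rw [hs] at h'; cases h'; exact h I _ _ r (by omega)
      | _ => simp_all
    | storeWitness i w s' =>
      obtain ⟨F, hF, h⟩ := ih s' (o.storeWitness i w)
      refine ⟨F, by omega, fun I t o' hr ht => ?_⟩
      cases hr with
      | storeWitness h' r => rw [hs] at h'; cases h'; exact h I _ _ r (by omega)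
      | _ => simp_all

/-- Every entry of the witness list takes one instruction. -/
theorem Run.card_unwritten_lt {s : M.State} {o o' : Output n} {t : ℕ} (h : Run M I s o t o')
    (hw : ∀ i, o'.witness i ≠ none) :
    (Finset.univ.filter fun i => o.witness i = none).card < t := by
  induction h with
  | halt h => simp [hw]
  | step _ _ ih => exact (ih hw).trans (Nat.lt_succ_self _)
  | compareYes _ _ _ ih => exact (ih hw).trans (Nat.lt_succ_self _)
  | compareNo _ _ _ ih => exact (ih hw).trans (Nat.lt_succ_self _)
  | appendHull _ _ ih => exact (ih hw).trans (Nat.lt_succ_self _)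
  | @storeWitness s s' o o' t i w h r ih =>
    have h1 := ih hw
    have h2 : (Finset.univ.filter fun j => o.witness j = none) ⊆
        insert i (Finset.univ.filter fun j => (o.storeWitness i w).witness j = none) := by
      intro j hj
      by_cases hji : j = i
      · simp [hji]
      · simp only [Finset.mem_insert, Finset.mem_filter, Finset.mem_univ, true_and] at hj ⊢
        exact .inr ((Function.update_of_ne hji _ _).trans hj)
    have h3 := (Finset.card_le_card h2).trans (Finset.card_insert_le _ _)
    omega

end Runs

/-! ### Evaluation of programs -/

namespace Prog

open Classical in
/-- The value returned by a program on an input array. -/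
noncomputable def res {n : ℕ} {α : Type} (I : Fin n → Point) : Prog n α → α
  | ret a => a
  | step p => res I p
  | xLess i j k => res I (k (decide ((I i).1 < (I j).1)))
  | yLess i j k => res I (k (decide ((I i).2 < (I j).2)))
  | dirLess p q r s k => res I (k (decide (0 < cross (I q - I p) (I s - I r))))
  | appendHull _ p => res I p
  | storeWitness _ _ p => res I p

open Classical in
/-- The number of instructions executed by a program, not counting the halting one. -/
noncomputable def cost {n : ℕ} {α : Type} (I : Fin n → Point) : Prog n α → ℕ
  | ret _ => 0
  | step p => cost I p + 1
  | xLess i j k => cost I (k (decide ((I i).1 < (I j).1))) + 1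
  | yLess i j k => cost I (k (decide ((I i).2 < (I j).2))) + 1
  | dirLess p q r s k => cost I (k (decide (0 < cross (I q - I p) (I s - I r)))) + 1
  | appendHull _ p => cost I p + 1
  | storeWitness _ _ p => cost I p + 1

open Classical in
/-- The entries that a program appends to the hull list. -/
noncomputable def hullOut {n : ℕ} {α : Type} (I : Fin n → Point) : Prog n α → List ℤ
  | ret _ => []
  | step p => hullOut I p
  | xLess i j k => hullOut I (k (decide ((I i).1 < (I j).1)))
  | yLess i j k => hullOut I (k (decide ((I i).2 < (I j).2)))
  | dirLess p q r s k => hullOut I (k (decide (0 < cross (I q - I p) (I s - I r))))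
  | appendHull i p => i :: hullOut I p
  | storeWitness _ _ p => hullOut I p

open Classical in
/-- The entries that a program writes to the witness list, in order. -/
noncomputable def writes {n : ℕ} {α : Type} (I : Fin n → Point) :
    Prog n α → List (Fin n × (ℤ × ℤ × ℤ))
  | ret _ => []
  | step p => writes I p
  | xLess i j k => writes I (k (decide ((I i).1 < (I j).1)))
  | yLess i j k => writes I (k (decide ((I i).2 < (I j).2)))
  | dirLess p q r s k => writes I (k (decide (0 < cross (I q - I p) (I s - I r))))
  | appendHull _ p => writes I p
  | storeWitness i t p => (i, t) :: writes I p

variable {n : ℕ} {α β : Type} (I : Fin n → Point)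

@[simp] theorem res_pure (a : α) : res I (pure a : Prog n α) = a := rfl
@[simp] theorem cost_pure (a : α) : cost I (pure a : Prog n α) = 0 := rfl
@[simp] theorem hullOut_pure (a : α) : hullOut I (pure a : Prog n α) = [] := rfl
@[simp] theorem writes_pure (a : α) : writes I (pure a : Prog n α) = [] := rfl

@[simp] theorem res_bind (p : Prog n α) (f : α → Prog n β) :
    res I (p >>= f) = res I (f (res I p)) := by
  change res I (p.bind f) = _
  induction p <;> simp_all [-Bool.forall_bool, Prog.bind, res]

@[simp] theorem cost_bind (p : Prog n α) (f : α → Prog n β) :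
    cost I (p >>= f) = cost I p + cost I (f (res I p)) := by
  change cost I (p.bind f) = _
  induction p <;> simp_all [-Bool.forall_bool, Prog.bind, res, cost, Nat.add_right_comm]

@[simp] theorem hullOut_bind (p : Prog n α) (f : α → Prog n β) :
    hullOut I (p >>= f) = hullOut I p ++ hullOut I (f (res I p)) := by
  change hullOut I (p.bind f) = _
  induction p <;> simp_all [-Bool.forall_bool, Prog.bind, res, hullOut]

@[simp] theorem writes_bind (p : Prog n α) (f : α → Prog n β) :
    writes I (p >>= f) = writes I p ++ writes I (f (res I p)) := by
  change writes I (p.bind f) = _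
  induction p <;> simp_all [-Bool.forall_bool, Prog.bind, res, writes]

/-- Perform a sequence of writes to the witness list. -/
def applyWrites (o : Output n) (ws : List (Fin n × (ℤ × ℤ × ℤ))) : Output n :=
  ws.foldl (fun o w => o.storeWitness w.1 w.2) o

theorem applyWrites_appendHull (o : Output n) (i : ℤ) (ws : List (Fin n × (ℤ × ℤ × ℤ))) :
    applyWrites (o.appendHull i) ws = (applyWrites o ws).appendHull i := by
  induction ws generalizing o with
  | nil => rfl
  | cons w ws ih => exact ih (o.storeWitness w.1 w.2)

/-- If some entry `i` has been written, then its final value is one of the written ones. -/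
theorem applyWrites_witness (o : Output n) (ws : List (Fin n × (ℤ × ℤ × ℤ))) (i : Fin n) :
    ((∀ t, (i, t) ∉ ws) ∧ (applyWrites o ws).witness i = o.witness i) ∨
      ∃ t, (i, t) ∈ ws ∧ (applyWrites o ws).witness i = some t := by
  induction ws generalizing o with
  | nil => exact .inl ⟨by simp, rfl⟩
  | cons w ws ih =>
    obtain ⟨h, h'⟩ | ⟨t, h, h'⟩ := ih (o.storeWitness w.1 w.2)
    · by_cases hw : w.1 = i
      · refine .inr ⟨w.2, by simp [← hw], ?_⟩
        refine h'.trans ?_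
        simp [Output.storeWitness, hw]
      · refine .inl ⟨fun t => ?_, h'.trans ?_⟩
        · simp only [List.mem_cons, not_or]
          exact ⟨fun h => hw (by rw [← h]), h t⟩
        · simp [Output.storeWitness, Function.update_of_ne (Ne.symm hw)]
    · exact .inr ⟨t, by simp [h], h'⟩

/-- Links the structural evaluation of programs to runs of machines. The states of the machine are
themselves programs and its instructions do not depend on the initial one, so `p₀` stays fixed while
the induction runs over `p`. The extra 1 is the halting instruction. -/
theorem run_toMachine (p₀ p : Prog n Unit) (o : Output n) :
    ∃ o', Run p₀.toMachine I p o (cost I p + 1) o' ∧ o'.hull = o.hull ++ hullOut I p ∧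
      o'.witness = (applyWrites o (writes I p)).witness := by
  induction p generalizing o with
  | ret a => exact ⟨o, .halt rfl, by simp [hullOut], rfl⟩
  | step p ih =>
    obtain ⟨o', h, h'⟩ := ih o
    exact ⟨o', .step rfl h, h'⟩
  | xLess i j k ih =>
    obtain ⟨o', h, h'⟩ := ih (decide ((I i).1 < (I j).1)) o
    refine ⟨o', ?_, h'⟩
    by_cases hc : (I i).1 < (I j).1
    · exact .compareYes (y := k true) (z := k false) (c := compareX) (a := ![i, j]) rfl hc
        (by simpa [hc, cost] using h)
    · exact .compareNo (y := k true) (z := k false) (c := compareX) (a := ![i, j]) rfl hc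
        (by simpa [hc, cost] using h)
  | yLess i j k ih =>
    obtain ⟨o', h, h'⟩ := ih (decide ((I i).2 < (I j).2)) o
    refine ⟨o', ?_, h'⟩
    by_cases hc : (I i).2 < (I j).2
    · exact .compareYes (y := k true) (z := k false) (c := compareY) (a := ![i, j]) rfl hc
        (by simpa [hc, cost] using h)
    · exact .compareNo (y := k true) (z := k false) (c := compareY) (a := ![i, j]) rfl hc
        (by simpa [hc, cost] using h)
  | dirLess p q r s k ih =>
    obtain ⟨o', h, h'⟩ := ih (decide (0 < cross (I q - I p) (I s - I r))) o
    refine ⟨o', ?_, h'⟩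
    by_cases hc : 0 < cross (I q - I p) (I s - I r)
    · exact .compareYes (y := k true) (z := k false) (c := compareDir) (a := ![p, q, r, s]) rfl hc
        (by simpa [hc, cost] using h)
    · exact .compareNo (y := k true) (z := k false) (c := compareDir) (a := ![p, q, r, s]) rfl hc
        (by simpa [hc, cost] using h)
  | appendHull i p ih =>
    obtain ⟨o', h, h', h''⟩ := ih (o.appendHull i)
    refine ⟨o', .appendHull rfl h, ?_, ?_⟩
    · simp [h', hullOut, Output.appendHull]
    · rw [h'', applyWrites_appendHull]; rfl
  | storeWitness i t p ih =>
    obtain ⟨o', h, h', h''⟩ := ih (o.storeWitness i t)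
    exact ⟨o', .storeWitness rfl h, h', h''⟩

theorem toMachine_compare_mem (p₀ p : Prog n Unit) {c : Comparison} {a : Fin c.arity → Fin n}
    {y z : Prog n Unit} (h : p₀.toMachine.instr p = Instr.compare c a y z) :
    c ∈ basicComparisons := by
  cases p <;> simp only [toMachine] at h <;> cases h <;> simp [basicComparisons]

end Prog

theorem kirkpatrickMcQueenSeidel_usesOnly {𝒞 : Set Comparison} (h𝒞 : basicComparisons ⊆ 𝒞) :
    kirkpatrickMcQueenSeidel.UsesOnly 𝒞 :=
  fun n s _ _ _ _ h => h𝒞 (Prog.toMachine_compare_mem (KMS.program n) s h)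

/-! ### Geometry of convex hulls -/

theorem cross_add_right (u v w : Point) : cross u (v + w) = cross u v + cross u w := by
  simp only [cross, Prod.fst_add, Prod.snd_add]; ring

theorem cross_smul_right (u v : Point) (r : ℝ) : cross u (r • v) = r * cross u v := by
  simp only [cross, Prod.smul_fst, Prod.smul_snd, smul_eq_mul]; ring

theorem continuous_cross (u : Point) : Continuous (cross u) := by
  unfold cross; fun_prop

theorem convex_cross_le (u : Point) (r : ℝ) : Convex ℝ {x | cross u x ≤ r} := by
  refine convex_halfSpace_le (f := cross u) ⟨cross_add_right u, fun c x => ?_⟩ r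
  rw [cross_smul_right, smul_eq_mul]

/-- A point in the interior of the convex hull of a set is not extreme in any direction. -/
theorem exists_cross_lt {s : Set Point} {x : Point} (hx : x ∈ interior (convexHull ℝ s))
    {v : Point} (hv : v ≠ 0) : ∃ q ∈ s, cross v x < cross v q := by
  by_contra! h
  have hsub : convexHull ℝ s ⊆ {y | cross v y ≤ cross v x} :=
    convexHull_min h (convex_cross_le v _)
  -- `(-v.2, v.1)` is `v` turned by a right angle, and its cross product with `v` is the squared
  -- length of `v`; a small move along it stays in the hull but increases `cross v`.
  have hcont : Filter.Tendsto (fun ε : ℝ => x + ε • ((-v.2, v.1) : Point)) (nhds 0) (nhds x) := by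
    have : Continuous fun ε : ℝ => x + ε • ((-v.2, v.1) : Point) := by fun_prop
    simpa using this.tendsto 0
  have h1 : ∀ᶠ ε : ℝ in nhdsWithin 0 (Set.Ioi 0),
      x + ε • ((-v.2, v.1) : Point) ∈ convexHull ℝ s :=
    (hcont.mono_left nhdsWithin_le_nhds).eventually (mem_interior_iff_mem_nhds.1 hx)
  obtain ⟨ε, hε, hpos⟩ := (h1.and self_mem_nhdsWithin).exists
  have h2 := hsub hε
  rw [Set.mem_ofPred_eq, cross_add_right, cross_smul_right] at h2
  have h3 : cross v (-v.2, v.1) = v.1 ^ 2 + v.2 ^ 2 := by simp only [cross]; ring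
  have h4 : 0 < v.1 ^ 2 + v.2 ^ 2 := by
    by_contra! h0
    refine hv (Prod.ext ?_ ?_)
    · exact pow_eq_zero_iff two_ne_zero |>.1 (by nlinarith [sq_nonneg v.1, sq_nonneg v.2])
    · exact pow_eq_zero_iff two_ne_zero |>.1 (by nlinarith [sq_nonneg v.1, sq_nonneg v.2])
  rw [h3] at h2
  have := mul_pos (Set.mem_Ioi.1 hpos) h4
  linarith

/-! ### What the hull list reveals about the array -/

section InputArrays

variable {P : Finset Point}

theorem InputArray.injective_points (I : InputArray P) : Function.Injective I.points :=
  fun _ _ h => I.injective (Subtype.ext h)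

theorem InputArray.range_points (I : InputArray P) : Set.range I.points = P := by
  ext x
  constructor
  · rintro ⟨i, rfl⟩; exact (I i).2
  · intro hx; exact ⟨I.symm ⟨x, hx⟩, by simp [InputArray.points]⟩

theorem onHull_iff (I : InputArray P) (i : Fin P.card) :
    OnHull I.points i ↔ (I i : Point) ∈ frontier (convexHull ℝ (P : Set Point)) := by
  unfold OnHull; rw [I.range_points]; rfl

/-- The hull list determines the positions of the hull points. -/
theorem IsHullList.eq_of_onHull {I I' : InputArray P} {H : List ℤ} (h : IsHullList I.points H)
    (h' : IsHullList I'.points H) {i : Fin P.card} (hi : OnHull I.points i) : I i = I' i := by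
  obtain ⟨k, f, hH, hinj, hrange, hedge, hleft⟩ := h
  obtain ⟨k', f', hH', hinj', hrange', hedge', hleft'⟩ := h'
  obtain rfl : k = k' := by
    have := congrArg List.length (hH.symm.trans hH')
    simpa using this
  obtain rfl : f = f' := by
    have := List.ofFn_injective (hH.symm.trans hH')
    funext t
    have h2 := congrFun this t
    exact Fin.ext (by simpa using h2)
  have key : ∀ t : ℕ, ∀ ht : t < k, I.points (f ⟨t, ht⟩) = I'.points (f ⟨t, ht⟩) := by
    -- Being a hull point depends on the point alone, so the same index list enumerates the same set
    -- of points in both arrays.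
    have other : ∀ J J' : InputArray P, (Set.range f = {i | OnHull J.points i}) →
        (Set.range f = {i | OnHull J'.points i}) → ∀ t, ∃ s, J.points (f s) = J'.points (f t) := by
      intro J J' hJ hJ' t
      have h1 : OnHull J'.points (f t) := by
        have : f t ∈ Set.range f := ⟨t, rfl⟩
        rw [hJ'] at this; exact this
      have h2 : OnHull J.points (J.symm (J' (f t))) := by
        rw [onHull_iff] at h1 ⊢; simpa using h1
      have h3 : J.symm (J' (f t)) ∈ Set.range f := by rw [hJ]; exact h2
      obtain ⟨s, hs⟩ := h3
      exact ⟨s, by simp [InputArray.points, hs]⟩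
    intro t
    induction t with
    | zero =>
      intro ht
      obtain ⟨s, hs⟩ := other I I' hrange hrange' ⟨0, ht⟩
      obtain ⟨s', hs'⟩ := other I' I hrange' hrange ⟨0, ht⟩
      have h1 := hleft ⟨0, ht⟩ rfl s
      have h2 := hleft' ⟨0, ht⟩ rfl s'
      rw [hs] at h1
      rw [hs'] at h2
      rcases h1 with h1 | ⟨h1, h1'⟩ <;> rcases h2 with h2 | ⟨h2, h2'⟩
      · linarith
      · linarith
      · linarith
      · exact Prod.ext h1 (le_antisymm h1' h2')
    | succ t ih =>
      intro ht
      have ht' : t < k := by omega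
      have ih := ih ht'
      have hrot : finRotate k ⟨t, ht'⟩ = ⟨t + 1, ht⟩ := by
        obtain ⟨k, rfl⟩ : ∃ k', k = k' + 1 := ⟨k - 1, by omega⟩
        exact finRotate_of_lt (by omega)
      -- Two different successors of the same hull point would each lie strictly to the right of the
      -- segment towards the other, but the two cross products are opposite numbers.
      by_contra hne
      obtain ⟨s, hs⟩ := other I I' hrange hrange' ⟨t + 1, ht⟩
      obtain ⟨s', hs'⟩ := other I' I hrange' hrange ⟨t + 1, ht⟩
      have hne1 : f ⟨t + 1, ht⟩ ≠ f ⟨t, ht'⟩ := fun h => by simpa using hinj h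
      have h1 := hedge ⟨t, ht'⟩ (f s)
        (fun h => hne1 (I'.injective_points (by rw [← hs, h, ih])))
        (fun h => hne (by rw [← hs, h, hrot]))
      have h2 := hedge' ⟨t, ht'⟩ (f s')
        (fun h => hne1 (I.injective_points (by rw [← hs', h, ih])))
        (fun h => hne (by rw [← hs', h, hrot]))
      rw [hrot, hs, ih] at h1
      rw [hrot, hs'] at h2
      simp only [cross] at h1 h2
      linarith
  have hi' : i ∈ Set.range f := by rw [hrange]; exact hi
  obtain ⟨t, rfl⟩ := hi'
  exact Subtype.ext (key t t.2)

/-- The hull points have the same positions in two arrays with the same hull list. -/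
theorem IsHullList.onHull_iff_onHull {I I' : InputArray P} {H : List ℤ}
    (h : IsHullList I.points H) (h' : IsHullList I'.points H) (i : Fin P.card) :
    OnHull I.points i ↔ OnHull I'.points i := by
  constructor <;> intro hi
  · rw [onHull_iff] at hi ⊢; rwa [← h.eq_of_onHull h' ((onHull_iff I i).2 hi)]
  · rw [onHull_iff] at hi ⊢; rwa [← h'.eq_of_onHull h ((onHull_iff I' i).2 hi)]

end InputArrays

/-! ### Counting -/

/-- The number of sequences of `n` natural numbers with sum `D` is at most `4 ^ n * (4 / 3) ^ D`. -/
theorem card_piAntidiag_mul_le (ι : Type) [Fintype ι] [DecidableEq ι] (D : ℕ) :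
    (Finset.piAntidiag (Finset.univ : Finset ι) D).card * 3 ^ D ≤
      4 ^ D * 4 ^ Fintype.card ι := by
  have hgeom : ∑ j ∈ Finset.range (D + 1), (3 / 4 : ℝ) ^ j ≤ 4 := by
    rw [geom_sum_eq (by norm_num), div_le_iff_of_neg (by norm_num)]
    have : (0 : ℝ) ≤ (3 / 4) ^ (D + 1) := by positivity
    linarith
  -- Generating function at 3/4: every sequence has weight (3/4)^D, and the total weight of all
  -- sequences in the box factors into geometric sums, each at most 4. The point 3/4 is chosen so
  -- that the growth rate 4/3 stays below the factor 2 gained from the class sizes.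
  have h : ((Finset.piAntidiag (Finset.univ : Finset ι) D).card : ℝ) * (3 / 4) ^ D ≤
      4 ^ Fintype.card ι := by
    calc ((Finset.piAntidiag (Finset.univ : Finset ι) D).card : ℝ) * (3 / 4) ^ D
        = ∑ d ∈ Finset.piAntidiag (Finset.univ : Finset ι) D, ∏ i, (3 / 4 : ℝ) ^ d i := by
          rw [← nsmul_eq_mul, ← Finset.sum_const]
          refine Finset.sum_congr rfl fun d hd => ?_
          rw [Finset.prod_pow_eq_pow_sum, (Finset.mem_piAntidiag.1 hd).1]
      _ ≤ ∑ d ∈ Fintype.piFinset fun _ : ι => Finset.range (D + 1),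
            ∏ i, (3 / 4 : ℝ) ^ d i := by
          refine Finset.sum_le_sum_of_subset_of_nonneg (fun d hd => ?_)
            fun _ _ _ => by positivity
          rw [Fintype.mem_piFinset]
          intro i
          rw [Finset.mem_range, Nat.lt_succ_iff, ← (Finset.mem_piAntidiag.1 hd).1]
          exact Finset.single_le_sum (fun _ _ => Nat.zero_le _) (Finset.mem_univ i)
      _ = ∏ _i : ι, ∑ j ∈ Finset.range (D + 1), (3 / 4 : ℝ) ^ j :=
          (Finset.prod_univ_sum _ _).symm
      _ ≤ 4 ^ Fintype.card ι := by
          rw [Finset.prod_const, Finset.card_univ]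
          exact pow_le_pow_left₀ (Finset.sum_nonneg fun _ _ => by positivity) hgeom _
  have h' : ((Finset.piAntidiag (Finset.univ : Finset ι) D).card : ℝ) * 3 ^ D ≤
      4 ^ D * 4 ^ Fintype.card ι := by
    rw [div_pow, mul_div_assoc', div_le_iff₀ (by positivity)] at h
    linarith
  exact_mod_cast h'

/-- The quotient n^n / n! is a single term of the exponential series at n, and e < 3. -/
theorem pow_self_le_three_pow_mul_factorial (n : ℕ) : n ^ n ≤ 3 ^ n * n.factorial := by
  have h1 := Real.pow_div_factorial_le_exp (n : ℝ) (by positivity) n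
  have h2 : Real.exp n ≤ 3 ^ n := by
    rw [← mul_one (n : ℝ), Real.exp_nat_mul]
    exact pow_le_pow_left₀ (Real.exp_pos _).le
      (Real.exp_one_lt_d9.le.trans (by norm_num)) n
  rw [div_le_iff₀ (by positivity)] at h1
  have h3 : (n : ℝ) ^ n ≤ 3 ^ n * n.factorial :=
    h1.trans (mul_le_mul_of_nonneg_right h2 (by positivity))
  exact_mod_cast h3

/-- The content is (3/2)^D ≤ 2^T 144^n. Squaring avoids logarithms: 36 ≥ 32 and 144 ≤ 256 turn
everything into powers of two, and the exponents give D ≤ 2T + 16n. -/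
theorem le_of_pow_bound {D T n : ℕ} (hn : n ≤ T) (h : 6 ^ D ≤ 2 ^ T * 4 ^ D * 144 ^ n) :
    D ≤ 18 * T := by
  have h1 : 2 ^ (5 * D) ≤ 2 ^ (2 * T + 4 * D + 16 * n) := by
    calc 2 ^ (5 * D) = 32 ^ D := by rw [pow_mul]; norm_num
      _ ≤ 36 ^ D := Nat.pow_le_pow_left (by norm_num) D
      _ = (6 ^ D) ^ 2 := by rw [← pow_mul, mul_comm D 2, pow_mul]; norm_num
      _ ≤ (2 ^ T * 4 ^ D * 144 ^ n) ^ 2 := Nat.pow_le_pow_left h 2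
      _ ≤ (2 ^ T * 4 ^ D * 256 ^ n) ^ 2 := by gcongr; norm_num
      _ = 2 ^ (2 * T + 4 * D + 16 * n) := by
        rw [show (4 : ℕ) = 2 ^ 2 by norm_num, show (256 : ℕ) = 2 ^ 8 by norm_num]
        simp only [← pow_mul, ← pow_add]; ring_nf
  have h2 := (Nat.pow_le_pow_iff_right (by norm_num : 1 < 2)).1 h1
  omega

/-! ### The lower bound -/

/-- The labels of the points are the addresses of nodes of a binary tree, and every node comes with
a direction `v` in which no point with that label is exceeded by a point outside the subtree. -/
def IsCapLabelling {P : Finset Point} (path : {p : Point // p ∈ P} → List Bool) : Prop :=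
  ∀ w, ∃ v : Point, v ≠ 0 ∧ ∀ p q : {p : Point // p ∈ P}, path p = w →
    cross v p < cross v q → w <+: path q

section LowerBound

variable {P : Finset Point}

/-- An output determines, up to one of three choices and the length of the label of each point, the
labels of the points in every array with that output. -/
theorem exists_code {path : {p : Point // p ∈ P} → List Bool} (hpath : IsCapLabelling path)
    {H : List ℤ} {W : Fin P.card → ℤ × ℤ × ℤ} :
    ∃ e : InputArray P → Fin P.card → Fin 3, ∀ I I' : InputArray P,
      IsHullList I.points H → IsWitnessList I.points W →
      IsHullList I'.points H → IsWitnessList I'.points W →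
      e I = e I' → (∀ i, (path (I i)).length = (path (I' i)).length) →
      ∀ i, path (I i) = path (I' i) := by
  choose v hv0 hv using hpath
  have hex : ∀ (I : InputArray P) (i : Fin P.card), ∃ j : Fin 3,
      (IsWitnessList I.points W → ¬ OnHull I.points i → ∃ q : Fin P.card,
        ![(W i).1, (W i).2.1, (W i).2.2] j = ((q : ℕ) : ℤ) ∧
        cross (v (path (I i))) (I i) < cross (v (path (I i))) (I q)) := by
    intro I i
    by_cases h : IsWitnessList I.points W ∧ ¬ OnHull I.points i
    · obtain ⟨a, b, c, hW, hint⟩ := (h.1 i).2 h.2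
      obtain ⟨q, hq, hlt⟩ := exists_cross_lt hint (hv0 (path (I i)))
      rcases hq with rfl | rfl | rfl
      · exact ⟨0, fun _ _ => ⟨a, by simp [hW], hlt⟩⟩
      · exact ⟨1, fun _ _ => ⟨b, by simp [hW], hlt⟩⟩
      · exact ⟨2, fun _ _ => ⟨c, by simp [hW], hlt⟩⟩
    · exact ⟨0, fun h1 h2 => absurd ⟨h1, h2⟩ h⟩
  choose e he using hex
  refine ⟨e, fun I I' hH hW hH' hW' hee hd => ?_⟩
  -- The order of decoding: corners come before the points that they exceed. A corner has either a
  -- longer label, or the same label and a larger value in the direction of that label; on a finite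
  -- set this relation is well founded.
  let R : Fin P.card → Fin P.card → Prop := fun q i =>
    (path (I i)).length < (path (I q)).length ∨ (path (I i) = path (I q) ∧
      cross (v (path (I i))) (I i) < cross (v (path (I i))) (I q))
  have : IsTrans (Fin P.card) R := ⟨by
    rintro a b c (h | ⟨h, h'⟩) (h2 | ⟨h2, h2'⟩)
    · exact .inl (h2.trans h)
    · left; rw [h2]; exact h
    · left; rw [← h]; exact h2
    · right
      refine ⟨h2.trans h, h2'.trans ?_⟩
      rwa [h2]⟩
  have : Std.Irrefl R := ⟨by
    rintro a (h | ⟨h, h'⟩)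
    · exact lt_irrefl _ h
    · exact lt_irrefl _ h'⟩
  have hwf : WellFounded R := Finite.wellFounded_of_trans_of_irrefl R
  intro i
  induction i using hwf.induction with
  | _ i ih =>
    by_cases hi : OnHull I.points i
    · rw [hH.eq_of_onHull hH' hi]
    · have hi' : ¬ OnHull I'.points i := by rwa [← hH.onHull_iff_onHull hH']
      obtain ⟨q, hq, hlt⟩ := he I i hW hi
      obtain ⟨q', hq', hlt'⟩ := he I' i hW' hi'
      -- The triple is the same for both arrays, since `W` is shared, and so is the choice of the
      -- corner; hence the corner sits at the same index.
      obtain rfl : q = q' := by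
        rw [hee, hq'] at hq
        exact Fin.ext (by exact_mod_cast hq.symm)
      have h1 := hv _ _ _ rfl hlt
      have h2 := hv _ _ _ rfl hlt'
      have h3 : path (I q) = path (I' q) := by
        refine ih q ?_
        rcases h1.length_le.lt_or_eq with h | h
        · exact .inl h
        · exact .inr ⟨h1.eq_of_length h, hlt⟩
      -- Both labels are prefixes, of the same length, of one already decoded label.
      rw [List.prefix_iff_eq_take] at h1 h2
      rw [h1, h2, hd i, h3]

/-- The arrays are grouped by their code. The constant 48 is 3 for the corner, 4 for the sequence of
lengths and 4 from the bound on the class sizes. -/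
theorem card_consistent_mul_le {path : {p : Point // p ∈ P} → List Bool}
    (hpath : IsCapLabelling path)
    (hcard : ∀ w, (Finset.univ.filter fun p => path p = w).card * 2 ^ w.length ≤ 4 * P.card)
    {H : List ℤ} {W : Fin P.card → ℤ × ℤ × ℤ} (K : Finset (InputArray P))
    (hK : ∀ I ∈ K, IsHullList I.points H ∧ IsWitnessList I.points W) :
    K.card * 6 ^ (∑ p, (path p).length) ≤
      4 ^ (∑ p, (path p).length) * (48 * P.card) ^ P.card := by
  classical
  set D := ∑ p, (path p).length with hD
  obtain ⟨e, he⟩ := exists_code hpath (H := H) (W := W)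
  let code : InputArray P → (Fin P.card → Fin 3) × (Fin P.card → ℕ) :=
    fun I => (e I, fun i => (path (I i)).length)
  have hsum : ∀ I : InputArray P, ∑ i, (path (I i)).length = D := fun I =>
    Equiv.sum_comp I fun p => (path p).length
  have himage : (K.image code).card ≤
      3 ^ P.card * (Finset.piAntidiag (Finset.univ : Finset (Fin P.card)) D).card := by
    have hsub : K.image code ⊆ Finset.univ ×ˢ Finset.piAntidiag Finset.univ D := by
      intro c hc
      obtain ⟨I, _, rfl⟩ := Finset.mem_image.1 hc
      simp [code, hsum]
    refine (Finset.card_le_card hsub).trans ?_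
    simp [Finset.card_product]
  have hfiber : ∀ c ∈ K.image code,
      (K.filter fun I => code I = c).card ≤ (4 * P.card) ^ P.card / 2 ^ D := by
    intro c hc
    obtain ⟨I₀, hI₀, rfl⟩ := Finset.mem_image.1 hc
    rw [Nat.le_div_iff_mul_le (by positivity)]
    -- Arrays with the same code have the same label at every index, so an entry can only vary
    -- within one label class.
    have hinj : (K.filter fun I => code I = code I₀).card ≤
        (Fintype.piFinset fun i => Finset.univ.filter fun p => path p = path (I₀ i)).card := by
      refine Finset.card_le_card_of_injOn (fun I i => I i) ?_ ?_
      · intro I hI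
        simp only [Finset.coe_filter, Set.mem_ofPred_eq] at hI
        simp only [Finset.mem_coe, Fintype.mem_piFinset, Finset.mem_filter, Finset.mem_univ,
          true_and]
        have h1 := hK I hI.1
        have h2 := hK I₀ hI₀
        exact he I I₀ h1.1 h1.2 h2.1 h2.2 (congrArg Prod.fst hI.2)
          fun i => congrFun (congrArg Prod.snd hI.2) i
      · intro I _ J _ h
        exact Equiv.ext fun i => congrFun h i
    calc _ ≤ (∏ i, (Finset.univ.filter fun p => path p = path (I₀ i)).card) * 2 ^ D := by
          rw [← Fintype.card_piFinset]; exact Nat.mul_le_mul_right _ hinj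
      _ = ∏ i, (Finset.univ.filter fun p => path p = path (I₀ i)).card *
            2 ^ (path (I₀ i)).length := by
          rw [Finset.prod_mul_distrib, Finset.prod_pow_eq_pow_sum, hsum]
      _ ≤ ∏ _i : Fin P.card, 4 * P.card := Finset.prod_le_prod' fun i _ => hcard _
      _ = (4 * P.card) ^ P.card := by simp
  have h1 := Finset.card_le_mul_card_image K _ hfiber
  have h2 := card_piAntidiag_mul_le (Fin P.card) D
  rw [Fintype.card_fin] at h2
  calc K.card * 6 ^ D ≤ ((4 * P.card) ^ P.card / 2 ^ D * (3 ^ P.card *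
        (Finset.piAntidiag (Finset.univ : Finset (Fin P.card)) D).card)) * 6 ^ D :=
        Nat.mul_le_mul_right _ (h1.trans (Nat.mul_le_mul_left _ himage))
    _ = ((4 * P.card) ^ P.card / 2 ^ D * 2 ^ D) * 3 ^ P.card *
        ((Finset.piAntidiag (Finset.univ : Finset (Fin P.card)) D).card * 3 ^ D) := by
        rw [show (6 : ℕ) ^ D = 2 ^ D * 3 ^ D by rw [← mul_pow]; norm_num]; ring
    _ ≤ (4 * P.card) ^ P.card * 3 ^ P.card * (4 ^ D * 4 ^ P.card) :=
        Nat.mul_le_mul (Nat.mul_le_mul_right _ (Nat.div_mul_le_self _ _)) h2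
    _ = 4 ^ D * (48 * P.card) ^ P.card := by
        rw [show 48 * P.card = (4 * P.card) * 3 * 4 by ring, mul_pow, mul_pow _ 4, mul_pow _ 3]
        ring

/-- The universal running time of a correct algorithm is at least the number of points, and, up to a
constant factor, the sum of the lengths of the labels in a cap labelling. -/
theorem lower_bound (hP : GeneralPosition P) {A : Algorithm} (hA : A.Correct) {T : ℕ}
    (hT : A.universal P ≤ T) :
    P.card < T ∧ ∀ path : {p : Point // p ∈ P} → List Bool, IsCapLabelling path →
      (∀ w, (Finset.univ.filter fun p => path p = w).card * 2 ^ w.length ≤ 4 * P.card) →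
      ∑ p, (path p).length ≤ 18 * T := by
  classical
  choose t o W hrun hhull hwit hW using hA P hP
  have htT : ∀ I, t I ≤ T := by
    intro I
    have h1 : A.runningTime I.points ≤ A.universal P := le_iSup (fun I : InputArray P =>
      A.runningTime I.points) I
    rw [Algorithm.runningTime_eq (hrun I)] at h1
    exact_mod_cast h1.trans hT
  have hnT : P.card < T := by
    let I : InputArray P := P.equivFin.symm
    have h1 := (hrun I).card_unwritten_lt fun i => by simp [hwit]
    simp only [Output.empty, Finset.filter_true, Finset.card_univ, Fintype.card_fin] at h1
    exact h1.trans_le (htT I)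
  refine ⟨hnT, fun path hpath hcard => ?_⟩
  obtain ⟨F, hF, hmem⟩ := exists_outputs (A P.card) T (A P.card).start (Output.empty P.card)
  set D := ∑ p, (path p).length with hD
  have hfact : Fintype.card (InputArray P) = P.card.factorial := by
    rw [Fintype.card_equiv (P.equivFin.symm : InputArray P), Fintype.card_fin]
  have hfiber : ∀ o' ∈ Finset.univ.image o, (Finset.univ.filter fun I => o I = o').card ≤
      4 ^ D * (48 * P.card) ^ P.card / 6 ^ D := by
    intro o' ho'
    obtain ⟨I₀, _, rfl⟩ := Finset.mem_image.1 ho'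
    rw [Nat.le_div_iff_mul_le (by positivity)]
    refine card_consistent_mul_le hpath hcard (H := (o I₀).hull) (W := W I₀) _ fun I hI => ?_
    have hI : o I = o I₀ := by simpa using hI
    refine ⟨hI ▸ hhull I, ?_⟩
    have : W I₀ = W I := by
      funext i
      have h1 := hwit I i
      rw [hI, hwit I₀ i] at h1
      exact Option.some_injective _ h1
    rw [this]; exact hW I
  -- All n! arrays are distributed over at most 2^T outputs, and the fibres are bounded by
  -- `card_consistent_mul_le`.
  have h1 := Finset.card_le_mul_card_image Finset.univ _ hfiber
  have h2 : (Finset.univ.image o).card ≤ 2 ^ T := by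
    refine (Finset.card_le_card ?_).trans hF
    intro o' ho'
    obtain ⟨I, _, rfl⟩ := Finset.mem_image.1 ho'
    exact hmem I.points _ _ (hrun I) (htT I)
  rw [Finset.card_univ, hfact] at h1
  refine le_of_pow_bound hnT.le (Nat.le_of_mul_le_mul_left (?_ : P.card.factorial * _ ≤
    P.card.factorial * _) (Nat.factorial_pos _))
  calc P.card.factorial * 6 ^ D
      ≤ (4 ^ D * (48 * P.card) ^ P.card / 6 ^ D * 2 ^ T) * 6 ^ D :=
        Nat.mul_le_mul_right _ (h1.trans (Nat.mul_le_mul_left _ h2))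
    _ = (4 ^ D * (48 * P.card) ^ P.card / 6 ^ D * 6 ^ D) * 2 ^ T := by ring
    _ ≤ 4 ^ D * (48 * P.card) ^ P.card * 2 ^ T :=
        Nat.mul_le_mul_right _ (Nat.div_mul_le_self _ _)
    _ = 4 ^ D * 48 ^ P.card * 2 ^ T * P.card ^ P.card := by rw [mul_pow]; ring
    _ ≤ 4 ^ D * 48 ^ P.card * 2 ^ T * (3 ^ P.card * P.card.factorial) :=
        Nat.mul_le_mul_left _ (pow_self_le_three_pow_mul_factorial _)
    _ = P.card.factorial * (2 ^ T * 4 ^ D * 144 ^ P.card) := by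
        rw [show (144 : ℕ) = 48 * 3 by norm_num, mul_pow]; ring

end LowerBound

/-! ### Cost bounds for programs without output -/

namespace Prog

/-- The program writes no output and executes at most `c` instructions. -/
def Cheap {n : ℕ} {α : Type} (I : Fin n → Point) (c : ℕ) (p : Prog n α) : Prop :=
  hullOut I p = [] ∧ writes I p = [] ∧ cost I p ≤ c

variable {n : ℕ} {α β : Type} {I : Fin n → Point}

theorem Cheap.mono {c c' : ℕ} {p : Prog n α} (h : Cheap I c p) (hc : c ≤ c') : Cheap I c' p :=
  ⟨h.1, h.2.1, h.2.2.trans hc⟩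

theorem cheap_pure (c : ℕ) (a : α) : Cheap I c (pure a : Prog n α) :=
  ⟨rfl, rfl, Nat.zero_le _⟩

theorem Cheap.bind {c c' d : ℕ} {p : Prog n α} {f : α → Prog n β} (hp : Cheap I c p)
    (hf : Cheap I c' (f (res I p))) (hd : c + c' ≤ d) : Cheap I d (p >>= f) := by
  refine ⟨by simp [hp.1, hf.1], by simp [hp.2.1, hf.2.1], ?_⟩
  rw [cost_bind]
  have := hp.2.2
  have := hf.2.2
  omega

theorem Cheap.ite {c : ℕ} {P : Prop} [Decidable P] {p q : Prog n α} (hp : P → Cheap I c p)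
    (hq : ¬ P → Cheap I c q) : Cheap I c (if P then p else q) := by
  split_ifs with h
  exacts [hp h, hq h]

end Prog

namespace KMS

open Prog

variable {n : ℕ} {α : Type} {I : Fin n → Point}

@[simp] theorem res_tick : res I tick = () := rfl
@[simp] theorem hullOut_tick : hullOut I tick = [] := rfl
@[simp] theorem writes_tick : writes I tick = [] := rfl

theorem cheap_tick : Cheap I 1 (tick : Prog n Unit) := ⟨rfl, rfl, le_rfl⟩

/-! ### Sorting and selection -/

/-- The comparisons of `less` have the cost at most `κ`. -/
def CheapLess (I : Fin n → Point) (κ : ℕ) (less : α → α → Prog n Bool) : Prop :=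
  ∀ a b, Cheap I κ (less a b)

/-- On the elements of the list, `less` compares the values of `key`. -/
def Compares (I : Fin n → Point) (key : α → ℝ) (less : α → α → Prog n Bool) (l : List α) : Prop :=
  ∀ a ∈ l, ∀ b ∈ l, (res I (less a b) = true ↔ key a < key b)

theorem Compares.mono {key : α → ℝ} {less : α → α → Prog n Bool} {l l' : List α}
    (h : Compares I key less l) (hl : l' ⊆ l) : Compares I key less l' :=
  fun a ha b hb => h a (hl ha) b (hl hb)

variable {κ : ℕ} {key : α → ℝ} {less : α → α → Prog n Bool}

theorem cheap_insert (h : CheapLess I κ less) (a : α) (l : List α) :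
    Cheap I ((κ + 1) * (l.length + 1)) (insert less a l) := by
  induction l with
  | nil => exact cheap_tick.bind (cheap_pure 0 _) (by simp)
  | cons b l ih =>
    refine cheap_tick.bind ((h a b).bind (Cheap.ite (fun _ => cheap_pure _ _)
      fun _ => ih.bind (cheap_pure 0 _) le_rfl) le_rfl) ?_
    simp only [List.length_cons]; ring_nf; omega

theorem res_insert (a : α) (l : List α) (h : Compares I key less (a :: l))
    (hl : l.Pairwise fun x y => key x ≤ key y) :
    (res I (insert less a l)).Perm (a :: l) ∧
      (res I (insert less a l)).Pairwise fun x y => key x ≤ key y := by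
  induction l with
  | nil => simp [insert]
  | cons b l ih =>
    obtain ⟨ih1, ih2⟩ := ih (h.mono (by simp)) (List.pairwise_cons.1 hl).2
    simp only [insert, res_bind]
    by_cases hab : key a < key b
    · rw [if_pos ((h a (by simp) b (by simp)).2 hab)]
      refine ⟨List.Perm.refl _, List.pairwise_cons.2 ⟨?_, hl⟩⟩
      intro y hy
      rcases List.mem_cons.1 hy with rfl | hy
      · exact hab.le
      · exact hab.le.trans ((List.pairwise_cons.1 hl).1 y hy)
    · rw [if_neg (fun hc => hab ((h a (by simp) b (by simp)).1 hc))]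
      simp only [res_bind, res_pure]
      refine ⟨(ih1.cons b).trans (List.Perm.swap _ _ _), List.pairwise_cons.2 ⟨?_, ih2⟩⟩
      intro y hy
      rcases List.mem_cons.1 (ih1.subset hy) with rfl | hy
      · exact not_lt.1 hab
      · exact (List.pairwise_cons.1 hl).1 y hy

theorem res_sort (l : List α) (h : Compares I key less l) :
    (res I (sort less l)).Perm l ∧ (res I (sort less l)).Pairwise fun x y => key x ≤ key y := by
  induction l with
  | nil => simp [sort]
  | cons a l ih =>
    obtain ⟨ih1, ih2⟩ := ih (h.mono (by simp))
    simp only [sort, res_bind]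
    obtain ⟨h1, h2⟩ := res_insert a _ (h.mono (List.cons_subset_cons a ih1.subset)) ih2
    exact ⟨h1.trans (ih1.cons a), h2⟩

theorem length_res_insert (a : α) (l : List α) :
    (res I (insert less a l)).length = l.length + 1 := by
  induction l with
  | nil => simp [insert]
  | cons b l ih =>
    simp only [insert, res_bind]
    split_ifs <;> simp [ih]

theorem length_res_sort (l : List α) : (res I (sort less l)).length = l.length := by
  induction l with
  | nil => simp [sort]
  | cons b l ih => simp [sort, length_res_insert, ih]

theorem cheap_sort (h : CheapLess I κ less) (l : List α) :
    Cheap I ((κ + 1) * (l.length + 1) * (l.length + 1)) (sort less l) := by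
  induction l with
  | nil => exact cheap_tick.bind (cheap_pure 0 _) (by simp)
  | cons a l ih =>
    refine cheap_tick.bind (ih.bind (cheap_insert h a _) le_rfl) ?_
    rw [length_res_sort]
    simp only [List.length_cons]
    nlinarith [Nat.zero_le κ, Nat.zero_le l.length, Nat.zero_le (κ * l.length)]

/-- Sorting a group of five costs at most 36(κ + 1), by the square bound of `cheap_sort`; one more
instruction visits the group. -/
theorem cheap_medians (h : CheapLess I κ less) (l : List α) :
    Cheap I (37 * (κ + 1) * (l.length + 1)) (medians less l) := by
  induction l using medians.induct with
  | case1 a b c d e l ih =>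
    rw [medians]
    refine cheap_tick.bind ((cheap_sort h [a, b, c, d, e]).bind (ih.bind (c' := 0) ?_ le_rfl)
      le_rfl) ?_
    · split <;> exact cheap_pure _ _
    · simp only [List.length_cons, List.length_nil]
      nlinarith [Nat.zero_le κ, Nat.zero_le l.length, Nat.zero_le (κ * l.length)]
  | case2 l hl =>
    rw [medians]
    · exact cheap_tick.bind (cheap_pure 0 _) (by nlinarith [Nat.zero_le κ])
    · exact hl

theorem exists_eq_of_length_eq_five {l : List α} (h : l.length = 5) :
    ∃ x y z u v, l = [x, y, z, u, v] := by
  match l, h with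
  | [x, y, z, u, v], _ => exact ⟨x, y, z, u, v, rfl⟩

theorem length_res_medians (l : List α) :
    (res I (medians less l)).length = l.length / 5 := by
  induction l using medians.induct with
  | case1 a b c d e l ih =>
    obtain ⟨x, y, z, u, v, hs⟩ := exists_eq_of_length_eq_five
      (length_res_sort (I := I) (less := less) [a, b, c, d, e])
    simp only [medians, res_bind, hs, res_pure, List.length_cons, ih]
    omega
  | case2 l hl =>
    rw [medians]
    · rw [res_bind, res_pure]
      match l, hl with
      | [], _ => simp
      | [_], _ => simp
      | [_, _], _ => simp
      | [_, _, _], _ => simp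
      | [_, _, _, _], _ => simp
      | a :: b :: c :: d :: e :: l, hl => exact absurd rfl (hl a b c d e l)
    · exact hl

/-- The middle element `z` of a sorted group brings two companions along on either side. -/
theorem three_mul_le_countP_of_pairwise {x y z u v : α}
    (h : [x, y, z, u, v].Pairwise fun x y => key x ≤ key y) (p : ℝ) :
    (key z ≤ p → 3 ≤ [x, y, z, u, v].countP fun x => key x ≤ p) ∧
    (p ≤ key z → 3 ≤ [x, y, z, u, v].countP fun x => p ≤ key x) := by
  simp only [List.pairwise_cons, List.mem_cons, forall_eq_or_imp] at h
  obtain ⟨⟨-, hxz, -⟩, ⟨hyz, -⟩, ⟨hzu, hzv, -⟩, -⟩ := h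
  constructor <;> intro hz
  · simp only [List.countP_cons, hz, hxz.trans hz, hyz.trans hz, decide_true, if_true]; omega
  · simp only [List.countP_cons, hz, hz.trans hzu, hz.trans hzv, decide_true, if_true]; omega

/-- The medians belong to the list, and every one of them accounts for three elements of the list
that are not larger, and for three that are not smaller. -/
theorem res_medians (l : List α) (h : Compares I key less l) :
    (res I (medians less l) ⊆ l) ∧
    (∀ p, 3 * (res I (medians less l)).countP (fun x => key x ≤ p) ≤
      l.countP fun x => key x ≤ p) ∧
    (∀ p, 3 * (res I (medians less l)).countP (fun x => p ≤ key x) ≤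
      l.countP fun x => p ≤ key x) := by
  induction l using medians.induct with
  | case1 a b c d e l ih =>
    have hsub : [a, b, c, d, e] ⊆ a :: b :: c :: d :: e :: l := List.subset_append_left _ l
    have hsub' : l ⊆ a :: b :: c :: d :: e :: l := List.subset_append_right [a, b, c, d, e] l
    obtain ⟨ih1, ih2, ih3⟩ := ih (h.mono hsub')
    obtain ⟨h1, h2⟩ := res_sort (I := I) (less := less) [a, b, c, d, e] (h.mono hsub)
    obtain ⟨x, y, z, u, v, hs⟩ := exists_eq_of_length_eq_five h1.length_eq
    rw [hs] at h1 h2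
    simp only [medians, res_bind, hs, res_pure]
    have hl : ∀ P : α → Bool, (a :: b :: c :: d :: e :: l).countP P =
        [x, y, z, u, v].countP P + l.countP P := by
      intro P
      rw [h1.countP_eq, ← List.countP_append]; rfl
    refine ⟨List.cons_subset.2 ⟨hsub (h1.subset (by simp)), fun t ht => hsub' (ih1 ht)⟩,
      fun p => ?_, fun p => ?_⟩
    · have e1 := ih2 p
      have e2 := (three_mul_le_countP_of_pairwise h2 p).1
      rw [hl, List.countP_cons]
      by_cases hz : key z ≤ p
      · have := e2 hz
        rw [if_pos (by simpa using hz)]; omega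
      · rw [if_neg (by simpa using hz)]; omega
    · have e1 := ih3 p
      have e2 := (three_mul_le_countP_of_pairwise h2 p).2
      rw [hl, List.countP_cons]
      by_cases hz : p ≤ key z
      · have := e2 hz
        rw [if_pos (by simpa using hz)]; omega
      · rw [if_neg (by simpa using hz)]; omega
  | case2 l hl =>
    rw [medians]
    · simp
    · exact hl

theorem cheap_split (h : CheapLess I κ less) (p : α) (l : List α) :
    Cheap I ((2 * κ + 1) * (l.length + 1)) (split less p l) := by
  induction l with
  | nil => exact cheap_tick.bind (cheap_pure 0 _) (by simp)
  | cons a l ih =>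
    refine cheap_tick.bind (ih.bind ((h a p).bind (Cheap.ite (fun _ => cheap_pure _ _)
      fun _ => (h p a).bind (Cheap.ite (fun _ => cheap_pure 0 _) fun _ => cheap_pure 0 _) le_rfl)
      le_rfl) le_rfl) ?_
    simp only [List.length_cons]; ring_nf; omega

theorem res_split (p : α) (l : List α) (h : Compares I key less (p :: l)) :
    res I (split less p l) = (l.filter fun x => key x < key p, l.filter fun x => key x = key p,
      l.filter fun x => key p < key x) := by
  induction l with
  | nil => simp [split]
  | cons a l ih =>
    have ih := ih (h.mono (List.cons_subset_cons p (by simp)))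
    simp only [split, res_bind, ih]
    by_cases h1 : key a < key p
    · rw [if_pos ((h a (by simp) p (by simp)).2 h1)]
      simp [h1, h1.ne, h1.le]
    · rw [if_neg fun hc => h1 ((h a (by simp) p (by simp)).1 hc)]
      rw [res_bind]
      by_cases h2 : key p < key a
      · rw [if_pos ((h p (by simp) a (by simp)).2 h2)]
        simp [h2, h2.ne', h2.le]
      · rw [if_neg fun hc => h2 ((h p (by simp) a (by simp)).1 hc)]
        have h3 : key a = key p := le_antisymm (not_lt.1 h2) (not_lt.1 h1)
        simp [h3]

theorem cheap_length (l : List α) : Cheap I (l.length + 1) (length l : Prog n ℕ) := by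
  induction l with
  | nil => exact cheap_tick.bind (cheap_pure 0 _) (by simp)
  | cons a l ih =>
    exact cheap_tick.bind (ih.bind (cheap_pure 0 _) le_rfl) (by simp; omega)

@[simp] theorem res_length (l : List α) : res I (length l : Prog n ℕ) = l.length := by
  induction l with
  | nil => simp [length]
  | cons a l ih => simp [length, ih]

theorem cheap_nth (d : α) (k : ℕ) (l : List α) : Cheap I (l.length + 1) (nth d k l : Prog n α) := by
  induction l generalizing k with
  | nil => cases k <;> exact cheap_tick.bind (cheap_pure 0 _) (by simp)
  | cons a l ih =>
    cases k with
    | zero => exact cheap_tick.bind (cheap_pure 0 _) (by simp)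
    | succ k => exact cheap_tick.bind (ih k) (by simp; omega)

theorem res_nth (d : α) (k : ℕ) (l : List α) :
    res I (nth d k l : Prog n α) = l.getD k d := by
  induction l generalizing k with
  | nil => cases k <;> simp [nth]
  | cons a l ih =>
    cases k with
    | zero => simp [nth]
    | succ k => simp [nth, ih]

/-- The element `x` has rank `k` in the list. -/
def HasRank (key : α → ℝ) (l : List α) (k : ℕ) (x : α) : Prop :=
  x ∈ l ∧ l.countP (fun y => key y < key x) ≤ k ∧ k < l.countP fun y => key y ≤ key x

theorem hasRank_getElem {l : List α} (hl : l.Pairwise fun x y => key x ≤ key y) {k : ℕ}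
    (hk : k < l.length) : HasRank key l k l[k] := by
  refine ⟨List.getElem_mem hk, ?_, ?_⟩
  · rw [show l.countP (fun y => key y < key l[k]) = (l.take k).countP (fun y => key y < key l[k]) +
      (l.drop k).countP (fun y => key y < key l[k]) by
        rw [← List.countP_append, List.take_append_drop]]
    have h1 : (l.drop k).countP (fun y => key y < key l[k]) = 0 := by
      rw [List.countP_eq_zero]
      intro a ha
      obtain ⟨i, hi, rfl⟩ := List.mem_iff_getElem.1 ha
      simp only [List.getElem_drop, decide_eq_true_eq, not_lt]
      rcases Nat.eq_zero_or_pos i with rfl | hi0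
      · simp
      · exact List.pairwise_iff_getElem.1 hl _ _ _ _ (by omega)
    have h2 := (l.take k).countP_le_length (p := fun y => decide (key y < key l[k]))
    simp only [List.length_take] at h2
    omega
  · rw [show l.countP (fun y => key y ≤ key l[k]) =
      (l.take (k + 1)).countP (fun y => key y ≤ key l[k]) +
      (l.drop (k + 1)).countP (fun y => key y ≤ key l[k]) by
        rw [← List.countP_append, List.take_append_drop]]
    have h1 : (l.take (k + 1)).countP (fun y => key y ≤ key l[k]) = (l.take (k + 1)).length := by
      rw [List.countP_eq_length]
      intro a ha
      obtain ⟨i, hi, rfl⟩ := List.mem_iff_getElem.1 ha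
      simp only [List.length_take] at hi
      simp only [List.getElem_take, decide_eq_true_eq]
      rcases (show i ≤ k by omega).lt_or_eq with hik | rfl
      · exact List.pairwise_iff_getElem.1 hl _ _ _ _ hik
      · exact le_rfl
    rw [h1, List.length_take]
    omega

theorem HasRank.perm {l l' : List α} {k : ℕ} {x : α} (h : HasRank key l k x) (hl : l.Perm l') :
    HasRank key l' k x :=
  ⟨hl.subset h.1, by rw [← hl.countP_eq]; exact h.2.1, by rw [← hl.countP_eq]; exact h.2.2⟩

theorem countP_lt_add_countP_le (l : List α) (p : ℝ) :
    l.countP (fun y => key y < p) + l.countP (fun y => p ≤ key y) = l.length := by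
  rw [List.length_eq_countP_add_countP (fun y => decide (key y < p))]
  congr 2
  funext y
  simp

theorem countP_le_add_countP_lt (l : List α) (p : ℝ) :
    l.countP (fun y => key y ≤ p) + l.countP (fun y => p < key y) = l.length := by
  rw [List.length_eq_countP_add_countP (fun y => decide (key y ≤ p))]
  congr 2
  funext y
  simp

theorem countP_lt_add_countP_eq (l : List α) (p : ℝ) :
    l.countP (fun y => key y < p) + l.countP (fun y => key y = p) =
      l.countP (fun y => key y ≤ p) := by
  induction l with
  | nil => rfl
  | cons a l ih =>
    simp only [List.countP_cons]
    rcases lt_trichotomy (key a) p with h | h | h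
    · simp [h, h.le, h.ne]; omega
    · simp [h]; omega
    · simp [h.not_gt, h.not_ge, h.ne']; omega

theorem countP_eq_add_of_le (l : List α) (p : ℝ) (Q : α → Bool)
    (hQ : ∀ x, key x ≤ p → Q x = true) : l.countP Q =
      (l.countP fun x => key x ≤ p) + (l.filter fun x => p < key x).countP Q := by
  induction l with
  | nil => rfl
  | cons a l ih =>
    by_cases ha : key a ≤ p
    · simp [ih, ha, hQ a ha, not_lt.2 ha]; omega
    · simp [List.countP_cons, ih, ha, not_le.1 ha]; omega

/-- An element of rank `g / 2` among the medians leaves out three tenths of the list on either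
side. -/
theorem countP_of_hasRank_medians (l : List α) (h : Compares I key less l) {p : α}
    (hp : HasRank key (res I (medians less l)) (l.length / 5 / 2) p) :
    l.countP (fun y => key y < key p) + 3 * ((l.length / 5 + 1) / 2) ≤ l.length ∧
    l.countP (fun y => key p < key y) + 3 * ((l.length / 5 + 1) / 2) ≤ l.length := by
  obtain ⟨-, h2, h3⟩ := res_medians l h
  -- With g medians and rank g / 2, more than g / 2 medians are at most the pivot and at least g - g
  -- / 2 are at least it. Both numbers are at least (g + 1) / 2, and each such median stands for
  -- three list elements.
  have e1 := h2 (key p)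
  have e2 := h3 (key p)
  have e3 := countP_lt_add_countP_le (key := key) (res I (medians less l)) (key p)
  have e4 := countP_lt_add_countP_le (key := key) l (key p)
  have e5 := countP_le_add_countP_lt (key := key) l (key p)
  have e6 := hp.2.1
  have e7 := hp.2.2
  rw [length_res_medians] at e3
  omega

theorem select_of_length_le (d : α) (fuel k : ℕ) {l : List α} (hl : l.length ≤ 5) :
    select less d (fuel + 1) k l = (do
      tick
      let s ← sort less l
      nth d k s) := by
  match l, hl with
  | [], _ => rfl
  | [_], _ => rfl
  | [_, _], _ => rfl
  | [_, _, _], _ => rfl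
  | [_, _, _, _], _ => rfl
  | [_, _, _, _, _], _ => rfl
  | _ :: _ :: _ :: _ :: _ :: _ :: l, hl => exact absurd hl (by simp only [List.length_cons]; omega)

theorem select_of_lt_length (d : α) (fuel k : ℕ) {l : List α} (hl : 5 < l.length) :
    select less d (fuel + 1) k l = (do
      tick
      let ms ← medians less l
      let g ← length ms
      let p ← select less d fuel (g / 2) ms
      let (lo, eq, hi) ← split less p l
      let a ← length lo
      let b ← length eq
      if k < a then select less d fuel k lo
      else if k < a + b then return p
      else select less d fuel (k - (a + b)) hi) := by
  match l, hl with
  | _ :: _ :: _ :: _ :: _ :: _ :: l, _ => rfl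

/-- Rank is defined by counting, not by position, which allows ties (parallel pairs of points do
occur). All sublists in the recursion are strictly shorter than the list, so the fuel suffices and
the default `d` is never returned. -/
theorem res_select (d : α) : ∀ (fuel k : ℕ) (l : List α), l.length ≤ fuel → k < l.length →
    Compares I key less l → HasRank key l k (res I (select less d fuel k l))
  | 0, k, l, hf, hk, _ => by omega
  | fuel + 1, k, l, hf, hk, h => by
    have ih := res_select d fuel
    by_cases hl6 : 5 < l.length
    · rw [select_of_lt_length d fuel k hl6]
      simp only [res_bind, res_length]
      have hmlen := length_res_medians (I := I) (less := less) l
      have hmsub := (res_medians l h).1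
      have hp := ih (l.length / 5 / 2) (res I (medians less l)) (by omega) (by omega)
        (h.mono hmsub)
      rw [hmlen]
      set p := res I (select less d fuel (l.length / 5 / 2) (res I (medians less l))) with hpdef
      have hpl : p ∈ l := hmsub hp.1
      have hcnt := countP_of_hasRank_medians l h hp
      have hlt3 := countP_lt_add_countP_eq (key := key) l (key p)
      have hle := countP_le_add_countP_lt (key := key) l (key p)
      rw [res_split p l (h.mono (by simp [hpl]))]
      simp only [← List.countP_eq_length_filter]
      split_ifs with hc1 hc2
      · obtain ⟨r1, r2, r3⟩ := ih k (l.filter fun x => key x < key p)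
          (by rw [← List.countP_eq_length_filter]; omega)
          (by rw [← List.countP_eq_length_filter]; omega)
          (h.mono (List.filter_subset_self l))
        set m := res I (select less d fuel k (l.filter fun x => key x < key p))
        have hm : key m < key p := by simpa using (List.mem_filter.1 r1).2
        refine ⟨(List.mem_filter.1 r1).1, ?_, r3.trans_le ?_⟩
        · rw [List.countP_filter] at r2
          refine (List.countP_mono_left ?_).trans r2
          intro x _ hx
          simp only [decide_eq_true_eq, Bool.and_eq_true] at hx ⊢
          exact ⟨hx, hx.trans hm⟩
        · rw [List.countP_filter]
          refine List.countP_mono_left ?_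
          intro x _ hx
          simp only [decide_eq_true_eq, Bool.and_eq_true] at hx ⊢
          exact hx.1
      · exact ⟨hpl, by rw [res_pure]; omega, by rw [res_pure]; omega⟩
      · obtain ⟨r1, r2, r3⟩ := ih (k - l.countP fun x => key x ≤ key p)
          (l.filter fun x => key p < key x)
          (by rw [← List.countP_eq_length_filter]; omega)
          (by rw [← List.countP_eq_length_filter]; omega)
          (h.mono (List.filter_subset_self l))
        rw [hlt3]
        set m := res I (select less d fuel (k - l.countP fun x => key x ≤ key p)
          (l.filter fun x => key p < key x))
        have hm : key p < key m := by simpa using (List.mem_filter.1 r1).2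
        refine ⟨(List.mem_filter.1 r1).1, ?_, ?_⟩
        -- The selected element exceeds the pivot, so all elements up to the pivot precede it; this
        -- restores the amount subtracted from `k`.
        · rw [countP_eq_add_of_le l (key p) _ fun x hx => by simpa using hx.trans_lt hm]; omega
        · rw [countP_eq_add_of_le l (key p) _ fun x hx => by simpa using hx.trans hm.le]; omega
    · rw [select_of_length_le d fuel k (by omega)]
      obtain ⟨h1, h2⟩ := res_sort (I := I) (less := less) l h
      simp only [res_bind]
      have hk' : k < (res I (sort less l)).length := by rw [h1.length_eq]; exact hk
      rw [res_nth, List.getD_eq_getElem _ _ hk']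
      exact (hasRank_getElem h2 hk').perm h1

/-- The two recursive calls work on about 1/5 and at most about 7/10 of the list. As the fractions
sum to less than 1, linear overhead keeps the total linear. -/
theorem cheap_select (hκ : CheapLess I κ less) (d : α) : ∀ (fuel k : ℕ) (l : List α),
    l.length ≤ fuel → k < l.length → Compares I key less l →
    Cheap I (1000 * (κ + 1) * l.length) (select less d fuel k l)
  | 0, k, l, hf, hk, h => cheap_pure _ _
  | fuel + 1, k, l, hf, hk, h => by
    have ih := cheap_select hκ d fuel
    by_cases hl6 : 5 < l.length
    · rw [select_of_lt_length d fuel k hl6]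
      have hmlen := length_res_medians (I := I) (less := less) l
      have hmsub := (res_medians l h).1
      have hp := res_select d fuel (l.length / 5 / 2) (res I (medians less l)) (by omega)
        (by omega) (h.mono hmsub)
      have hcp := ih (l.length / 5 / 2) (res I (medians less l)) (by omega)
        (by omega) (h.mono hmsub)
      rw [hmlen] at hcp
      set p := res I (select less d fuel (l.length / 5 / 2) (res I (medians less l))) with hpdef
      have hpl : p ∈ l := hmsub hp.1
      have hcnt := countP_of_hasRank_medians l h hp
      have hlt3 := countP_lt_add_countP_eq (key := key) l (key p)
      have hle := countP_le_add_countP_lt (key := key) l (key p)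
      set s' := l.length - 3 * ((l.length / 5 + 1) / 2) with hs'
      have hsub : ∀ P : α → Bool, (l.filter P) ⊆ l := fun P => List.filter_subset_self l
      have hrest : Cheap I ((l.length + 1) + ((l.length + 1) + 1000 * (κ + 1) * s'))
          (do
            let a ← length (l.filter fun x => key x < key p)
            let b ← length (l.filter fun x => key x = key p)
            if k < a then select less d fuel k (l.filter fun x => key x < key p)
            else if k < a + b then return p
            else select less d fuel (k - (a + b)) (l.filter fun x => key p < key x)) := by
        refine ((cheap_length _).mono (by simpa using List.length_filter_le _ l)).bind
          (((cheap_length _).mono (by simpa using List.length_filter_le _ l)).bind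
            (Cheap.ite (fun hc1 => ?_) fun hc1 => Cheap.ite (fun hc2 => cheap_pure _ _)
              fun hc2 => ?_) le_rfl) le_rfl
        · rw [res_length] at hc1
          refine (ih k _ ?_ hc1 (h.mono (hsub _))).mono (Nat.mul_le_mul_left _ ?_) <;>
            rw [← List.countP_eq_length_filter] <;> omega
        · simp only [res_length, ← List.countP_eq_length_filter] at hc1 hc2 ⊢
          refine (ih _ _ ?_ ?_ (h.mono (hsub _))).mono (Nat.mul_le_mul_left _ ?_) <;>
            rw [← List.countP_eq_length_filter] <;> omega
      refine cheap_tick.bind ((cheap_medians hκ l).bind ((cheap_length _).bind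
        ((show Cheap I (1000 * (κ + 1) * (l.length / 5)) _ from ?_).bind
        ((cheap_split hκ _ l).bind (c' := (l.length + 1) + ((l.length + 1) +
          1000 * (κ + 1) * s')) ?_ le_rfl) le_rfl) le_rfl) le_rfl) ?_
      · rw [res_length, hmlen]; exact hcp
      · rw [res_length, hmlen, ← hpdef, res_split p l (h.mono (by simp [hpl]))]
        exact hrest
      · rw [hmlen]
        -- The remaining tenth, about 100 units per element, pays for grouping, splitting and
        -- measuring, which take little more than 41; the constant 1000 is generous enough for the
        -- roundings at small lengths.
        have e1 : 1 + 37 * (l.length + 1) + (l.length / 5 + 1) + 1000 * (l.length / 5) +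
          2 * (l.length + 1) + 2 * (l.length + 1) + 1000 * s' ≤ 1000 * l.length := by omega
        have e2 := Nat.mul_le_mul_left (κ + 1) e1
        have e3 : 0 ≤ κ * (l.length / 5) := Nat.zero_le _
        have e4 : 0 ≤ κ * l.length := Nat.zero_le _
        nlinarith
    · rw [select_of_length_le d fuel k (by omega)]
      refine cheap_tick.bind ((cheap_sort hκ l).bind (cheap_nth d k _) le_rfl) ?_
      rw [length_res_sort]
      have e1 : (l.length + 1) * (l.length + 1) ≤ 6 * (l.length + 1) :=
        Nat.mul_le_mul_right _ (by omega)
      have e2 := Nat.mul_le_mul_left (κ + 1) e1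
      have e3 : 1 + 6 * (l.length + 1) + (l.length + 1) ≤ 1000 * l.length := by omega
      have e4 := Nat.mul_le_mul_left (κ + 1) e3
      have e5 : 0 ≤ κ * l.length := Nat.zero_le _
      nlinarith

end KMS

namespace KMS

open Prog

variable {n : ℕ} {I J : Fin n → Point} {flip : Bool}

/-! ### Elementary comparisons -/

theorem cheap_isLeft (i j : Fin n) : Cheap I 3 (isLeft i j) := by
  unfold isLeft
  refine Cheap.bind (c := 1) ⟨rfl, rfl, le_rfl⟩ (Cheap.ite (fun _ => cheap_pure 2 _) fun _ =>
    Cheap.bind (c := 1) ⟨rfl, rfl, le_rfl⟩ (Cheap.ite (fun _ => cheap_pure 1 _) fun _ =>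
      ⟨rfl, rfl, le_rfl⟩) le_rfl) le_rfl

theorem res_isLeft (i j : Fin n) : res I (isLeft i j) = true ↔
    (I i).1 < (I j).1 ∨ ((I i).1 = (I j).1 ∧ (I i).2 < (I j).2) := by
  by_cases h1 : (I i).1 < (I j).1
  · simp [isLeft, res, h1]
  · by_cases h2 : (I j).1 < (I i).1
    · simp [isLeft, res, h1, h2, h2.ne']
    · simp [isLeft, res, le_antisymm (not_lt.1 h2) (not_lt.1 h1)]

theorem cheap_before : CheapLess I 3 (before flip) := by
  intro i j
  unfold before
  cases flip
  exacts [cheap_isLeft _ _, cheap_isLeft _ _]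

theorem cheap_above (p q x : Fin n) : Cheap I 1 (above p q x) := ⟨rfl, rfl, le_rfl⟩

theorem cheap_slopeLess : CheapLess I 1 slopeLess := fun _ _ => ⟨rfl, rfl, le_rfl⟩

theorem cheap_onOrAbove (p q x : Fin n) : Cheap I 1 (onOrAbove p q x) :=
  Cheap.ite (fun _ => cheap_pure _ _) fun _ => cheap_above _ _ _

/-- Coordinates `J` of the points in which no vertical line contains two of them, in which the order
`before flip` is the order from left to right, and which have the same orientations. -/
structure Frame (I : Fin n → Point) (flip : Bool) (J : Fin n → Point) : Prop where
  before_iff : ∀ i j, res I (before flip i j) = true ↔ (J i).1 < (J j).1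
  cross_eq : ∀ p q r s, cross (I q - I p) (I s - I r) = cross (J q - J p) (J s - J r)
  inj : ∀ i j, (J i).1 = (J j).1 → i = j
  gp : ∀ i j k, i ≠ j → i ≠ k → j ≠ k → cross (J j - J i) (J k - J i) ≠ 0
  exists_dir : ∀ s : ℝ, ∃ v : Point, v ≠ 0 ∧ ∀ i j, cross v (I j) - cross v (I i) =
    ((J j).2 - (J i).2) - s * ((J j).1 - (J i).1)

/-- The point `x` is above the line from `p` to `q`. -/
def Above (J : Fin n → Point) (p q x : Fin n) : Prop := 0 < cross (J q - J p) (J x - J p)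

theorem Frame.res_above (F : Frame I flip J) (p q x : Fin n) :
    res I (above p q x) = true ↔ Above J p q x := by
  simp [above, res, Above, F.cross_eq]

theorem Frame.res_onOrAbove (F : Frame I flip J) (p q x : Fin n) :
    res I (onOrAbove p q x) = true ↔ x = p ∨ x = q ∨ Above J p q x := by
  unfold onOrAbove
  split_ifs with h
  · simp only [res_pure, true_iff]; tauto
  · rw [F.res_above]; tauto

/-- The slope of a segment. -/
noncomputable def slope (J : Fin n → Point) (e : Fin n × Fin n) : ℝ :=
  ((J e.2).2 - (J e.1).2) / ((J e.2).1 - (J e.1).1)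

theorem slope_mul {e : Fin n × Fin n} (h : (J e.1).1 < (J e.2).1) :
    (J e.2).2 - (J e.1).2 = slope J e * ((J e.2).1 - (J e.1).1) :=
  (div_mul_cancel₀ _ (sub_pos.2 h).ne').symm

/-- The cross product is the width of `e` times the difference of the intercepts of the lines
through the two points parallel to `e`. The segment from `u` to `x` may point in any direction, as
`support` requires. -/
theorem Frame.res_slopeLess (F : Frame I flip J) {e : Fin n × Fin n} (h : (J e.1).1 < (J e.2).1)
    (u x : Fin n) : res I (slopeLess e (u, x)) = true ↔
      (J u).2 - slope J e * (J u).1 < (J x).2 - slope J e * (J x).1 := by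
  have h1 : cross (J e.2 - J e.1) (J x - J u) = ((J e.2).1 - (J e.1).1) *
      (((J x).2 - slope J e * (J x).1) - ((J u).2 - slope J e * (J u).1)) := by
    simp only [cross, Prod.fst_sub, Prod.snd_sub]
    rw [slope_mul h]; ring
  simp only [slopeLess, res, F.cross_eq, decide_eq_true_eq]
  rw [h1, mul_pos_iff_of_pos_left (sub_pos.2 h), sub_pos]

theorem Frame.compares_slopeLess (F : Frame I flip J) {l : List (Fin n × Fin n)}
    (h : ∀ e ∈ l, (J e.1).1 < (J e.2).1) : Compares I (slope J) slopeLess l := by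
  intro e he f hf
  have h1 := F.res_slopeLess (h e he) f.1 f.2
  have h2 := slope_mul (h f hf)
  have h3 := h f hf
  rw [show ((f.1, f.2) : Fin n × Fin n) = f from rfl] at h1
  have h4 : (slope J f - slope J e) * ((J f.2).1 - (J f.1).1) =
      ((J f.2).2 - slope J e * (J f.2).1) - ((J f.1).2 - slope J e * (J f.1).1) := by
    rw [sub_mul, ← h2]; ring
  rw [h1, ← sub_pos, ← h4, mul_pos_iff_of_pos_right (sub_pos.2 h3), sub_pos]

theorem Frame.compares_before (F : Frame I flip J) (l : List (Fin n)) :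
    Compares I (fun i => (J i).1) (before flip) l :=
  fun i _ j _ => F.before_iff i j

/-! ### Upper hull edges -/

/-- All points other than `a` and `b` are below the line from `a` to `b`, which is directed from
left to right. -/
def UpperEdge (J : Fin n → Point) (a b : Fin n) : Prop :=
  (J a).1 < (J b).1 ∧ ∀ i, i ≠ a → i ≠ b → cross (J b - J a) (J i - J a) < 0

/-- All points are on or below some line through `p`. -/
def Supported (J : Fin n → Point) (p : Fin n) : Prop :=
  ∃ s : ℝ, ∀ i, (J i).2 - (J p).2 ≤ s * ((J i).1 - (J p).1)

theorem cross_eq_slope {a b : Fin n} (h : (J a).1 < (J b).1) (i : Fin n) :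
    cross (J b - J a) (J i - J a) = ((J b).1 - (J a).1) *
      (((J i).2 - (J a).2) - slope J (a, b) * ((J i).1 - (J a).1)) := by
  have := slope_mul (J := J) (e := (a, b)) h
  simp only [cross, Prod.fst_sub, Prod.snd_sub]
  simp only at this
  rw [this]; ring

theorem above_iff {a b : Fin n} (h : (J a).1 < (J b).1) (i : Fin n) :
    Above J a b i ↔ slope J (a, b) * ((J i).1 - (J a).1) < (J i).2 - (J a).2 := by
  unfold Above
  rw [cross_eq_slope h, mul_pos_iff_of_pos_left (sub_pos.2 h), sub_pos]

theorem UpperEdge.lt {a b : Fin n} (h : UpperEdge J a b) {i : Fin n} (ha : i ≠ a) (hb : i ≠ b) :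
    (J i).2 - (J a).2 < slope J (a, b) * ((J i).1 - (J a).1) := by
  have h1 := h.2 i ha hb
  rw [cross_eq_slope h.1] at h1
  have := (pos_iff_neg_of_mul_neg h1).1 (sub_pos.2 h.1)
  linarith

theorem UpperEdge.le {a b : Fin n} (h : UpperEdge J a b) (i : Fin n) :
    (J i).2 - (J a).2 ≤ slope J (a, b) * ((J i).1 - (J a).1) := by
  by_cases ha : i = a
  · simp [ha]
  · by_cases hb : i = b
    · rw [hb]; exact (slope_mul (e := (a, b)) h.1).le
    · exact (h.lt ha hb).le

theorem UpperEdge.supported_left {a b : Fin n} (h : UpperEdge J a b) : Supported J a :=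
  ⟨_, h.le⟩

theorem UpperEdge.supported_right {a b : Fin n} (h : UpperEdge J a b) : Supported J b := by
  refine ⟨slope J (a, b), fun i => ?_⟩
  have h1 := slope_mul (J := J) (e := (a, b)) h.1
  have h2 := h.le i
  simp only at h1
  linarith

theorem Frame.ne_zero_of_not_above (F : Frame I flip J) {a b i : Fin n} (h : (J a).1 < (J b).1)
    (ha : i ≠ a) (hb : i ≠ b) (hi : ¬ Above J a b i) :
    (J i).2 - (J a).2 < slope J (a, b) * ((J i).1 - (J a).1) := by
  have h1 := F.gp a b i (fun e => by simp [e] at h) ha.symm hb.symm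
  have h2 : cross (J b - J a) (J i - J a) < 0 := lt_of_le_of_ne (not_lt.1 hi) h1
  rw [cross_eq_slope h] at h2
  have := (pos_iff_neg_of_mul_neg h2).1 (sub_pos.2 h)
  linarith

/-- The vertical line just to the right of a point which is not the rightmost one is crossed by an
edge of the upper hull. -/
theorem Frame.exists_upperEdge (F : Frame I flip J) {m r : Fin n} (hr : (J m).1 < (J r).1) :
    ∃ a b, (J a).1 ≤ (J m).1 ∧ (J m).1 < (J b).1 ∧ UpperEdge J a b := by
  classical
  let L := Finset.univ.filter fun i => (J i).1 ≤ (J m).1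
  let R := Finset.univ.filter fun i => (J m).1 < (J i).1
  -- A min-max choice: every left point takes the right point that it sees at the largest slope, and
  -- the left point for which this slope is smallest is an endpoint of the bridge.
  have hex : ∀ a, ∃ b ∈ R, ∀ c ∈ R, slope J (a, c) ≤ slope J (a, b) := fun a =>
    Finset.exists_max_image R (fun c => slope J (a, c)) ⟨r, by simp [R, hr]⟩
  choose b hbR hb using hex
  obtain ⟨a, haL, ha⟩ := Finset.exists_min_image L (fun a => slope J (a, b a)) ⟨m, by simp [L]⟩
  have hR : ∀ c, c ∈ R ↔ (J m).1 < (J c).1 := fun c => by simp [R]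
  have hL : ∀ c, c ∈ L ↔ (J c).1 ≤ (J m).1 := fun c => by simp [L]
  have ham := (hL a).1 haL
  have hbm := (hR _).1 (hbR a)
  have hab := ham.trans_lt hbm
  refine ⟨a, b a, ham, hbm, hab, ?_⟩
  have hc : ∀ c ∈ R, (J c).2 - (J a).2 ≤ slope J (a, b a) * ((J c).1 - (J a).1) := by
    intro c hc
    have h1 : (J a).1 < (J c).1 := ham.trans_lt ((hR c).1 hc)
    rw [show (J c).2 - (J a).2 = _ from slope_mul (e := (a, c)) h1]
    exact mul_le_mul_of_nonneg_right (hb a c hc) (sub_pos.2 h1).le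
  intro i hia hib
  -- A left point above the line would see its own best right point, which is on or below the line,
  -- at a slope less than the minimum.
  have hle : (J i).2 - (J a).2 ≤ slope J (a, b a) * ((J i).1 - (J a).1) := by
    by_cases hi : i ∈ R
    · exact hc i hi
    · have hiL : i ∈ L := by rw [hL]; rw [hR] at hi; exact not_lt.1 hi
      have h1 := ha i hiL
      have h2 : (J i).1 < (J (b i)).1 := ((hL i).1 hiL).trans_lt ((hR _).1 (hbR i))
      have h3 : (J (b i)).2 - (J i).2 = _ := slope_mul (e := (i, b i)) h2
      have h4 := hc (b i) (hbR i)
      have h5 := mul_le_mul_of_nonneg_right h1 (sub_pos.2 h2).le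
      simp only at h3
      linarith
  refine lt_of_le_of_ne ?_ (F.gp a (b a) i (fun e => by rw [← e] at hab; exact lt_irrefl _ hab)
    hia.symm hib.symm)
  rw [cross_eq_slope hab]
  exact mul_nonpos_of_nonneg_of_nonpos (sub_pos.2 hab).le (by linarith)

/-! ### Bridge finding -/

theorem cheap_pairUp (l : List (Fin n)) : Cheap I (4 * (l.length + 1)) (pairUp flip l) := by
  induction l using pairUp.induct with
  | case1 a b l ih =>
    rw [pairUp]
    refine cheap_tick.bind (ih.bind ((cheap_before a b).bind (c' := 0) (Cheap.ite
      (fun _ => cheap_pure _ _) fun _ => cheap_pure _ _) le_rfl) le_rfl) ?_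
    simp only [List.length_cons]; omega
  | case2 l hl =>
    rw [pairUp]
    · exact cheap_tick.bind (cheap_pure 0 _) (by omega)
    · exact hl

theorem Frame.res_pairUp (F : Frame I flip J) (l : List (Fin n)) (hl : l.Nodup) :
    (((res I (pairUp flip l)).1.map Prod.fst ++ (res I (pairUp flip l)).1.map Prod.snd) ++
      (res I (pairUp flip l)).2).Perm l ∧
    (∀ e ∈ (res I (pairUp flip l)).1, (J e.1).1 < (J e.2).1) ∧
    (res I (pairUp flip l)).1.length = l.length / 2 := by
  induction l using pairUp.induct with
  | case1 a b l ih =>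
    obtain ⟨ih1, ih2, ih3⟩ := ih (List.nodup_cons.1 (List.nodup_cons.1 hl).2).2
    simp only [pairUp, res_bind]
    have hab : a ≠ b := by
      rintro rfl
      simp at hl
    have hperm : ∀ x y : Fin n, [x, y].Perm [a, b] → ∀ ps : List (Fin n × Fin n), ∀ rest,
        ((ps.map Prod.fst ++ ps.map Prod.snd) ++ rest).Perm l →
        (((((x, y) :: ps).map Prod.fst) ++ (((x, y) :: ps).map Prod.snd)) ++ rest).Perm
          (a :: b :: l) := by
      intro x y hxy ps rest h
      refine List.Perm.trans ?_ ((hxy.append_right l).trans (List.Perm.refl _))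
      refine List.Perm.trans ?_ (h.append_left [x, y])
      simp only [List.map_cons, List.cons_append, List.nil_append]
      refine List.Perm.cons x ?_
      simp only [List.append_assoc]
      exact List.perm_middle
    split_ifs with h
    · refine ⟨hperm a b (List.Perm.refl _) _ _ ih1, ?_, ?_⟩
      · simp only [res_pure, List.mem_cons, forall_eq_or_imp]
        exact ⟨(F.before_iff a b).1 h, ih2⟩
      · simp only [res_pure, List.length_cons, ih3]; omega
    · refine ⟨hperm b a (List.Perm.swap _ _ _) _ _ ih1, ?_, ?_⟩
      · simp only [res_pure, List.mem_cons, forall_eq_or_imp]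
        rw [F.before_iff] at h
        exact ⟨lt_of_le_of_ne (not_lt.1 h) fun e => hab (F.inj _ _ e).symm, ih2⟩
      · simp only [res_pure, List.length_cons, ih3]; omega
  | case2 l hl' =>
    rw [pairUp]
    · simp only [res_bind, res_pure, List.map_nil, List.nil_append, List.Perm.refl, true_and,
        List.length_nil, List.not_mem_nil, false_implies, implies_true]
      match l, hl' with
      | [], _ => simp
      | [_], _ => simp
      | a :: b :: l, hl => exact absurd rfl (hl a b l)
    · exact hl'

theorem cheap_support (e : Fin n × Fin n) (u v : Fin n) (l : List (Fin n)) :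
    Cheap I (9 * (l.length + 1)) (support flip e u v l) := by
  induction l generalizing u v with
  | nil => exact cheap_tick.bind (cheap_pure 0 _) (by simp)
  | cons x l ih =>
    have h1 : ∀ c u v, Cheap I (9 * (l.length + 1) + c) (support flip e u v l) :=
      fun c u v => (ih u v).mono (Nat.le_add_right _ _)
    refine cheap_tick.bind ((cheap_slopeLess _ _).bind (c' := 9 * (l.length + 1) + 7)
      (Cheap.ite (fun _ => h1 _ _ _) fun _ => (cheap_slopeLess _ _).bind
        (c' := 9 * (l.length + 1) + 6) (Cheap.ite (fun _ => h1 _ _ _) fun _ =>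
          (cheap_before _ _).bind (c' := 9 * (l.length + 1) + 3) (Cheap.ite (fun _ => h1 _ _ _)
            fun _ => (cheap_before _ _).bind (c' := 9 * (l.length + 1) + 0)
              (Cheap.ite (fun _ => h1 _ _ _) fun _ => h1 _ _ _) ?_) ?_) ?_) le_rfl) ?_
    all_goals (try simp only [List.length_cons]); omega

/-- Here `h` is the intercept of the line of slope `slope J e` through a point. The loop invariant
is that `u` and `v` are the extreme points, from left to right, among the maximisers of `h` seen so
far. -/
theorem Frame.res_support (F : Frame I flip J) {e : Fin n × Fin n} (he : (J e.1).1 < (J e.2).1)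
    (u v : Fin n) (l : List (Fin n)) (h : Fin n → ℝ)
    (hh : ∀ x, h x = (J x).2 - slope J e * (J x).1) (huv : h u = h v) (hX : (J u).1 ≤ (J v).1) :
    ∀ u' v', res I (support flip e u v l) = (u', v') →
      h u' = h v' ∧ (u' = u ∨ u' ∈ l) ∧ (v' = v ∨ v' ∈ l) ∧
      ∀ x, x = u ∨ x = v ∨ x ∈ l → h x ≤ h u' ∧
        (h x = h u' → (J u').1 ≤ (J x).1 ∧ (J x).1 ≤ (J v').1) := by
  induction l generalizing u v with
  | nil =>
    intro u' v' huv'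
    simp only [support, res_bind, res_pure, Prod.mk.injEq] at huv'
    obtain ⟨rfl, rfl⟩ := huv'
    simp only [List.not_mem_nil, or_false, true_and, huv]
    rintro x (rfl | rfl)
    · exact ⟨huv.le, fun _ => ⟨le_rfl, hX⟩⟩
    · exact ⟨le_rfl, fun _ => ⟨hX, le_rfl⟩⟩
  | cons x l ih =>
    intro u' v'
    simp only [support, res_bind]
    have e1 : ∀ a b, res I (slopeLess e (a, b)) = true ↔ h a < h b := fun a b => by
      rw [F.res_slopeLess he, hh, hh]
    by_cases h1 : h u < h x
    · rw [if_pos ((e1 u x).2 h1)]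
      intro hr
      obtain ⟨r1, r2, r3, r4⟩ := ih x x rfl le_rfl u' v' hr
      refine ⟨r1, .inr (by simpa using r2), .inr (by simpa using r3), ?_⟩
      rintro y (rfl | rfl | hy)
      · have := (r4 x (.inl rfl)).1
        exact ⟨by linarith, fun hc => by linarith⟩
      · have := (r4 x (.inl rfl)).1
        exact ⟨by linarith, fun hc => by linarith⟩
      · rcases List.mem_cons.1 hy with rfl | hy
        · exact r4 _ (.inl rfl)
        · exact r4 _ (.inr (.inr hy))
    · rw [if_neg (fun hc => h1 ((e1 u x).1 hc))]
      rw [res_bind]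
      by_cases h2 : h x < h u
      · rw [if_pos ((e1 x u).2 h2)]
        intro hr
        obtain ⟨r1, r2, r3, r4⟩ := ih u v huv hX u' v' hr
        refine ⟨r1, by simp only [List.mem_cons]; tauto, by simp only [List.mem_cons]; tauto, ?_⟩
        rintro y (rfl | rfl | hy)
        · exact r4 _ (.inl rfl)
        · exact r4 _ (.inr (.inl rfl))
        · rcases List.mem_cons.1 hy with rfl | hy
          · have := (r4 u (.inl rfl)).1
            exact ⟨by linarith, fun hc => by linarith⟩
          · exact r4 _ (.inr (.inr hy))
      · rw [if_neg (fun hc => h2 ((e1 x u).1 hc))]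
        have hxu : h x = h u := le_antisymm (not_lt.1 h1) (not_lt.1 h2)
        rw [res_bind]
        by_cases h3 : (J x).1 < (J u).1
        · rw [if_pos ((F.before_iff x u).2 h3)]
          intro hr
          obtain ⟨r1, r2, r3, r4⟩ := ih x v (hxu.trans huv) (h3.le.trans hX) u' v' hr
          refine ⟨r1, by simp only [List.mem_cons]; tauto, by simp only [List.mem_cons]; tauto, ?_⟩
          rintro y (rfl | rfl | hy)
          · have a1 := r4 x (.inl rfl)
            have a2 := r4 v (.inr (.inl rfl))
            refine ⟨by linarith, fun hc => ⟨?_, ?_⟩⟩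
            · exact (a1.2 (by linarith)).1.trans h3.le
            · exact hX.trans (a2.2 (by linarith)).2
          · exact r4 _ (.inr (.inl rfl))
          · rcases List.mem_cons.1 hy with rfl | hy
            · exact r4 _ (.inl rfl)
            · exact r4 _ (.inr (.inr hy))
        · rw [if_neg (fun hc => h3 ((F.before_iff x u).1 hc))]
          rw [res_bind]
          by_cases h4 : (J v).1 < (J x).1
          · rw [if_pos ((F.before_iff v x).2 h4)]
            intro hr
            obtain ⟨r1, r2, r3, r4⟩ := ih u x hxu.symm (not_lt.1 h3) u' v' hr
            refine ⟨r1, by simp only [List.mem_cons]; tauto,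
              by simp only [List.mem_cons]; tauto, ?_⟩
            rintro y (rfl | rfl | hy)
            · exact r4 _ (.inl rfl)
            · have a1 := r4 u (.inl rfl)
              have a2 := r4 x (.inr (.inl rfl))
              refine ⟨by linarith, fun hc => ⟨?_, ?_⟩⟩
              · exact (a1.2 (by linarith)).1.trans hX
              · exact h4.le.trans (a2.2 (by linarith)).2
            · rcases List.mem_cons.1 hy with rfl | hy
              · exact r4 _ (.inr (.inl rfl))
              · exact r4 _ (.inr (.inr hy))
          · rw [if_neg (fun hc => h4 ((F.before_iff v x).1 hc))]
            intro hr
            obtain ⟨r1, r2, r3, r4⟩ := ih u v huv hX u' v' hr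
            refine ⟨r1, by simp only [List.mem_cons]; tauto,
              by simp only [List.mem_cons]; tauto, ?_⟩
            rintro y (rfl | rfl | hy)
            · exact r4 _ (.inl rfl)
            · exact r4 _ (.inr (.inl rfl))
            · rcases List.mem_cons.1 hy with rfl | hy
              · have a1 := r4 u (.inl rfl)
                have a2 := r4 v (.inr (.inl rfl))
                refine ⟨by linarith, fun hc => ⟨?_, ?_⟩⟩
                · exact (a1.2 (by linarith)).1.trans (not_lt.1 h3)
                · exact (not_lt.1 h4).trans (a2.2 (by linarith)).2
              · exact r4 _ (.inr (.inr hy))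

theorem cheap_addLeft (ps : List (Fin n × Fin n)) (acc : List (Fin n)) :
    Cheap I (ps.length + 1) (addLeft ps acc) := by
  induction ps generalizing acc with
  | nil => exact cheap_tick.bind (cheap_pure 0 _) (by simp)
  | cons e ps ih => exact cheap_tick.bind (ih _) (by simp; omega)

theorem cheap_addRight (ps : List (Fin n × Fin n)) (acc : List (Fin n)) :
    Cheap I (ps.length + 1) (addRight ps acc) := by
  induction ps generalizing acc with
  | nil => exact cheap_tick.bind (cheap_pure 0 _) (by simp)
  | cons e ps ih => exact cheap_tick.bind (ih _) (by simp; omega)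

theorem cheap_addBoth (ps : List (Fin n × Fin n)) (acc : List (Fin n)) :
    Cheap I (ps.length + 1) (addBoth ps acc) := by
  induction ps generalizing acc with
  | nil => exact cheap_tick.bind (cheap_pure 0 _) (by simp)
  | cons e ps ih => exact cheap_tick.bind (ih _) (by simp; omega)

theorem res_addLeft (ps : List (Fin n × Fin n)) (acc : List (Fin n)) :
    (res I (addLeft ps acc)).Perm (ps.map Prod.fst ++ acc) := by
  induction ps generalizing acc with
  | nil => simp [addLeft]
  | cons e ps ih =>
    simp only [addLeft, res_bind]
    exact (ih _).trans List.perm_middle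

theorem res_addRight (ps : List (Fin n × Fin n)) (acc : List (Fin n)) :
    (res I (addRight ps acc)).Perm (ps.map Prod.snd ++ acc) := by
  induction ps generalizing acc with
  | nil => simp [addRight]
  | cons e ps ih =>
    simp only [addRight, res_bind]
    exact (ih _).trans List.perm_middle

theorem res_addBoth (ps : List (Fin n × Fin n)) (acc : List (Fin n)) :
    (res I (addBoth ps acc)).Perm (ps.map Prod.fst ++ (ps.map Prod.snd ++ acc)) := by
  induction ps generalizing acc with
  | nil => simp [addBoth]
  | cons e ps ih =>
    simp only [addBoth, res_bind]
    refine (ih _).trans ?_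
    simp only [List.map_cons, List.cons_append]
    refine ((List.perm_middle.append_left _).trans List.perm_middle).trans (List.Perm.cons _ ?_)
    exact List.perm_middle.append_left _

theorem bridge_of_length (m : Fin n) (fuel : ℕ) {x : Fin n} {S' S : List (Fin n)}
    (hS : x :: S' = S) (hS' : 2 ≤ S'.length) :
    bridge flip m (fuel + 1) S = (do
      tick
      let (pairs, rest) ← pairUp flip S
      let g ← length pairs
      let e ← select slopeLess (m, m) n (g / 2) pairs
      let (small, equal, large) ← split slopeLess e pairs
      let (u, v) ← support flip e x x S'
      if ← before flip m u then
        let c₁ ← addBoth large rest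
        let c₂ ← addLeft equal c₁
        let c₃ ← addLeft small c₂
        bridge flip m fuel c₃
      else if ← before flip m v then return (u, v)
      else
        let c₁ ← addBoth small rest
        let c₂ ← addRight equal c₁
        let c₃ ← addRight large c₂
        bridge flip m fuel c₃) := by
  subst hS
  match S', hS' with
  | _ :: _ :: _, _ => rfl

/-- All points are on or below the line of the edge, so from its endpoints nothing to the right is
seen at a larger slope. Thus a pair steeper than the bridge may lose its left point. -/
theorem UpperEdge.slope_le_of_left {a b : Fin n} (h : UpperEdge J a b) {c : Fin n × Fin n}
    (hc : (J c.1).1 < (J c.2).1) (hac : c.1 = a ∨ c.1 = b) :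
    slope J c ≤ slope J (a, b) := by
  have h1 := slope_mul hc
  have h2 := slope_mul (J := J) (e := (a, b)) h.1
  have h3 := h.le c.2
  refine le_of_mul_le_mul_right ?_ (sub_pos.2 hc)
  rw [← h1]
  simp only at h2
  rcases hac with e | e <;> rw [e] <;> linarith

/-- The mirror image: a pair less steep than the bridge may lose its right point. -/
theorem UpperEdge.le_slope_of_right {a b : Fin n} (h : UpperEdge J a b) {c : Fin n × Fin n}
    (hc : (J c.1).1 < (J c.2).1) (hac : c.2 = a ∨ c.2 = b) :
    slope J (a, b) ≤ slope J c := by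
  have h1 := slope_mul hc
  have h2 := slope_mul (J := J) (e := (a, b)) h.1
  have h3 := h.le c.1
  refine le_of_mul_le_mul_right ?_ (sub_pos.2 hc)
  rw [← h1]
  simp only at h2
  rcases hac with e | e <;> rw [e] <;> linarith

/-- The position of the bridge relative to the upper supporting line of slope `σ`, whose leftmost
and rightmost points are `u` and `v`. -/
theorem bridge_position {m a b u v : Fin n} (hab : UpperEdge J a b)
    (ham : (J a).1 ≤ (J m).1) (hmb : (J m).1 < (J b).1) (σ : ℝ) (h : Fin n → ℝ)
    (hh : ∀ x, h x = (J x).2 - σ * (J x).1) (huv : h u = h v)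
    (ha : h a ≤ h u ∧ (h a = h u → (J u).1 ≤ (J a).1 ∧ (J a).1 ≤ (J v).1))
    (hb : h b ≤ h u ∧ (h b = h u → (J u).1 ≤ (J b).1 ∧ (J b).1 ≤ (J v).1)) :
    ((J m).1 < (J u).1 → σ < slope J (a, b)) ∧
    ((J v).1 ≤ (J m).1 → slope J (a, b) < σ) ∧
    ((J u).1 ≤ (J m).1 → (J m).1 < (J v).1 → u = a ∧ v = b) := by
  have hs := slope_mul (J := J) (e := (a, b)) hab.1
  simp only at hs
  set s := slope J (a, b) with hsdef
  have hu := hab.le u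
  have hv := hab.le v
  rw [← hsdef] at hu hv
  refine ⟨fun hmu => ?_, fun hvm => ?_, fun hum hmv => ?_⟩
  -- `a` is to the left of `u`, the leftmost maximiser of `h`, so it is no maximiser. But `u` is on
  -- or below the bridge line, and for a bridge slope of at most `σ` this gives `h u ≤ h a`.
  · by_contra! hle
    have h1 : h a < h u := lt_of_le_of_ne ha.1 fun e => by linarith [(ha.2 e).1]
    rw [hh, hh] at h1
    have h2 := mul_le_mul_of_nonneg_right hle (sub_nonneg.2 (ham.trans hmu.le))
    linarith
  · by_contra! hle
    have h1 : h b < h v := huv ▸ lt_of_le_of_ne hb.1 fun e => by linarith [(hb.2 e).2]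
    rw [hh, hh] at h1
    have h2 := mul_le_mul_of_nonneg_right hle (sub_nonneg.2 (hvm.trans hmb.le))
    linarith
  · have hau := ha.1
    have hbu := hb.1
    rw [hh, hh] at hau hbu huv
    -- `v` is to the right of `a` and `u` to the left of `b`, so any slope other than `σ`
    -- contradicts maximality on one of the two sides. The supporting line is then the bridge line,
    -- which contains only `a` and `b`.
    have e1 : s = σ := by
      rcases lt_trichotomy s σ with hlt | heq | hlt
      · have := mul_lt_mul_of_pos_right hlt (sub_pos.2 (ham.trans_lt hmv))
        linarith
      · exact heq
      · have := mul_lt_mul_of_pos_right hlt (sub_pos.2 (hum.trans_lt hmb))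
        linarith
    have key : ∀ x, (J u).2 - σ * (J u).1 = (J x).2 - σ * (J x).1 → x = a ∨ x = b := by
      intro x hx
      by_contra! hne
      have := hab.lt hne.1 hne.2
      rw [← hsdef, e1] at this
      linarith
    constructor
    · rcases key u rfl with e | e
      · exact e
      · rw [e] at hum; linarith
    · rcases key v huv with e | e
      · rw [e] at hmv; linarith
      · exact e

theorem perm_filter_key {α : Type} (key : α → ℝ) (l : List α) (p : ℝ) :
    l.Perm ((l.filter fun x => key x < p) ++ ((l.filter fun x => key x = p) ++
      (l.filter fun x => p < key x))) := by
  induction l with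
  | nil => simp
  | cons a l ih =>
    rcases lt_trichotomy (key a) p with h | h | h
    · simpa [h, h.ne, h.le] using ih
    · simp only [h, lt_irrefl, decide_false, decide_true, List.filter_cons, if_true]
      exact (ih.cons a).trans List.perm_middle.symm
    · simp only [h, h.not_gt, h.ne', decide_false, decide_true, List.filter_cons, if_true]
      rw [← List.append_assoc] at ih ⊢
      exact (ih.cons a).trans List.perm_middle.symm

/-- Bookkeeping common to both pruning cases: `f` is the endpoint kept and `g` the one dropped in
the pairs of `A` and `B`, while the pairs of `C` are kept whole. Comparing multiplicities avoids
tracking the order of the lists. -/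
theorem perm_of_keep {ps A B C : List (Fin n × Fin n)} {rest S c₁ : List (Fin n)}
    {f g : Fin n × Fin n → Fin n}
    (hfg : ∀ qs : List (Fin n × Fin n), (qs.map f ++ qs.map g).Perm
      (qs.map Prod.fst ++ qs.map Prod.snd))
    (hS : ((ps.map Prod.fst ++ ps.map Prod.snd) ++ rest).Perm S)
    (hps : ps.Perm (A ++ (B ++ C)))
    (hc : c₁.Perm (A.map f ++ (B.map f ++ (C.map Prod.fst ++ (C.map Prod.snd ++ rest))))) :
    (c₁ ++ (A.map g ++ B.map g)).Perm S := by
  rw [List.perm_iff_count] at hS hc ⊢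
  intro x
  have h1 := hS x
  have h2 := hc x
  have h3 := (List.perm_iff_count.1 (hps.map Prod.fst)) x
  have h4 := (List.perm_iff_count.1 (hps.map Prod.snd)) x
  have h5 := (List.perm_iff_count.1 (hfg A)) x
  have h6 := (List.perm_iff_count.1 (hfg B)) x
  simp only [List.map_append, List.count_append] at h1 h2 h3 h4 h5 h6 ⊢
  omega

/-- If the bridge of the whole point set belongs to the list, then it is found, in linear time. -/
theorem Frame.bridge_spec (F : Frame I flip J) {m a b : Fin n} (hab : UpperEdge J a b)
    (ham : (J a).1 ≤ (J m).1) (hmb : (J m).1 < (J b).1) : ∀ (fuel : ℕ) (S : List (Fin n)),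
    S.length ≤ fuel → S.Nodup → a ∈ S → b ∈ S →
    res I (bridge flip m fuel S) = (a, b) ∧ Cheap I (7000 * S.length) (bridge flip m fuel S)
  | 0, S, hf, _, ha, _ => by
    have := List.length_pos_of_mem ha
    omega
  | fuel + 1, [], _, _, ha, _ => by simp at ha
  | fuel + 1, [x], _, _, ha, hb => by
    simp only [List.mem_singleton] at ha hb
    rw [ha, hb] at hab
    exact absurd hab.1 (lt_irrefl _)
  | fuel + 1, [x, y], _, hnd, ha, hb => by
    rw [show bridge flip m (fuel + 1) [x, y] = (do
      tick
      if ← before flip x y then return (x, y) else return (y, x)) from rfl]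
    refine ⟨?_, cheap_tick.bind ((cheap_before _ _).bind (c' := 0) (Cheap.ite
      (fun _ => cheap_pure _ _) fun _ => cheap_pure _ _) le_rfl) (by simp)⟩
    simp only [res_bind]
    have hne : a ≠ b := fun e => by rw [e] at hab; exact lt_irrefl _ hab.1
    simp only [List.mem_cons, List.not_mem_nil, or_false] at ha hb
    have hxy : (a = x ∧ b = y) ∨ (a = y ∧ b = x) := by
      rcases ha with ha | ha <;> rcases hb with hb | hb
      · exact absurd (ha.trans hb.symm) hne
      · exact .inl ⟨ha, hb⟩
      · exact .inr ⟨ha, hb⟩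
      · exact absurd (ha.trans hb.symm) hne
    rcases hxy with ⟨rfl, rfl⟩ | ⟨rfl, rfl⟩
    · rw [if_pos ((F.before_iff _ _).2 hab.1)]; rfl
    · rw [if_neg (fun hc => lt_asymm hab.1 ((F.before_iff _ _).1 hc))]; rfl
  | fuel + 1, x :: y :: z :: l, hf, hnd, ha, hb => by
    have ih := F.bridge_spec hab ham hmb fuel
    have hS2 : 2 ≤ (y :: z :: l).length := by simp
    generalize y :: z :: l = S' at *
    generalize hS : x :: S' = S at *
    rw [bridge_of_length m fuel hS hS2]
    have hSlen : S'.length + 1 = S.length := by rw [← hS]; rfl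
    have hS3 : 3 ≤ S.length := by omega
    have hSn : S.length ≤ n := by simpa using hnd.length_le_card
    obtain ⟨hp1, hp2, hp3⟩ := F.res_pairUp S hnd
    set ps := (res I (pairUp flip S)).1 with hps
    set rest := (res I (pairUp flip S)).2 with hrest
    have hcmp := F.compares_slopeLess hp2
    have hg : ps.length / 2 < ps.length := by omega
    have hrank := res_select (m, m) n (ps.length / 2) ps (by omega) hg hcmp
    have hcsel := cheap_select (I := I) (cheap_slopeLess) (m, m) n (ps.length / 2) ps (by omega) hg
      hcmp
    set e := res I (select slopeLess (m, m) n (ps.length / 2) ps) with he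
    have heps : e ∈ ps := hrank.1
    have hsplit := res_split e ps (hcmp.mono (by simp [heps]))
    have hperm := perm_filter_key (slope J) ps (slope J e)
    have hle := countP_lt_add_countP_eq (key := slope J) ps (slope J e)
    have hlen := countP_le_add_countP_lt (key := slope J) ps (slope J e)
    have hr1 := hrank.2.1
    have hr2 := hrank.2.2
    simp only [List.countP_eq_length_filter] at hle hlen hr1 hr2
    set small := ps.filter fun f => slope J f < slope J e with hsmall
    set equal := ps.filter fun f => slope J f = slope J e with hequal
    set large := ps.filter fun f => slope J e < slope J f with hlarge
    obtain ⟨u, v, huv⟩ : ∃ u v, res I (support flip e x x S') = (u, v) := ⟨_, _, rfl⟩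
    obtain ⟨s1, -, -, s4⟩ := F.res_support (hp2 e heps) x x S' _ (fun _ => rfl) rfl
      le_rfl u v huv
    have hmemS : ∀ t ∈ S, t = x ∨ t = x ∨ t ∈ S' := by
      intro t ht
      rw [← hS] at ht
      rcases List.mem_cons.1 ht with h | h
      exacts [.inl h, .inr (.inr h)]
    obtain ⟨pos1, pos2, pos3⟩ := bridge_position hab ham hmb (slope J e) _ (fun _ => rfl) s1
      (s4 a (hmemS a ha)) (s4 b (hmemS b hb))
    -- Both cases drop one endpoint in at least half of the pairs, none of them a bridge endpoint.
    -- The worst case is five points, of which four may remain; this is below the factor 5/6.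
    have recurse : ∀ (c A B C : List _) (f g : Fin n × Fin n → Fin n),
        (∀ qs : List (Fin n × Fin n), (qs.map f ++ qs.map g).Perm
          (qs.map Prod.fst ++ qs.map Prod.snd)) →
        ps.Perm (A ++ (B ++ C)) → ps.length - ps.length / 2 ≤ A.length + B.length →
        (∀ q ∈ A, g q ≠ a ∧ g q ≠ b) → (∀ q ∈ B, g q ≠ a ∧ g q ≠ b) →
        c.Perm (A.map f ++ (B.map f ++ (C.map Prod.fst ++ (C.map Prod.snd ++ rest)))) →
        6 * c.length ≤ 5 * S.length ∧ res I (bridge flip m fuel c) = (a, b) ∧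
          Cheap I (7000 * c.length) (bridge flip m fuel c) := by
      intro c A B C f g hfg hABC hAB hA hB hc
      have hk := perm_of_keep hfg hp1 hABC hc
      have hl := hk.length_eq
      simp only [List.length_append, List.length_map] at hl
      have hkeep : ∀ t ∈ S, (t = a ∨ t = b) → t ∈ c := by
        intro t ht htab
        rcases List.mem_append.1 (hk.symm.subset ht) with h | h
        · exact h
        · rcases List.mem_append.1 h with h | h
          · obtain ⟨q, hq, rfl⟩ := List.mem_map.1 h
            have := hA q hq; tauto
          · obtain ⟨q, hq, rfl⟩ := List.mem_map.1 h
            have := hB q hq; tauto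
      have hnd' := hk.nodup_iff.2 hnd
      exact ⟨by omega, ih c (by omega) hnd'.of_append_left (hkeep a ha (.inl rfl))
        (hkeep b hb (.inr rfl))⟩
    -- Pairs of slope at most that of the median pair are less steep than the bridge; the rank of
    -- the median makes them at least half of all pairs.
    have steep := fun h : (J m).1 < (J u).1 => recurse (res I (addLeft small (res I (addLeft equal
      (res I (addBoth large rest)))))) small equal large Prod.fst Prod.snd (fun _ => List.Perm.refl _)
      hperm (by omega)
      (fun q hq => by
        obtain ⟨hq1, hq2⟩ := List.mem_filter.1 hq
        rw [← not_or]
        exact fun hc => absurd (hab.le_slope_of_right (hp2 q hq1) hc)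
          (not_le.2 (lt_trans (by simpa using hq2) (pos1 h))))
      (fun q hq => by
        obtain ⟨hq1, hq2⟩ := List.mem_filter.1 hq
        rw [← not_or]
        exact fun hc => absurd (hab.le_slope_of_right (hp2 q hq1) hc)
          (not_le.2 (lt_of_eq_of_lt (by simpa using hq2) (pos1 h))))
      ((res_addLeft _ _).trans (((res_addLeft _ _).trans
        ((res_addBoth _ _).append_left _)).append_left _))
    have shallow := fun h : (J v).1 ≤ (J m).1 => recurse (res I (addRight large (res I (addRight equal
      (res I (addBoth small rest)))))) large equal small Prod.snd Prod.fst
      (fun _ => List.perm_append_comm)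
      (hperm.trans (by
        refine List.perm_append_comm.trans ?_
        rw [List.append_assoc]
        exact (List.perm_append_comm (l₁ := equal)).trans (by
          rw [List.append_assoc]
          exact List.perm_append_comm.append_left _)))
      (by omega)
      (fun q hq => by
        obtain ⟨hq1, hq2⟩ := List.mem_filter.1 hq
        rw [← not_or]
        exact fun hc => absurd (hab.slope_le_of_left (hp2 q hq1) hc)
          (not_le.2 (lt_trans (pos2 h) (by simpa using hq2))))
      (fun q hq => by
        obtain ⟨hq1, hq2⟩ := List.mem_filter.1 hq
        rw [← not_or]
        exact fun hc => absurd (hab.slope_le_of_left (hp2 q hq1) hc)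
          (not_le.2 (lt_of_lt_of_eq (pos2 h) (by simpa using (of_decide_eq_true hq2).symm))))
      ((res_addRight _ _).trans (((res_addRight _ _).trans
        ((res_addBoth _ _).append_left _)).append_left _))
    have hsmallg : small.length ≤ S.length := by omega
    have hequalg : equal.length ≤ S.length := by omega
    have hlargeg : large.length ≤ S.length := by omega
    constructor
    · simp only [res_bind, res_length]
      rw [← hps, ← he, hsplit]
      simp only [huv, ← hrest]
      split_ifs with h1
      · simp only [res_bind]
        exact (steep ((F.before_iff _ _).1 h1)).2.1
      · rw [res_bind]
        rw [F.before_iff] at h1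
        split_ifs with h2
        · rw [F.before_iff] at h2
          obtain ⟨rfl, rfl⟩ := pos3 (not_lt.1 h1) h2
          rfl
        · rw [F.before_iff] at h2
          simp only [res_bind]
          exact (shallow (not_lt.1 h2)).2.1
    -- 5840 exceeds 7000 · 5/6, the cost of the recursive call. Selection among at most |S| / 2
    -- pairs costs another 1000 per point.
    · have htail : Cheap I (6 + (3 * (S.length + 1) + 5840 * S.length)) (do
          if ← before flip m u then
            let c₁ ← addBoth large rest
            let c₂ ← addLeft equal c₁
            let c₃ ← addLeft small c₂
            bridge flip m fuel c₃
          else if ← before flip m v then return (u, v)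
          else
            let c₁ ← addBoth small rest
            let c₂ ← addRight equal c₁
            let c₃ ← addRight large c₂
            bridge flip m fuel c₃) := by
        refine (cheap_before m u).bind (c' := 3 + (3 * (S.length + 1) + 5840 * S.length))
          (Cheap.ite (fun h1 => ?_) fun h1 => (cheap_before m v).bind
            (c' := 3 * (S.length + 1) + 5840 * S.length) (Cheap.ite (fun h2 => cheap_pure _ _)
              fun h2 => ?_) ?_) ?_
        · obtain ⟨t1, -, t3⟩ := steep ((F.before_iff _ _).1 h1)
          exact (cheap_addBoth _ _).bind ((cheap_addLeft _ _).bind ((cheap_addLeft _ _).bind t3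
            le_rfl) le_rfl) (by omega)
        · rw [F.before_iff] at h2
          obtain ⟨t1, -, t3⟩ := shallow (not_lt.1 h2)
          exact (cheap_addBoth _ _).bind ((cheap_addRight _ _).bind ((cheap_addRight _ _).bind t3
            le_rfl) le_rfl) (by omega)
        · omega
        · omega
      refine cheap_tick.bind ((cheap_pairUp S).bind ((cheap_length ps).bind
        ((show Cheap I (2000 * ps.length) _ from ?_).bind ((cheap_split cheap_slopeLess _ _).bind
          ((cheap_support _ x x S').bind (c' := 6 + (3 * (S.length + 1) +
            5840 * S.length)) ?_ le_rfl) le_rfl) le_rfl) le_rfl) le_rfl) ?_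
      · rw [res_length, ← hps]
        exact hcsel.mono (by omega)
      · rw [res_length, ← hps, ← he, hsplit, huv]
        exact htail
      · rw [← hps]
        omega

end KMS

namespace KMS

open Prog

variable {n : ℕ} {I J : Fin n → Point} {flip : Bool}

/-! ### The recursion -/

/-- The point `x` is in the interior of the triangle `a b c`, which is oriented counterclockwise. -/
def Inside (J : Fin n → Point) (x a b c : Fin n) : Prop :=
  Above J a b x ∧ Above J b c x ∧ Above J c a x

/-- The arguments of a call of the recursive procedure: `S` consists of the points on or above the
line from `pl` to `pr`, which are vertices of the upper hull. -/
structure HullNode (J : Fin n → Point) (S : List (Fin n)) (pl pr : Fin n) : Prop where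
  nodup : S.Nodup
  le : (J pl).1 ≤ (J pr).1
  mem : ∀ x, x ∈ S ↔ x = pl ∨ x = pr ∨ Above J pl pr x
  left : Supported J pl
  right : Supported J pr

theorem not_above_self (p x : Fin n) : ¬ Above J p p x := by
  simp [Above, cross]

theorem above_swap (p q x : Fin n) : Above J q p x ↔ cross (J q - J p) (J x - J p) < 0 := by
  unfold Above
  rw [show cross (J p - J q) (J x - J q) = - cross (J q - J p) (J x - J p) by
    simp only [cross, Prod.fst_sub, Prod.snd_sub]; ring]
  exact neg_pos

theorem Frame.above_swap_of_not_above (F : Frame I flip J) {p q x : Fin n} (hpq : p ≠ q)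
    (hp : x ≠ p) (hq : x ≠ q) (h : ¬ Above J p q x) : Above J q p x := by
  rw [above_swap]
  exact lt_of_le_of_ne (not_lt.1 h) (F.gp p q x hpq hp.symm hq.symm)

/-- The supporting line at `p` is at least as steep as the chord and the one at `q` at most as
steep. Outside the strip between `p` and `q` one of them is on or below the line of the chord, so no
point there is above that line. -/
theorem Above.lt_of_supported {p q x : Fin n} (hpq : (J p).1 < (J q).1) (hp : Supported J p)
    (hq : Supported J q) (h : Above J p q x) : (J p).1 < (J x).1 ∧ (J x).1 < (J q).1 := by
  rw [above_iff hpq] at h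
  have hσ := slope_mul (J := J) (e := (p, q)) hpq
  simp only at hσ
  set σ := slope J (p, q)
  have hd := sub_pos.2 hpq
  obtain ⟨s, hs⟩ := hp
  obtain ⟨t, ht⟩ := hq
  have h1 : σ ≤ s := le_of_mul_le_mul_right (hσ ▸ hs q) hd
  have h2 : t ≤ σ := by
    refine le_of_mul_le_mul_right ?_ hd
    have := ht p
    linarith
  constructor <;> by_contra! hc
  · have := hs x
    have := mul_le_mul_of_nonneg_right h1 (sub_nonneg.2 hc)
    linarith
  · have := ht x
    have := mul_le_mul_of_nonneg_right h2 (sub_nonneg.2 hc)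
    linarith

/-- A vertex of the upper hull that is between two other points is above their connecting line. -/
theorem Frame.above_of_supported (F : Frame I flip J) {p q c : Fin n} (hpc : (J p).1 < (J c).1)
    (hcq : (J c).1 < (J q).1) (hc : Supported J c) : Above J p q c := by
  by_contra hna
  have hpq := hpc.trans hcq
  have h1 := F.ne_zero_of_not_above hpq (fun e => by simp [e] at hpc) (fun e => by simp [e] at hcq)
    hna
  have hσ := slope_mul (J := J) (e := (p, q)) hpq
  simp only at hσ
  set σ := slope J (p, q)
  obtain ⟨s, hs⟩ := hc
  have h2 := hs p
  have h3 := hs q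
  have h4 : s < σ := by
    refine lt_of_mul_lt_mul_right ?_ (sub_pos.2 hpc).le
    linarith
  have h5 := mul_lt_mul_of_pos_right h4 (sub_pos.2 hcq)
  linarith

/-- A point strictly below the chord of `a` and `b`, between them, admits no line through it that is
on or above both. -/
theorem UpperEdge.not_between {a b c : Fin n} (h : UpperEdge J a b) (hc : Supported J c)
    (hac : (J a).1 < (J c).1) (hcb : (J c).1 < (J b).1) : False := by
  have h1 := h.lt (i := c) (fun e => by simp [e] at hac) (fun e => by simp [e] at hcb)
  have hσ := slope_mul (J := J) (e := (a, b)) h.1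
  simp only at hσ
  set σ := slope J (a, b)
  obtain ⟨s, hs⟩ := hc
  have h2 := hs a
  have h3 := hs b
  have h4 : s < σ := by
    refine lt_of_mul_lt_mul_right ?_ (sub_pos.2 hac).le
    linarith
  have h5 := mul_lt_mul_of_pos_right h4 (sub_pos.2 hcb)
  linarith

theorem HullNode.lt_of_ne (F : Frame I flip J) {S : List (Fin n)} {pl pr : Fin n}
    (h : HullNode J S pl pr) (hne : pl ≠ pr) : (J pl).1 < (J pr).1 :=
  lt_of_le_of_ne h.le fun e => hne (F.inj _ _ e)

theorem HullNode.mem_range (F : Frame I flip J) {S : List (Fin n)} {pl pr : Fin n}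
    (h : HullNode J S pl pr) {x : Fin n} (hx : x ∈ S) :
    (J pl).1 ≤ (J x).1 ∧ (J x).1 ≤ (J pr).1 := by
  rcases (h.mem x).1 hx with rfl | rfl | hx
  · exact ⟨le_rfl, h.le⟩
  · exact ⟨h.le, le_rfl⟩
  · by_cases hne : pl = pr
    · rw [hne] at hx; exact absurd hx (not_above_self _ _)
    · have := hx.lt_of_supported (h.lt_of_ne F hne) h.left h.right
      exact ⟨this.1.le, this.2.le⟩

/-- Supplies the hypothesis of `Frame.bridge_spec` that the endpoints of the global hull edge belong
to the current list. -/
theorem HullNode.mem_of_supported (F : Frame I flip J) {S : List (Fin n)} {pl pr c : Fin n}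
    (h : HullNode J S pl pr) (h1 : (J pl).1 ≤ (J c).1) (h2 : (J c).1 ≤ (J pr).1)
    (hc : Supported J c) : c ∈ S := by
  rw [h.mem]
  rcases h1.lt_or_eq with h1 | h1
  · rcases h2.lt_or_eq with h2 | h2
    · exact .inr (.inr (F.above_of_supported h1 h2 hc))
    · exact .inr (.inl (F.inj _ _ h2))
  · exact .inl (F.inj _ _ h1).symm

theorem HullNode.pair_sublist_length {S : List (Fin n)} {pl pr : Fin n} (h : HullNode J S pl pr)
    (hne : pl ≠ pr) : 2 ≤ S.length := by
  have h1 : [pl, pr].Nodup := by simp [hne]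
  have h2 : [pl, pr] ⊆ S := by
    intro x hx
    rw [h.mem]
    simp only [List.mem_cons, List.not_mem_nil, or_false] at hx
    tauto
  exact (h1.subperm h2).length_le

theorem HullNode.eq_singleton {S : List (Fin n)} {p : Fin n} (h : HullNode J S p p) :
    S = [p] := by
  have h1 : ∀ x, x ∈ S ↔ x = p := fun x => by
    rw [h.mem]; simp [not_above_self]
  have h2 := (List.perm_ext_iff_of_nodup h.nodup (List.nodup_singleton p)).2 (by simpa using h1)
  exact List.perm_singleton.1 h2

open Classical in
theorem Frame.res_divide (F : Frame I flip J) (pl pi pj pr : Fin n) (l : List (Fin n)) :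
    res I (divide pl pi pj pr l) =
      (l.filter fun x => x = pl ∨ x = pi ∨ Above J pl pi x,
       l.filter fun x => ¬ (x = pl ∨ x = pi ∨ Above J pl pi x) ∧ (x = pj ∨ x = pr ∨ Above J pj pr x),
       l.filter fun x => ¬ (x = pl ∨ x = pi ∨ Above J pl pi x) ∧
        ¬ (x = pj ∨ x = pr ∨ Above J pj pr x)) := by
  induction l with
  | nil => simp [divide]
  | cons x l ih =>
    simp only [divide, res_bind, ih]
    by_cases h1 : x = pl ∨ x = pi ∨ Above J pl pi x
    · rw [if_pos ((F.res_onOrAbove _ _ _).2 h1)]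
      simp only [List.filter_cons, h1, res_pure, decide_true, if_true, not_true, false_and,
        decide_false, if_false, Bool.false_eq_true]
    · rw [if_neg (fun hc => h1 ((F.res_onOrAbove _ _ _).1 hc)), res_bind]
      by_cases h2 : x = pj ∨ x = pr ∨ Above J pj pr x
      · rw [if_pos ((F.res_onOrAbove _ _ _).2 h2)]
        simp only [List.filter_cons, h1, h2, res_pure, decide_true, if_true, not_true, and_false,
          decide_false, if_false, not_false_eq_true, and_self, Bool.false_eq_true]
      · rw [if_neg (fun hc => h2 ((F.res_onOrAbove _ _ _).1 hc))]
        simp only [List.filter_cons, h1, h2, res_pure, decide_true, if_true, and_false,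
          decide_false, if_false, not_false_eq_true, and_self, Bool.false_eq_true]

theorem cheap_divide (pl pi pj pr : Fin n) (l : List (Fin n)) :
    Cheap I (3 * (l.length + 1)) (divide pl pi pj pr l) := by
  induction l with
  | nil => exact cheap_tick.bind (cheap_pure 0 _) (by simp)
  | cons x l ih =>
    refine cheap_tick.bind (ih.bind ((cheap_onOrAbove _ _ _).bind (c' := 1) (Cheap.ite
      (fun _ => cheap_pure _ _) fun _ => (cheap_onOrAbove _ _ _).bind (c' := 0) (Cheap.ite
        (fun _ => cheap_pure _ _) fun _ => cheap_pure _ _) le_rfl) le_rfl) le_rfl) ?_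
    simp only [List.length_cons]; omega

theorem Frame.giveWitness_spec (F : Frame I flip J) (pl pr pj pi : Fin n) (l : List (Fin n)) :
    hullOut I (giveWitness pl pr pj pi l) = [] ∧
    cost I (giveWitness pl pr pj pi l) ≤ 3 * (l.length + 1) ∧
    (∀ w ∈ writes I (giveWitness pl pr pj pi l), w.1 ∈ l ∧
      ((Above J pl pj w.1 ∧ w.2 = (((pl : ℕ) : ℤ), ((pj : ℕ) : ℤ), ((pi : ℕ) : ℤ))) ∨
      (¬ Above J pl pj w.1 ∧ w.2 = (((pl : ℕ) : ℤ), ((pr : ℕ) : ℤ), ((pj : ℕ) : ℤ))))) ∧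
    ∀ x ∈ l, ∃ t, (x, t) ∈ writes I (giveWitness pl pr pj pi l) := by
  induction l with
  | nil =>
    simp only [giveWitness]
    exact ⟨rfl, by simp [tick, cost], by simp, by simp⟩
  | cons x l ih =>
    obtain ⟨h1, h2, h3, h4⟩ := ih
    have hx := F.res_above pl pj x
    have hc := (cheap_above (I := I) pl pj x)
    simp only [giveWitness, hullOut_bind, cost_bind, writes_bind]
    by_cases ha : Above J pl pj x
    · rw [hx.2 ha]
      refine ⟨?_, ?_, ?_, ?_⟩
      · simp [hullOut, hc.1, h1]
      · have := hc.2.2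
        have := (cheap_tick (I := I)).2.2
        simp only [if_true, cost_bind, cost, List.length_cons]; omega
      · simp only [hc.2.1, writes_tick, writes_bind, writes, List.nil_append, if_true, List.cons_append,
          List.mem_cons, forall_eq_or_imp]
        exact ⟨⟨.inl trivial, .inl ⟨ha, trivial⟩⟩, fun w hw => ⟨.inr (h3 w hw).1, (h3 w hw).2⟩⟩
      · intro y hy
        simp only [hc.2.1, writes_tick, writes_bind, writes, List.nil_append, if_true, List.cons_append]
        rcases List.mem_cons.1 hy with rfl | hy
        · exact ⟨_, List.mem_cons_self⟩
        · obtain ⟨t, ht⟩ := h4 y hy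
          exact ⟨t, List.mem_cons_of_mem _ ht⟩
    · rw [if_neg (fun h => ha (hx.1 h))]
      refine ⟨?_, ?_, ?_, ?_⟩
      · simp [hullOut, hc.1, h1]
      · have := hc.2.2
        have := (cheap_tick (I := I)).2.2
        simp only [cost_bind, cost, List.length_cons]; omega
      · simp only [hc.2.1, writes_tick, writes_bind, writes, List.nil_append, List.cons_append,
          List.mem_cons, forall_eq_or_imp]
        exact ⟨⟨.inl trivial, .inr ⟨ha, trivial⟩⟩, fun w hw => ⟨.inr (h3 w hw).1, (h3 w hw).2⟩⟩
      · intro y hy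
        simp only [hc.2.1, writes_tick, writes_bind, writes, List.nil_append, List.cons_append]
        rcases List.mem_cons.1 hy with rfl | hy
        · exact ⟨_, List.mem_cons_self⟩
        · obtain ⟨t, ht⟩ := h4 y hy
          exact ⟨t, List.mem_cons_of_mem _ ht⟩

/-- The triangle that is given as a witness contains its point. -/
theorem Frame.inside_of_not_mem (F : Frame I flip J) {pl pr a b x : Fin n} (hab : UpperEdge J a b)
    (hplb : pl ≠ b) (h : Above J pl pr x) (h1 : ¬ (x = pl ∨ x = a ∨ Above J pl a x))
    (h2 : ¬ (x = b ∨ x = pr ∨ Above J b pr x)) :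
    (Above J pl b x → Inside J x pl b a) ∧ (¬ Above J pl b x → Inside J x pl pr b) := by
  simp only [not_or] at h1 h2
  have hbr := (above_swap (J := J) a b x).2 (hab.2 x h1.2.1 h2.1)
  constructor <;> intro hx
  · refine ⟨hx, hbr, F.above_swap_of_not_above ?_ h1.1 h1.2.1 h1.2.2⟩
    -- If `pl = a`, the triangle would be degenerate; but then the diagonal is the bridge, and
    -- nothing is above the bridge.
    rintro rfl
    exact lt_asymm hx (hab.2 x h1.1 h2.1)
  · refine ⟨h, F.above_swap_of_not_above ?_ h2.1 h2.2.1 h2.2.2,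
      F.above_swap_of_not_above hplb h1.1 h2.1 hx⟩
    rintro rfl
    exact hx h

theorem report_spec (l r x : Fin n) : cost I (report flip l r x) ≤ 2 ∧
    writes I (report flip l r x) = [(x, (-1, -1, -1))] ∧
    hullOut I (report flip l r x) =
      ((if flip then [x].filter fun y => y ≠ l ∧ y ≠ r else [x]).map fun y : Fin n => ((y : ℕ) : ℤ)) := by
  unfold report
  simp only [cost_bind, writes_bind, hullOut_bind, writes, hullOut, cost]
  cases flip
  · simp [cost, writes, hullOut]
  · by_cases h : x = l ∨ x = r
    · simp only [true_and, h, if_true]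
      refine ⟨by simp, by simp, ?_⟩
      rcases h with h | h <;> simp [h]
    · simp only [h, and_false, if_false]
      rw [not_or] at h
      simp [cost, writes, hullOut, h]

theorem hull_succ (l r : Fin n) (fuel : ℕ) (S : List (Fin n)) {pl pr : Fin n} (hne : pl ≠ pr) :
    hull flip l r (fuel + 1) S pl pr = (do
      tick
      let k ← length S
      let m ← select (before flip) pl n ((k - 1) / 2) S
      let (pi, pj) ← bridge flip m n S
      let (s₁, s₂, s) ← divide pl pi pj pr S
      hull flip l r fuel s₁ pl pi
      hull flip l r fuel s₂ pj pr
      giveWitness pl pr pj pi s) := by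
  rw [hull, if_neg hne]

theorem hull_self (l r : Fin n) (fuel : ℕ) (S : List (Fin n)) (p : Fin n) :
    hull flip l r (fuel + 1) S p p = (do
      tick
      report flip l r p) := by
  rw [hull, if_pos rfl]

/-- Without ties the median divides the list exactly, up to rounding. -/
theorem countP_key_eq_le_one {α : Type} {key : α → ℝ} {l : List α} (hl : l.Nodup)
    (hkey : ∀ a b, key a = key b → a = b) (p : ℝ) : l.countP (fun x => key x = p) ≤ 1 := by
  induction l with
  | nil => simp
  | cons a l ih =>
    obtain ⟨h1, h2⟩ := List.nodup_cons.1 hl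
    rw [List.countP_cons]
    by_cases ha : key a = p
    · have : l.countP (fun x => key x = p) = 0 := by
        rw [List.countP_eq_zero]
        intro b hb hc
        rw [decide_eq_true_eq] at hc
        exact h1 (hkey a b (ha.trans hc.symm) ▸ hb)
      simp [this, ha]
    · simpa [ha] using ih h2

theorem perm_filter_three {α : Type} (l : List α) (P Q : α → Prop) [DecidablePred P]
    [DecidablePred Q] : l.Perm ((l.filter fun x => P x) ++ ((l.filter fun x => ¬ P x ∧ Q x) ++
      (l.filter fun x => ¬ P x ∧ ¬ Q x))) := by
  induction l with
  | nil => simp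
  | cons a l ih =>
    by_cases hP : P a
    · simpa [hP] using ih
    · by_cases hQ : Q a
      · simp only [List.filter_cons, hP, hQ, decide_true, decide_false, if_true, not_true, and_false,
          not_false_eq_true, and_self, Bool.false_eq_true, if_false]
        exact (ih.cons a).trans List.perm_middle.symm
      · simp only [List.filter_cons, hP, hQ, decide_true, decide_false, if_true, and_false,
          not_false_eq_true, and_self, Bool.false_eq_true, if_false]
        rw [← List.append_assoc] at ih ⊢
        exact (ih.cons a).trans List.perm_middle.symm

/-- One step of the recursion. -/
theorem Frame.hull_step (F : Frame I flip J) {S : List (Fin n)} {pl pr : Fin n}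
    (h : HullNode J S pl pr) (hne : pl ≠ pr) :
    ∃ (a b : Fin n) (S₁ S₂ R : List (Fin n)) (ws : List (Fin n × (ℤ × ℤ × ℤ))),
      (∀ (l r : Fin n) (fuel : ℕ),
        hullOut I (hull flip l r (fuel + 1) S pl pr) =
          hullOut I (hull flip l r fuel S₁ pl a) ++ hullOut I (hull flip l r fuel S₂ b pr) ∧
        writes I (hull flip l r (fuel + 1) S pl pr) =
          writes I (hull flip l r fuel S₁ pl a) ++
            (writes I (hull flip l r fuel S₂ b pr) ++ ws) ∧
        cost I (hull flip l r (fuel + 1) S pl pr) ≤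
          cost I (hull flip l r fuel S₁ pl a) + cost I (hull flip l r fuel S₂ b pr) +
            12000 * S.length) ∧
      UpperEdge J a b ∧ HullNode J S₁ pl a ∧ HullNode J S₂ b pr ∧ S.Perm (S₁ ++ (S₂ ++ R)) ∧
      2 * S₁.length ≤ S.length + 1 ∧ 2 * S₂.length ≤ S.length + 1 ∧
      (∀ w ∈ ws, w.1 ∈ R ∧ ∃ a b c : Fin n, w.2 = (((a : ℕ) : ℤ), ((b : ℕ) : ℤ), ((c : ℕ) : ℤ)) ∧
        Inside J w.1 a b c) ∧
      (∀ x ∈ R, ∃ t, (x, t) ∈ ws) := by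
  classical
  have hlt := h.lt_of_ne F hne
  have hS2 := h.pair_sublist_length hne
  have hSn : S.length ≤ n := by simpa using h.nodup.length_le_card
  have hrank := res_select pl n ((S.length - 1) / 2) S hSn (by omega) (F.compares_before S)
  have hcsel := cheap_select (I := I) cheap_before pl n ((S.length - 1) / 2) S hSn (by omega)
    (F.compares_before S)
  set m := res I (select (before flip) pl n ((S.length - 1) / 2) S) with hm
  have hc1 := countP_lt_add_countP_eq (key := fun i => (J i).1) S (J m).1
  have hc2 := countP_le_add_countP_lt (key := fun i => (J i).1) S (J m).1
  have hc3 := countP_key_eq_le_one h.nodup F.inj (J m).1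
  have hc4 : S.countP (fun i => (J i).1 < (J m).1) ≤ _ := hrank.2.1
  have hc5 : _ < S.countP fun i => (J i).1 ≤ (J m).1 := hrank.2.2
  have hmr := h.mem_range F hrank.1
  -- For a list of k ≥ 2 points exactly (k - 1) / 2 + 1 points, fewer than k, are not to the right
  -- of the element of rank (k - 1) / 2.
  obtain ⟨y, hy, hmy⟩ : ∃ y ∈ S, (J m).1 < (J y).1 := by
    have : 0 < S.countP fun y => (J m).1 < (J y).1 := by omega
    simpa [List.countP_pos_iff] using this
  have hmpr := hmy.trans_le (h.mem_range F hy).2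
  obtain ⟨a, b, ham, hmb, hab⟩ := F.exists_upperEdge hmpr
  -- The bridge is found as an edge of the hull of all points. It stays within the current strip,
  -- because `pl` and `pr` are hull vertices and none lies strictly between `a` and `b`.
  have hpla : (J pl).1 ≤ (J a).1 := by
    by_contra! hc
    exact hab.not_between h.left hc (hmr.1.trans_lt hmb)
  have hbpr : (J b).1 ≤ (J pr).1 := by
    by_contra! hc
    exact hab.not_between h.right (ham.trans_lt hmpr) hc
  have haS := h.mem_of_supported F hpla (ham.trans hmr.2) hab.supported_left
  have hbS := h.mem_of_supported F (hmr.1.trans hmb.le) hbpr hab.supported_right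
  obtain ⟨hbr, hcbr⟩ := F.bridge_spec hab ham hmb n S hSn h.nodup haS hbS
  have hdiv := F.res_divide pl a b pr S
  have hplb : pl ≠ b := by rintro rfl; linarith
  have hper := perm_filter_three S (fun x => x = pl ∨ x = a ∨ Above J pl a x)
    (fun x => x = b ∨ x = pr ∨ Above J b pr x)
  set S₁ := S.filter fun x => x = pl ∨ x = a ∨ Above J pl a x with hS1
  set S₂ := S.filter fun x => ¬ (x = pl ∨ x = a ∨ Above J pl a x) ∧
    (x = b ∨ x = pr ∨ Above J b pr x) with hS2'
  set R := S.filter fun x => ¬ (x = pl ∨ x = a ∨ Above J pl a x) ∧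
    ¬ (x = b ∨ x = pr ∨ Above J b pr x) with hR
  -- `a` is above the chord from `pl` to `pr` (otherwise `F.above_of_supported` fails), so the line
  -- from `pl` to `a` is steeper, and to the right of `pl` whatever is above it is also above the
  -- chord.
  have habove1 : ∀ x, Above J pl a x → x ∈ S ∧ (J x).1 ≤ (J a).1 := by
    intro x hx
    have hne' : pl ≠ a := by rintro rfl; exact not_above_self _ _ hx
    have hla := lt_of_le_of_ne hpla fun e => hne' (F.inj _ _ e)
    obtain ⟨r1, r2⟩ := hx.lt_of_supported hla h.left hab.supported_left
    refine ⟨(h.mem x).2 (.inr (.inr ?_)), r2.le⟩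
    have h1 := F.above_of_supported hla (ham.trans_lt hmpr) hab.supported_left
    rw [above_iff hlt] at h1 ⊢
    rw [above_iff hla] at hx
    have h2 := slope_mul (J := J) (e := (pl, a)) hla
    simp only at h2
    rw [h2] at h1
    have h3 := lt_of_mul_lt_mul_right h1 (sub_pos.2 hla).le
    have h4 := mul_lt_mul_of_pos_right h3 (sub_pos.2 r1)
    linarith
  have habove2 : ∀ x, Above J b pr x → x ∈ S ∧ (J b).1 ≤ (J x).1 := by
    intro x hx
    have hne' : b ≠ pr := by rintro rfl; exact not_above_self _ _ hx
    have hla := lt_of_le_of_ne hbpr fun e => hne' (F.inj _ _ e)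
    obtain ⟨r1, r2⟩ := hx.lt_of_supported hla hab.supported_right h.right
    refine ⟨(h.mem x).2 (.inr (.inr ?_)), r1.le⟩
    have h1 := F.above_of_supported (hmr.1.trans_lt hmb) hla hab.supported_right
    rw [above_iff hlt] at h1 ⊢
    rw [above_iff hla] at hx
    have h2 := slope_mul (J := J) (e := (b, pr)) hla
    have h2' := slope_mul (J := J) (e := (pl, pr)) hlt
    simp only at h2 h2'
    have h3 : slope J (b, pr) < slope J (pl, pr) := by
      refine lt_of_mul_lt_mul_right ?_ (sub_pos.2 hla).le
      linarith
    have h4 := mul_lt_mul_of_pos_right h3 (sub_pos.2 r2)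
    linarith
  have hmem1 : ∀ x, x ∈ S₁ ↔ x = pl ∨ x = a ∨ Above J pl a x := by
    intro x
    rw [hS1, List.mem_filter, decide_eq_true_eq]
    refine ⟨fun hx => hx.2, fun hx => ⟨?_, hx⟩⟩
    rcases hx with rfl | rfl | hx
    · exact (h.mem _).2 (.inl rfl)
    · exact haS
    · exact (habove1 x hx).1
  have hle1 : ∀ x, x ∈ S₁ → (J x).1 ≤ (J m).1 := by
    intro x hx
    rcases (hmem1 x).1 hx with rfl | rfl | hx
    · exact hmr.1
    · exact ham
    · exact (habove1 x hx).2.trans ham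
  have hmem2 : ∀ x, x ∈ S₂ ↔ x = b ∨ x = pr ∨ Above J b pr x := by
    intro x
    rw [hS2', List.mem_filter, decide_eq_true_eq]
    refine ⟨fun hx => hx.2.2, fun hx => ?_⟩
    have hxS : x ∈ S ∧ (J m).1 < (J x).1 := by
      rcases hx with rfl | rfl | hx
      · exact ⟨hbS, hmb⟩
      · exact ⟨(h.mem _).2 (.inr (.inl rfl)), hmpr⟩
      · exact ⟨(habove2 x hx).1, hmb.trans_le (habove2 x hx).2⟩
    refine ⟨hxS.1, fun hc => ?_, hx⟩
    exact absurd (hle1 x ((hmem1 x).2 hc)) (not_le.2 hxS.2)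
  have hlt2 : ∀ x, x ∈ S₂ → (J m).1 < (J x).1 := by
    intro x hx
    rcases (hmem2 x).1 hx with rfl | rfl | hx
    · exact hmb
    · exact hmpr
    · exact hmb.trans_le (habove2 x hx).2
  have hlen1 : S₁.length ≤ S.countP fun x => (J x).1 ≤ (J m).1 := by
    rw [hS1, ← List.countP_eq_length_filter]
    refine List.countP_mono_left fun x hx hx' => ?_
    rw [decide_eq_true_eq] at hx' ⊢
    exact hle1 x ((hmem1 x).2 hx')
  have hlen2 : S₂.length ≤ S.countP fun x => (J m).1 < (J x).1 := by
    rw [hS2', ← List.countP_eq_length_filter]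
    refine List.countP_mono_left fun x hx hx' => ?_
    rw [decide_eq_true_eq] at hx' ⊢
    exact hlt2 x ((hmem2 x).2 hx'.2)
  obtain ⟨g1, g2, g3, g4⟩ := F.giveWitness_spec pl pr b a R
  refine ⟨a, b, S₁, S₂, R, writes I (giveWitness pl pr b a R), fun l r fuel => ?_, hab,
    ⟨h.nodup.filter _, hpla, hmem1, h.left, hab.supported_left⟩,
    ⟨h.nodup.filter _, hbpr, hmem2, hab.supported_right, h.right⟩, hper, by omega, by omega,
    fun w hw => ?_, g4⟩
  · rw [hull_succ l r fuel S hne]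
    have c1 := cheap_length (I := I) S
    have c2 := cheap_divide (I := I) pl a b pr S
    refine ⟨?_, ?_, ?_⟩
    · simp only [hullOut_bind, hullOut_tick, res_length, c1.1, ← hm, hcsel.1, hbr, hcbr.1, hdiv,
        c2.1, g1, List.nil_append, List.append_nil]
    · simp only [writes_bind, writes_tick, res_length, c1.2.1, ← hm, hcsel.2.1, hbr, hcbr.2.1, hdiv,
        c2.2.1, List.nil_append]
    -- Per point: 4000 for the median (a comparison costs 3), 7000 for the bridge, and a few
    -- instructions for the other passes over the list.
    · simp only [cost_bind, res_length, ← hm, hbr, hdiv]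
      have e1 := (cheap_tick (I := I)).2.2
      have e2 := c1.2.2
      have e3 := hcsel.2.2
      have e4 := hcbr.2.2
      have e5 := c2.2.2
      have e6 : R.length ≤ S.length := List.length_filter_le _ _
      omega
  · obtain ⟨hwR, hw'⟩ := g3 w hw
    refine ⟨hwR, ?_⟩
    rw [hR, List.mem_filter, decide_eq_true_eq] at hwR
    have hab' : Above J pl pr w.1 := by
      rcases (h.mem _).1 hwR.1 with e | e | e
      · exact absurd (Or.inl e) hwR.2.1
      · exact absurd (Or.inr (Or.inl e)) hwR.2.2
      · exact e
    obtain ⟨i1, i2⟩ := F.inside_of_not_mem hab hplb hab' hwR.2.1 hwR.2.2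
    rcases hw' with ⟨hA, hw'⟩ | ⟨hA, hw'⟩
    · exact ⟨pl, b, a, hw', i1 hA⟩
    · exact ⟨pl, pr, b, hw', i2 hA⟩

/-- The output of the recursive procedure: `Q` is the list of the vertices of the upper hull from
`pl` to `pr`. -/
theorem Frame.hull_output (F : Frame I flip J) (l r : Fin n) : ∀ (fuel : ℕ) (S : List (Fin n))
    (pl pr : Fin n), S.length ≤ fuel → HullNode J S pl pr →
    ∃ Q : List (Fin n),
      hullOut I (hull flip l r fuel S pl pr) =
        (if flip then Q.filter fun x => x ≠ l ∧ x ≠ r else Q).map (fun x : Fin n => ((x : ℕ) : ℤ)) ∧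
      Q.Nodup ∧ Q ⊆ S ∧ Q.head? = some pl ∧ Q.getLast? = some pr ∧
      Q.IsChain (UpperEdge J) ∧ (∀ x ∈ Q, Supported J x) ∧
      (∀ w ∈ writes I (hull flip l r fuel S pl pr),
        (w.2 = (-1, -1, -1) ∧ Supported J w.1) ∨
        ∃ a b c : Fin n, w.2 = (((a : ℕ) : ℤ), ((b : ℕ) : ℤ), ((c : ℕ) : ℤ)) ∧
          Inside J w.1 a b c) ∧
      (∀ x ∈ S, ∃ t, (x, t) ∈ writes I (hull flip l r fuel S pl pr)) ∧
      (∀ x ∈ S, x ∈ Q ∨ ∃ a b c : Fin n, Inside J x a b c)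
  | 0, S, pl, pr, hf, h => by
    have := List.length_pos_of_mem ((h.mem pl).2 (.inl rfl))
    omega
  | fuel + 1, S, pl, pr, hf, h => by
    by_cases hne : pl = pr
    · subst hne
      obtain rfl := h.eq_singleton
      obtain ⟨-, r2, r3⟩ := report_spec (I := I) (flip := flip) l r pl
      rw [hull_self]
      refine ⟨[pl], ?_, by simp, by simp, rfl, rfl, by simp, by simpa using h.left, ?_, ?_,
        by simp⟩
      · simp only [hullOut_bind, hullOut_tick, List.nil_append, r3]
      · simp only [writes_bind, writes_tick, List.nil_append, r2, List.mem_singleton, forall_eq]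
        exact .inl ⟨trivial, h.left⟩
      · simp [r2]
    · obtain ⟨a, b, S₁, S₂, R, ws, hout, hab, hN1, hN2, hper, hl1, hl2, hws, hws'⟩ :=
        F.hull_step h hne
      obtain ⟨o1, o2, -⟩ := hout l r fuel
      have hS2 := h.pair_sublist_length hne
      obtain ⟨Q1, p1, p2, p3, p4, p5, p6, p7, p8, p9, p10⟩ :=
        F.hull_output l r fuel S₁ pl a (by omega) hN1
      obtain ⟨Q2, q1, q2, q3, q4, q5, q6, q7, q8, q9, q10⟩ :=
        F.hull_output l r fuel S₂ b pr (by omega) hN2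
      have hnd := hper.nodup_iff.1 h.nodup
      have hmem : ∀ x, x ∈ S ↔ x ∈ S₁ ∨ x ∈ S₂ ∨ x ∈ R := fun x => by
        rw [hper.mem_iff, List.mem_append, List.mem_append]
      have hdisj : Q1.Disjoint Q2 := fun x hx1 hx2 =>
        (List.disjoint_of_nodup_append hnd) (p3 hx1) (List.mem_append_left _ (q3 hx2))
      refine ⟨Q1 ++ Q2, ?_, p2.append q2 hdisj, ?_, ?_, ?_, ?_, ?_, ?_, ?_, ?_⟩
      · rw [o1, p1, q1]
        split_ifs <;> simp
      · intro x hx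
        rw [hmem]
        rcases List.mem_append.1 hx with hx | hx
        exacts [.inl (p3 hx), .inr (.inl (q3 hx))]
      · rw [List.head?_append, p4]; rfl
      · rw [List.getLast?_append, q5]; rfl
      -- The two chains are joined by the bridge.
      · refine List.isChain_append.2 ⟨p6, q6, ?_⟩
        intro x hx y hy
        rw [p5] at hx
        rw [q4] at hy
        obtain rfl : a = x := by simpa using hx
        obtain rfl : b = y := by simpa using hy
        exact hab
      · intro x hx
        rcases List.mem_append.1 hx with hx | hx
        exacts [p7 x hx, q7 x hx]
      · intro w hw
        rw [o2, List.mem_append, List.mem_append] at hw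
        rcases hw with hw | hw | hw
        exacts [p8 w hw, q8 w hw, .inr (hws w hw).2]
      · intro x hx
        rw [o2]
        rcases (hmem x).1 hx with hx | hx | hx
        · obtain ⟨t, ht⟩ := p9 x hx
          exact ⟨t, by simp [ht]⟩
        · obtain ⟨t, ht⟩ := q9 x hx
          exact ⟨t, by simp [ht]⟩
        · obtain ⟨t, ht⟩ := hws' x hx
          exact ⟨t, by simp [ht]⟩
      · intro x hx
        rw [List.mem_append]
        rcases (hmem x).1 hx with hx | hx | hx
        · exact (p10 x hx).imp_left .inl
        · exact (q10 x hx).imp_left .inr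
        · obtain ⟨t, ht⟩ := hws' x hx
          obtain ⟨a, b, c, -, hi⟩ := (hws _ ht).2
          exact .inr ⟨a, b, c, hi⟩

theorem sum_map_add_one {α : Type} (l : List α) (f : α → ℕ) :
    (l.map fun x => f x + 1).sum = (l.map f).sum + l.length := by
  simp [List.sum_map_add]

/-- The running time of the recursive procedure is proportional to the total number of calls that
the points take part in. The calls form a binary tree, and every point is labelled with the address
of the last call that it takes part in. -/
theorem Frame.hull_cost (F : Frame I flip J) (l r : Fin n) : ∀ (fuel : ℕ) (S : List (Fin n))
    (pl pr : Fin n), S.length ≤ fuel → HullNode J S pl pr →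
    ∃ path : Fin n → List Bool,
      cost I (hull flip l r fuel S pl pr) ≤
        12000 * (S.map fun x => (path x).length + 1).sum ∧
      (∀ w, (S.countP fun x => path x = w) * 2 ^ w.length + 2 ≤ 2 * S.length ∨
        (S.length = 1 ∧ (S.countP fun x => path x = w) * 2 ^ w.length ≤ 1)) ∧
      ∀ w, ∃ v : Point, v ≠ 0 ∧ ∀ x ∈ S, path x = w → ∀ y, cross v (I x) < cross v (I y) →
        y ∈ S ∧ w <+: path y
  | 0, S, pl, pr, hf, h => by
    have := List.length_pos_of_mem ((h.mem pl).2 (.inl rfl))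
    omega
  | fuel + 1, S, pl, pr, hf, h => by
    by_cases hne : pl = pr
    · subst hne
      obtain rfl := h.eq_singleton
      obtain ⟨r1, -, -⟩ := report_spec (I := I) (flip := flip) l r pl
      rw [hull_self]
      -- A one-point list violates the bound with the additive 2, which is why the count has a
      -- second alternative.
      refine ⟨fun _ => [], ?_, fun w => .inr ⟨rfl, ?_⟩, fun w => ?_⟩
      · have := (cheap_tick (I := I)).2.2
        simp only [cost_bind, List.map_cons, List.map_nil, List.sum_cons, List.sum_nil,
          List.length_nil]
        omega
      · cases w <;> simp
      · obtain ⟨s, hs⟩ := h.left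
        obtain ⟨v, hv, hv'⟩ := F.exists_dir s
        refine ⟨v, hv, fun x hx _ y hy => ?_⟩
        obtain rfl := List.mem_singleton.1 hx
        have := hs y
        have := hv' x y
        linarith
    · obtain ⟨a, b, S₁, S₂, R, ws, hout, hab, hN1, hN2, hper, hl1, hl2, -, -⟩ :=
        F.hull_step h hne
      obtain ⟨-, -, o3⟩ := hout l r fuel
      have hS2 := h.pair_sublist_length hne
      obtain ⟨path1, p1, p2, p3⟩ := F.hull_cost l r fuel S₁ pl a (by omega) hN1
      obtain ⟨path2, q1, q2, q3⟩ := F.hull_cost l r fuel S₂ b pr (by omega) hN2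
      have hnd := hper.nodup_iff.1 h.nodup
      have hmem : ∀ x, x ∈ S ↔ x ∈ S₁ ∨ x ∈ S₂ ∨ x ∈ R := fun x => by
        rw [hper.mem_iff, List.mem_append, List.mem_append]
      have hlen := hper.length_eq
      rw [List.length_append, List.length_append] at hlen
      have hd1 : ∀ x ∈ S₁, x ∉ S₂ ∧ x ∉ R := fun x hx => by
        have := List.disjoint_of_nodup_append hnd hx
        simpa using this
      have hd2 : ∀ x ∈ S₂, x ∉ R := fun x hx =>
        List.disjoint_of_nodup_append hnd.of_append_right hx
      -- `false` and `true` lead to the two recursive calls; the points of `R` leave the recursion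
      -- here.
      let path : Fin n → List Bool := fun x =>
        if x ∈ S₁ then false :: path1 x else if x ∈ S₂ then true :: path2 x else []
      have e1 : ∀ x ∈ S₁, path x = false :: path1 x := fun x hx => by simp [path, hx]
      have e2 : ∀ x ∈ S₂, path x = true :: path2 x := fun x hx => by
        have : x ∉ S₁ := fun hc => (hd1 x hc).1 hx
        simp [path, hx, this]
      have e3 : ∀ x ∈ R, path x = [] := fun x hx => by
        have h1 : x ∉ S₁ := fun hc => (hd1 x hc).2 hx
        have h2 : x ∉ S₂ := fun hc => hd2 x hc hx
        simp [path, h1, h2]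
      refine ⟨path, ?_, fun w => .inl ?_, fun w => ?_⟩
      · have hsum : (S.map fun x => (path x).length + 1).sum =
            (S₁.map fun x => (path1 x).length + 1).sum + (S₂.map fun x => (path2 x).length + 1).sum +
              S.length := by
          rw [(hper.map _).sum_eq, List.map_append, List.map_append, List.sum_append,
            List.sum_append, hlen]
          rw [List.map_congr_left (l := S₁) (g := fun x => ((path1 x).length + 1) + 1)
              fun x hx => by simp [e1 x hx],
            List.map_congr_left (l := S₂) (g := fun x => ((path2 x).length + 1) + 1)
              fun x hx => by simp [e2 x hx],
            List.map_congr_left (l := R) (g := fun _ => 1) fun x hx => by simp [e3 x hx]]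
          rw [sum_map_add_one S₁, sum_map_add_one S₂, List.map_const', List.sum_replicate, smul_eq_mul,
            mul_one]
          omega
        rw [hsum]
        omega
      · have hcount : (S.countP fun x => path x = w) = (S₁.countP fun x => path x = w) +
            ((S₂.countP fun x => path x = w) + R.countP fun x => path x = w) := by
          rw [hper.countP_eq, List.countP_append, List.countP_append]
        rw [List.countP_congr (l := S₁) (q := fun x => false :: path1 x = w)
            fun x hx => by rw [e1 x hx],
          List.countP_congr (l := S₂) (q := fun x => true :: path2 x = w)
            fun x hx => by rw [e2 x hx],
          List.countP_congr (l := R) (q := fun x => [] = w)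
            fun x hx => by rw [e3 x hx]] at hcount
        -- The additive 2 absorbs the rounding: doubling 2s - 2 and adding 2 gives 4s - 2, at most
        -- 2|S| because 2s ≤ |S| + 1. At the root, `R` misses at least one point for each of the two
        -- nonempty sublists.
        have hpos1 := List.length_pos_of_mem ((hN1.mem pl).2 (.inl rfl))
        have hpos2 := List.length_pos_of_mem ((hN2.mem b).2 (.inl rfl))
        match w with
        | [] =>
          simp only [reduceCtorEq, decide_false, List.countP_false, Function.const_apply, decide_true, List.countP_true]
            at hcount
          simp only [List.length_nil, pow_zero]
          omega
        | false :: w =>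
          simp only [List.cons.injEq, true_and, reduceCtorEq, decide_false, List.countP_false,
            Function.const_apply,
            Bool.true_eq_false, false_and] at hcount
          rw [hcount, List.length_cons, pow_succ, add_zero, add_zero, ← mul_assoc]
          rcases p2 w with h1 | ⟨h1, h2⟩ <;> omega
        | true :: w =>
          simp only [List.cons.injEq, true_and, reduceCtorEq, decide_false, List.countP_false,
            Function.const_apply,
            Bool.false_eq_true, false_and] at hcount
          rw [hcount, List.length_cons, pow_succ, zero_add, add_zero, ← mul_assoc]
          rcases q2 w with h1 | ⟨h1, h2⟩ <;> omega
      · match w with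
        | [] =>
          have hlt := h.lt_of_ne F hne
          -- The direction normal to the chord: points exceeding one on or above the chord are above
          -- it, hence in `S`.
          obtain ⟨v, hv, hv'⟩ := F.exists_dir (slope J (pl, pr))
          refine ⟨v, hv, fun x hx _ y hy => ⟨(h.mem y).2 (.inr (.inr ?_)), List.nil_prefix⟩⟩
          rw [above_iff hlt]
          have h1 : slope J (pl, pr) * ((J x).1 - (J pl).1) ≤ (J x).2 - (J pl).2 := by
            rcases (h.mem x).1 hx with rfl | rfl | hx
            · simp
            · exact (slope_mul (e := (pl, x)) hlt).ge
            · exact ((above_iff hlt x).1 hx).le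
          have h2 := hv' x y
          linarith
        | false :: w =>
          obtain ⟨v, hv, hv'⟩ := p3 w
          refine ⟨v, hv, fun x hx hxw y hy => ?_⟩
          have hx1 : x ∈ S₁ := by
            rcases (hmem x).1 hx with hx | hx | hx
            · exact hx
            · rw [e2 x hx] at hxw; simp at hxw
            · rw [e3 x hx] at hxw; simp at hxw
          rw [e1 x hx1] at hxw
          obtain ⟨hy1, hy2⟩ := hv' x hx1 (List.cons.inj hxw).2 y hy
          exact ⟨(hmem y).2 (.inl hy1), by rw [e1 y hy1]; exact (List.prefix_cons_inj _).2 hy2⟩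
        | true :: w =>
          obtain ⟨v, hv, hv'⟩ := q3 w
          refine ⟨v, hv, fun x hx hxw y hy => ?_⟩
          have hx1 : x ∈ S₂ := by
            rcases (hmem x).1 hx with hx | hx | hx
            · rw [e1 x hx] at hxw; simp at hxw
            · exact hx
            · rw [e3 x hx] at hxw; simp at hxw
          rw [e2 x hx1] at hxw
          obtain ⟨hy1, hy2⟩ := hv' x hx1 (List.cons.inj hxw).2 y hy
          exact ⟨(hmem y).2 (.inr (.inl hy1)), by
            rw [e2 y hy1]; exact (List.prefix_cons_inj _).2 hy2⟩

end KMS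

/-! ### Points in triangles -/

/-- The three cross products, divided by their sum, are barycentric coordinates. Thus the open set
where all three are positive is contained in the triangle. -/
theorem mem_interior_triangle {a b c x : Point} (h1 : 0 < cross (b - a) (x - a))
    (h2 : 0 < cross (c - b) (x - b)) (h3 : 0 < cross (a - c) (x - c)) :
    x ∈ interior (convexHull ℝ {a, b, c}) := by
  have hopen : ∀ p q : Point, IsOpen {y : Point | 0 < cross q (y - p)} := fun p q =>
    isOpen_lt continuous_const ((continuous_cross q).comp (continuous_id.sub continuous_const))
  refine mem_interior.2 ⟨{y | 0 < cross (b - a) (y - a)} ∩ ({y | 0 < cross (c - b) (y - b)} ∩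
    {y | 0 < cross (a - c) (y - c)}), ?_, (hopen _ _).inter ((hopen _ _).inter (hopen _ _)),
    h1, h2, h3⟩
  rintro y ⟨hy1, hy2, hy3⟩
  rw [Set.mem_ofPred_eq] at hy1 hy2 hy3
  set D := cross (b - a) (y - a) + cross (c - b) (y - b) + cross (a - c) (y - c) with hD
  have hD0 : 0 < D := by positivity
  have hDne := hD0.ne'
  have key : y = ∑ i : Fin 3, (![cross (c - b) (y - b) / D, cross (a - c) (y - c) / D,
      cross (b - a) (y - a) / D] i) • (![a, b, c] i) := by
    simp only [Fin.sum_univ_three, Matrix.cons_val_zero, Matrix.cons_val_one, Matrix.cons_val]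
    refine Prod.ext ?_ ?_
    · simp only [Prod.fst_add, Prod.smul_fst, smul_eq_mul]
      field_simp
      simp only [hD, cross, Prod.fst_sub, Prod.snd_sub]
      ring
    · simp only [Prod.snd_add, Prod.smul_snd, smul_eq_mul]
      field_simp
      simp only [hD, cross, Prod.fst_sub, Prod.snd_sub]
      ring
  rw [key]
  refine (convex_convexHull ℝ _).sum_mem ?_ ?_ ?_
  · intro i _
    fin_cases i
    exacts [(div_pos hy2 hD0).le, (div_pos hy3 hD0).le, (div_pos hy1 hD0).le]
  · simp only [Fin.sum_univ_three, Matrix.cons_val_zero, Matrix.cons_val_one, Matrix.cons_val]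
    field_simp
    rw [hD]; ring
  · intro i _
    refine subset_convexHull ℝ _ ?_
    fin_cases i <;> simp

theorem collinear_of_cross_eq_zero {a b c : Point} (hab : a ≠ b)
    (h : cross (b - a) (c - a) = 0) : Collinear ℝ {a, b, c} := by
  rw [collinear_iff_of_mem (p₀ := a) (by simp)]
  refine ⟨b - a, ?_⟩
  simp only [cross, Prod.fst_sub, Prod.snd_sub] at h
  rintro p (rfl | rfl | rfl)
  · exact ⟨0, by simp⟩
  · exact ⟨1, by simp⟩
  · by_cases h1 : b.1 - a.1 = 0
    · have h2 : b.2 - a.2 ≠ 0 := fun h2 => hab (Prod.ext (by linarith) (by linarith))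
      refine ⟨(p.2 - a.2) / (b.2 - a.2), Prod.ext ?_ ?_⟩
      · have h3 : p.1 - a.1 = 0 := by
          rw [h1, zero_mul, zero_sub, neg_eq_zero] at h
          exact (mul_eq_zero.1 h).resolve_left h2
        simp only [vadd_eq_add, Prod.fst_add, Prod.smul_fst, Prod.fst_sub, smul_eq_mul, h1]
        linarith
      · simp only [vadd_eq_add, Prod.snd_add, Prod.smul_snd, Prod.snd_sub, smul_eq_mul]
        field_simp
        ring
    · refine ⟨(p.1 - a.1) / (b.1 - a.1), Prod.ext ?_ ?_⟩
      · simp only [vadd_eq_add, Prod.fst_add, Prod.smul_fst, Prod.fst_sub, smul_eq_mul]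
        field_simp
        ring
      · simp only [vadd_eq_add, Prod.snd_add, Prod.smul_snd, Prod.snd_sub, smul_eq_mul]
        field_simp
        linarith

namespace KMS

open Prog

variable {n : ℕ} {I J : Fin n → Point} {flip : Bool}

/-- In the direction normal to the supporting line no point exceeds `x`, whereas interior points are
exceeded in every direction. -/
theorem Frame.onHull (F : Frame I flip J) {x : Fin n} (hx : Supported J x) : OnHull I x := by
  obtain ⟨s, hs⟩ := hx
  obtain ⟨v, hv, hv'⟩ := F.exists_dir s
  refine ⟨subset_closure (subset_convexHull ℝ _ ⟨x, rfl⟩), fun hint => ?_⟩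
  obtain ⟨_, ⟨y, rfl⟩, hlt⟩ := exists_cross_lt hint hv
  have := hv' x y
  have := hs y
  linarith

theorem Frame.mem_interior (F : Frame I flip J) {x a b c : Fin n} (h : Inside J x a b c) :
    I x ∈ interior (convexHull ℝ {I a, I b, I c}) := by
  obtain ⟨h1, h2, h3⟩ := h
  unfold Above at h1 h2 h3
  rw [← F.cross_eq] at h1 h2 h3
  exact mem_interior_triangle h1 h2 h3

theorem Frame.not_onHull (F : Frame I flip J) {x a b c : Fin n} (h : Inside J x a b c) :
    ¬ OnHull I x := by
  intro hx
  refine hx.2 (interior_mono (convexHull_mono ?_) (F.mem_interior h))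
  rintro _ (rfl | rfl | rfl) <;> exact ⟨_, rfl⟩

/-! ### Existence of coordinates -/

/-- Finitely many strict inequalities: those between different first coordinates survive a small
shear by continuity, and ties are broken by the second coordinate for every positive `ε`. -/
theorem exists_shear (I : Fin n → Point) : ∃ ε : ℝ, ∀ i j,
    ((I i).1 < (I j).1 ∨ ((I i).1 = (I j).1 ∧ (I i).2 < (I j).2)) →
      (I i).1 + ε * (I i).2 < (I j).1 + ε * (I j).2 := by
  have h : ∀ᶠ ε : ℝ in nhdsWithin 0 (Set.Ioi 0), ∀ i j,
      ((I i).1 < (I j).1 ∨ ((I i).1 = (I j).1 ∧ (I i).2 < (I j).2)) →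
        (I i).1 + ε * (I i).2 < (I j).1 + ε * (I j).2 := by
    refine Filter.eventually_all.2 fun i => Filter.eventually_all.2 fun j => ?_
    by_cases h1 : (I i).1 < (I j).1
    · have hc : ∀ k, Filter.Tendsto (fun ε : ℝ => (I k).1 + ε * (I k).2) (nhdsWithin 0 (Set.Ioi 0))
          (nhds (I k).1) := fun k => by
        have : Continuous fun ε : ℝ => (I k).1 + ε * (I k).2 := by fun_prop
        simpa using (this.tendsto 0).mono_left nhdsWithin_le_nhds
      filter_upwards [(hc i).eventually_lt (hc j) h1] with ε hε _ using hε
    · filter_upwards [self_mem_nhdsWithin] with ε hε hij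
      obtain ⟨h2, h3⟩ := hij.resolve_left h1
      have := mul_lt_mul_of_pos_left h3 (Set.mem_Ioi.1 hε)
      linarith
  exact h.exists

/-- A shear has determinant 1, so it preserves cross products while turning the lexicographic order
into the order of first coordinates. Negation realises the half-turn of the second pass. -/
theorem exists_frame (hinj : Function.Injective I)
    (hgp : ∀ i j k, i ≠ j → i ≠ k → j ≠ k → cross (I j - I i) (I k - I i) ≠ 0) :
    ∃ J, Frame I false J ∧ Frame I true (fun i => - J i) := by
  obtain ⟨ε, hε⟩ := exists_shear I
  let J : Fin n → Point := fun i => ((I i).1 + ε * (I i).2, (I i).2)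
  have hcross : ∀ p q r s, cross (I q - I p) (I s - I r) = cross (J q - J p) (J s - J r) := by
    intro p q r s
    simp only [J, cross, Prod.fst_sub, Prod.snd_sub]; ring
  have htot : ∀ i j, i ≠ j → res I (isLeft i j) = true ∨ res I (isLeft j i) = true := by
    intro i j hij
    rw [res_isLeft, res_isLeft]
    rcases lt_trichotomy (I i).1 (I j).1 with h | h | h
    · exact .inl (.inl h)
    · rcases lt_trichotomy (I i).2 (I j).2 with h' | h' | h'
      · exact .inl (.inr ⟨h, h'⟩)
      · exact absurd (hinj (Prod.ext h h')) hij
      · exact .inr (.inr ⟨h.symm, h'⟩)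
    · exact .inr (.inl h)
  have hbef : ∀ i j, res I (isLeft i j) = true ↔ (J i).1 < (J j).1 := by
    intro i j
    refine ⟨fun h => hε i j ((res_isLeft i j).1 h), fun h => ?_⟩
    have hij : i ≠ j := by rintro rfl; exact lt_irrefl _ h
    rcases htot i j hij with h' | h'
    · exact h'
    · exact absurd (hε j i ((res_isLeft j i).1 h')) (lt_asymm h)
  have hinjJ : ∀ i j, (J i).1 = (J j).1 → i = j := by
    intro i j hij
    by_contra hne
    rcases htot i j hne with h | h
    · exact absurd ((hbef _ _).1 h) (by rw [hij]; exact lt_irrefl _)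
    · exact absurd ((hbef _ _).1 h) (by rw [hij]; exact lt_irrefl _)
  have hdir : ∀ s σ : ℝ, σ ≠ 0 → ∃ v : Point, v ≠ 0 ∧ ∀ i j,
      cross v (I j) - cross v (I i) = σ * (((J j).2 - (J i).2) - s * ((J j).1 - (J i).1)) := by
    intro s σ hσ
    -- The functional "height minus `s` times abscissa", pulled back through the shear; its sign `σ`
    -- is 1 for `J` and -1 for the negated coordinates.
    refine ⟨(σ * (1 - s * ε), σ * s), fun h => ?_, fun i j => ?_⟩
    · have h1 : σ * (1 - s * ε) = 0 := congrArg Prod.fst h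
      have h2 : σ * s = 0 := congrArg Prod.snd h
      have h3 := (mul_eq_zero.1 h2).resolve_left hσ
      rw [h3] at h1
      exact hσ (by linarith)
    · simp only [J, cross]; ring
  refine ⟨J, ⟨hbef, hcross, hinjJ, fun i j k h1 h2 h3 => ?_, fun s => ?_⟩,
    ⟨fun i j => ?_, fun p q r s => ?_, fun i j h => ?_, fun i j k h1 h2 h3 => ?_, fun s => ?_⟩⟩
  · rw [← hcross]; exact hgp i j k h1 h2 h3
  · simpa using hdir s 1 one_ne_zero
  · exact (hbef j i).trans neg_lt_neg_iff.symm
  · rw [hcross]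
    simp only [cross, Prod.fst_sub, Prod.snd_sub, Prod.fst_neg, Prod.snd_neg]; ring
  · exact hinjJ i j (neg_injective h)
  · have := hgp i j k h1 h2 h3
    rw [hcross] at this
    simp only [cross, Prod.fst_sub, Prod.snd_sub, Prod.fst_neg, Prod.snd_neg] at this ⊢
    intro hc
    exact this (by linarith)
  · obtain ⟨v, hv, hv'⟩ := hdir s (-1) (by norm_num)
    refine ⟨v, hv, fun i j => ?_⟩
    rw [hv']
    simp only [Prod.fst_neg, Prod.snd_neg]; ring

/-! ### The whole program -/

theorem cheap_load (l : List (Fin n)) : Cheap I (l.length + 1) (load l) := by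
  induction l with
  | nil => exact cheap_tick.bind (cheap_pure 0 _) (by simp)
  | cons x l ih => exact cheap_tick.bind (ih.bind (cheap_pure 0 _) le_rfl) (by simp; omega)

theorem res_load (l : List (Fin n)) : res I (load l) = l := by
  induction l with
  | nil => simp [load]
  | cons x l ih => simp [load, ih]

theorem cheap_first (x : Fin n) (l : List (Fin n)) :
    Cheap I (4 * (l.length + 1)) (first flip x l) := by
  induction l generalizing x with
  | nil => exact cheap_tick.bind (cheap_pure 0 _) (by simp)
  | cons y l ih =>
    exact cheap_tick.bind ((cheap_before _ _).bind (Cheap.ite (fun _ => ih y) fun _ => ih x) le_rfl)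
      (by simp only [List.length_cons]; omega)

theorem Frame.res_first (F : Frame I flip J) (x : Fin n) (l : List (Fin n)) :
    ∀ y, y = x ∨ y ∈ l → (J (res I (first flip x l))).1 ≤ (J y).1 := by
  induction l generalizing x with
  | nil => simp [first]
  | cons z l ih =>
    intro y hy
    simp only [first, res_bind]
    by_cases h : (J z).1 < (J x).1
    · rw [if_pos ((F.before_iff _ _).2 h)]
      rcases hy with rfl | hy
      · exact (ih z z (.inl rfl)).trans h.le
      · rcases List.mem_cons.1 hy with rfl | hy
        exacts [ih _ _ (.inl rfl), ih z y (.inr hy)]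
    · rw [if_neg (fun hc => h ((F.before_iff _ _).1 hc))]
      rcases hy with rfl | hy
      · exact ih _ _ (.inl rfl)
      · rcases List.mem_cons.1 hy with rfl | hy
        exacts [(ih x x (.inl rfl)).trans (not_lt.1 h), ih x y (.inr hy)]

theorem cheap_sides (l r : Fin n) (xs : List (Fin n)) :
    Cheap I (2 * (xs.length + 1)) (sides l r xs) := by
  induction xs with
  | nil => exact cheap_tick.bind (cheap_pure 0 _) (by simp)
  | cons x xs ih =>
    refine cheap_tick.bind (ih.bind (c' := 1) (Cheap.ite (fun _ => cheap_pure _ _) fun _ =>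
      (cheap_above _ _ _).bind (c' := 0) (Cheap.ite (fun _ => cheap_pure _ _) fun _ =>
        cheap_pure _ _) le_rfl) le_rfl) ?_
    simp only [List.length_cons]; omega

open Classical in
theorem Frame.res_sides (F : Frame I flip J) (l r : Fin n) (xs : List (Fin n)) :
    res I (sides l r xs) = (xs.filter fun x => ¬ (x = l ∨ x = r) ∧ Above J l r x,
      xs.filter fun x => ¬ (x = l ∨ x = r) ∧ ¬ Above J l r x) := by
  induction xs with
  | nil => simp [sides]
  | cons x xs ih =>
    simp only [sides, res_bind, ih]
    by_cases h1 : x = l ∨ x = r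
    · rw [if_pos h1]
      simp only [List.filter_cons, h1, res_pure, decide_false, if_false, not_true, false_and,
        Bool.false_eq_true]
    · rw [if_neg h1, res_bind]
      by_cases h2 : Above J l r x
      · rw [if_pos ((F.res_above _ _ _).2 h2)]
        simp only [List.filter_cons, h1, h2, res_pure, decide_true, decide_false, if_true,
          if_false, not_true, not_false_eq_true, true_and, Bool.false_eq_true]
      · rw [if_neg (fun hc => h2 ((F.res_above _ _ _).1 hc))]
        simp only [List.filter_cons, h1, h2, res_pure, decide_true, decide_false, if_true,
          if_false, not_false_eq_true, true_and, Bool.false_eq_true]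

/-- Any upper bound on the finitely many slopes at which `p` sees the other points serves as the
slope of a supporting line. -/
theorem supported_of_leftmost {p : Fin n} (hp : ∀ i, i ≠ p → (J p).1 < (J i).1) :
    Supported J p := by
  obtain ⟨s, hs⟩ := (Set.finite_range fun i => slope J (p, i)).bddAbove
  refine ⟨s, fun i => ?_⟩
  by_cases hi : i = p
  · simp [hi]
  · rw [show (J i).2 - (J p).2 = _ from slope_mul (e := (p, i)) (hp i hi)]
    exact mul_le_mul_of_nonneg_right (hs ⟨i, rfl⟩) (sub_pos.2 (hp i hi)).le

theorem supported_of_rightmost {p : Fin n} (hp : ∀ i, i ≠ p → (J i).1 < (J p).1) :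
    Supported J p := by
  obtain ⟨s, hs⟩ := (Set.finite_range fun i => slope J (i, p)).bddBelow
  refine ⟨s, fun i => ?_⟩
  by_cases hi : i = p
  · simp [hi]
  · have h1 : (J p).2 - (J i).2 = _ := slope_mul (e := (i, p)) (hp i hi)
    have h2 := mul_le_mul_of_nonneg_right (hs ⟨i, rfl⟩) (sub_pos.2 (hp i hi)).le
    simp only at h1 h2
    linarith

theorem Frame.hullNode (F : Frame I flip J) {p q : Fin n} (hp : ∀ i, (J p).1 ≤ (J i).1)
    (hq : ∀ i, (J i).1 ≤ (J q).1) {S : List (Fin n)} (hS : S.Nodup)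
    (hmem : ∀ x, x ∈ S ↔ x = p ∨ x = q ∨ Above J p q x) : HullNode J S p q :=
  ⟨hS, hp q, hmem,
    supported_of_leftmost fun i hi => lt_of_le_of_ne (hp i) fun e => hi (F.inj _ _ e).symm,
    supported_of_rightmost fun i hi => lt_of_le_of_ne (hq i) fun e => hi (F.inj _ _ e)⟩

/-- The segment from `a` to `b` is an edge of the convex hull, in clockwise direction. -/
def HullEdge (I : Fin n → Point) (a b : Fin n) : Prop :=
  ∀ i, i ≠ a → i ≠ b → cross (I b - I a) (I i - I a) < 0

theorem Frame.hullEdge (F : Frame I flip J) {a b : Fin n} (h : UpperEdge J a b) :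
    HullEdge I a b := by
  intro i ha hb
  rw [F.cross_eq]
  exact h.2 i ha hb

/-- Repeating the first vertex at the end turns the cyclic condition on edges into a condition on a
chain. -/
theorem isHullList_of_isChain {Q : List (Fin n)} {l : Fin n} (hnd : Q.Nodup)
    (hhead : Q.head? = some l) (hchain : (Q ++ [l]).IsChain (HullEdge I))
    (hmem : ∀ i, i ∈ Q ↔ OnHull I i) (hl : ∀ i, LeftOf (I l) (I i)) :
    IsHullList I (Q.map fun x : Fin n => ((x : ℕ) : ℤ)) := by
  obtain ⟨Q', rfl⟩ : ∃ Q', Q = l :: Q' := by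
    cases Q with
    | nil => simp at hhead
    | cons a Q => exact ⟨Q, by simpa using hhead⟩
  set Q := l :: Q' with hQ
  refine ⟨Q'.length + 1, fun t => Q[t], ?_, fun s t hst => ?_, ?_, fun t i hi1 hi2 => ?_,
    fun t ht s => ?_⟩
  · refine List.ext_getElem (by simp [hQ]) fun i h1 h2 => ?_
    rw [List.getElem_map, List.getElem_ofFn]
    rfl
  · exact Fin.ext ((List.Nodup.getElem_inj_iff hnd).1 hst)
  · ext i
    rw [Set.mem_ofPred_eq, ← hmem, List.mem_iff_getElem]
    constructor
    · rintro ⟨t, rfl⟩; exact ⟨t, t.2, rfl⟩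
    · rintro ⟨t, ht, rfl⟩; exact ⟨⟨t, ht⟩, rfl⟩
  · have hc := List.isChain_iff_getElem.1 hchain t (by simp [hQ]; omega)
    have h1 : (Q ++ [l])[(t : ℕ)]'(by simp [hQ]) = Q[t] :=
      List.getElem_append_left t.2
    have h2 : (Q ++ [l])[(t : ℕ) + 1]'(by simp [hQ]; omega) =
        Q[finRotate (Q'.length + 1) t] := by
      by_cases ht : (t : ℕ) < Q'.length
      · have hrot : finRotate (Q'.length + 1) t = ⟨t + 1, by omega⟩ := finRotate_of_lt ht
        simp only [hrot]
        exact List.getElem_append_left (by simp [hQ]; omega)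
      -- Only the last index wraps around, and there the chain ends in the appended copy of `l`.
      · have htl : t = Fin.last _ := Fin.ext (by simp; omega)
        subst htl
        rw [finRotate_last]
        rw [List.getElem_append_right (by simp [hQ])]
        simp [hQ]
    rw [h1, h2] at hc
    exact hc i hi1 hi2
  · have : Q[t] = l := by
      simp only [Fin.getElem_fin, ht]; rfl
    simp only [this]
    exact hl _

end KMS

/-! ### Combining the upper and the lower hull -/

namespace KMS

open Prog

variable {n : ℕ} {I J : Fin n → Point}

theorem above_neg (p q x : Fin n) :
    Above (fun i => - J i) p q x ↔ Above J p q x := by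
  unfold Above
  rw [show cross (-J q - -J p) (-J x - -J p) = cross (J q - J p) (J x - J p) by
    simp only [cross, Prod.fst_sub, Prod.snd_sub, Prod.fst_neg, Prod.snd_neg]; ring]

/-- The upper hull followed by the inner vertices of the lower hull is the hull list. -/
theorem isHullList_append (F₀ : Frame I false J) (F₁ : Frame I true fun i => - J i) {l r : Fin n}
    (hlr : l ≠ r) (hl : ∀ i, (J l).1 ≤ (J i).1) {Q R : List (Fin n)}
    (hQnd : Q.Nodup) (hQl : Q.head? = some l) (hQr : Q.getLast? = some r)
    (hQ : Q.IsChain (UpperEdge J)) (hQs : ∀ x ∈ Q, Supported J x)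
    (hQa : ∀ x ∈ Q, x = l ∨ x = r ∨ Above J l r x)
    (hRnd : R.Nodup) (hRr : R.head? = some r) (hRl : R.getLast? = some l)
    (hR : R.IsChain (UpperEdge fun i => - J i)) (hRs : ∀ x ∈ R, Supported (fun i => - J i) x)
    (hRa : ∀ x ∈ R, x = r ∨ x = l ∨ Above (fun i => - J i) r l x)
    (hcover : ∀ x, OnHull I x → x ∈ Q ∨ x ∈ R) :
    IsHullList I ((Q ++ R.filter fun x => x ≠ l ∧ x ≠ r).map fun x : Fin n => ((x : ℕ) : ℤ)) := by
  have hlQ : l ∈ Q := List.mem_of_mem_head? hQl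
  have hrQ : r ∈ Q := List.mem_of_mem_getLast? hQr
  obtain ⟨R', rfl⟩ : ∃ R', R = r :: R' := by
    cases R with
    | nil => simp at hRr
    | cons a R => exact ⟨R, by simpa using hRr⟩
  obtain ⟨mid, rfl⟩ : ∃ mid, R' = mid ++ [l] := by
    rcases List.eq_nil_or_concat R' with rfl | ⟨mid, a, rfl⟩
    · simp only [List.getLast?_singleton, Option.some.injEq] at hRl
      exact absurd hRl.symm hlr
    · refine ⟨mid, ?_⟩
      rw [List.concat_eq_append, ← List.cons_append, List.getLast?_append] at hRl
      simp only [List.getLast?_singleton, Option.some_or, Option.some.injEq] at hRl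
      rw [List.concat_eq_append, hRl]
  simp only [List.nodup_cons, List.mem_append, List.mem_singleton, not_or,
    List.nodup_append] at hRnd
  obtain ⟨⟨hrmid, -⟩, hmid, -, hlmid⟩ := hRnd
  have hlmid' : l ∉ mid := fun h => hlmid l h l rfl rfl
  have hfilter : (r :: (mid ++ [l])).filter (fun x => x ≠ l ∧ x ≠ r) = mid := by
    have h1 : mid.filter (fun x => x ≠ l ∧ x ≠ r) = mid := by
      rw [List.filter_eq_self]
      intro x hx
      exact decide_eq_true ⟨fun e => hlmid' (e ▸ hx), fun e => hrmid (e ▸ hx)⟩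
    rw [List.filter_cons_of_neg (by simp), List.filter_append, h1]
    simp
  rw [hfilter]
  refine isHullList_of_isChain (l := l) ?_ ?_ ?_ (fun i => ⟨fun hi => ?_, fun hi => ?_⟩)
    fun i => ?_
  -- A common vertex other than `l` and `r` would be strictly above and strictly below the line from
  -- `l` to `r`.
  · refine List.nodup_append.2 ⟨hQnd, hmid, ?_⟩
    rintro x hx _ hx' rfl
    have hxl : x ≠ l := fun e => hlmid' (e ▸ hx')
    have hxr : x ≠ r := fun e => hrmid (e ▸ hx')
    have h1 := ((hQa x hx).resolve_left hxl).resolve_left hxr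
    have h2 := ((hRa x (by simp [hx'])).resolve_left hxr).resolve_left hxl
    rw [above_neg, above_swap] at h2
    exact lt_asymm h1 h2
  · rw [List.head?_append, hQl]; rfl
  -- Regrouped, the closed chain is `Q` followed by the lower chain without its first vertex `r`,
  -- which is the last vertex of `Q`.
  · rw [List.append_assoc, List.isChain_append]
    obtain ⟨h1, h2⟩ := List.isChain_cons.1 hR
    refine ⟨hQ.imp fun _ _ h => F₀.hullEdge h, h2.imp fun _ _ h => F₁.hullEdge h,
      fun x hx y hy => ?_⟩
    rw [hQr, Option.mem_some_iff] at hx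
    subst hx
    exact F₁.hullEdge (h1 y hy)
  · rcases List.mem_append.1 hi with hi | hi
    · exact F₀.onHull (hQs i hi)
    · exact F₁.onHull (hRs i (by simp [hi]))
  · rw [List.mem_append]
    rcases hcover i hi with h | h
    · exact .inl h
    · simp only [List.mem_cons, List.mem_append, List.not_mem_nil, or_false] at h
      rcases h with rfl | h | rfl
      exacts [.inl hrQ, .inr h, .inl hlQ]
  · have h := mt (F₀.before_iff i l).1 (not_lt.2 (hl i))
    rw [before, if_neg (by simp), res_isLeft] at h
    simp only [not_or, not_and, not_lt] at h
    rcases h.1.lt_or_eq with h' | h'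
    exacts [.inl h', .inr ⟨h', h.2 h'.symm⟩]

/-- A labelling of the entries of `S` by addresses in a binary tree: not too many entries have the
same label, and for every node there is a direction in which no entry with that label is exceeded
by an entry outside the subtree. -/
structure Labelling (I : Fin n → Point) (S : List (Fin n)) (path : Fin n → List Bool) : Prop where
  nodup : S.Nodup
  count : ∀ w, (S.countP fun x => path x = w) * 2 ^ w.length ≤ 2 * S.length
  dir : ∀ w, ∃ v : Point, v ≠ 0 ∧ ∀ x ∈ S, path x = w → ∀ y, cross v (I x) < cross v (I y) →
    y ∈ S ∧ w <+: path y

theorem labelling_nil : Labelling I [] fun _ => [] :=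
  ⟨List.nodup_nil, by simp, fun _ => ⟨(1, 0), by simp, by simp⟩⟩

theorem Frame.exists_labelling {flip : Bool} (F : Frame I flip J) (l r : Fin n) {fuel : ℕ}
    {S : List (Fin n)} {pl pr : Fin n} (hf : S.length ≤ fuel) (h : HullNode J S pl pr) :
    ∃ path, Labelling I S path ∧ cost I (hull flip l r fuel S pl pr) ≤
      12000 * (S.map fun x => (path x).length + 1).sum := by
  obtain ⟨path, h1, h2, h3⟩ := F.hull_cost l r fuel S pl pr hf h
  refine ⟨path, ⟨h.nodup, fun w => ?_, h3⟩, h1⟩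
  rcases h2 w with h | ⟨h, h'⟩ <;> omega

/-- What the program does on an array in general position. -/
structure ProgramSpec (I : Fin n → Point) (p : Prog n Unit) : Prop where
  hull : IsHullList I (hullOut I p)
  write : ∀ w ∈ writes I p, (w.2 = (-1, -1, -1) ∧ OnHull I w.1) ∨
    ∃ a b c : Fin n, w.2 = (((a : ℕ) : ℤ), ((b : ℕ) : ℤ), ((c : ℕ) : ℤ)) ∧
      I w.1 ∈ interior (convexHull ℝ {I a, I b, I c}) ∧ ¬ OnHull I w.1
  exists_write : ∀ i, ∃ t, (i, t) ∈ writes I p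
  cost : ∃ S₁ S₂ path₁ path₂, Labelling I S₁ path₁ ∧ Labelling I S₂ path₂ ∧
    cost I p ≤ 20 * (n + 1) + 12000 * ((S₁.map fun x => (path₁ x).length + 1).sum +
      (S₂.map fun x => (path₂ x).length + 1).sum)

theorem programSpec_zero (I : Fin 0 → Point) : ProgramSpec I (program 0) where
  hull := ⟨0, Fin.elim0, by simp [program], fun a => a.elim0, by ext a; exact a.elim0,
    fun a => a.elim0, fun a => a.elim0⟩
  write := by simp [program]
  exists_write i := i.elim0
  cost := ⟨[], [], _, _, labelling_nil, labelling_nil, by simp [program]⟩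

theorem programSpec_of_subsingleton {I : Fin (n + 1) → Point} {J : Fin (n + 1) → Point}
    (F : Frame I false J) {l : Fin (n + 1)} (hall : ∀ i, i = l) :
    IsHullList I (hullOut I (report false l l l)) ∧ OnHull I l := by
  obtain ⟨-, -, h3⟩ := report_spec (I := I) (flip := false) l l l
  have hl : OnHull I l := F.onHull (supported_of_leftmost fun i hi => absurd (hall i) hi)
  refine ⟨?_, hl⟩
  rw [h3]
  refine isHullList_of_isChain (Q := [l]) (l := l) (List.nodup_singleton l) rfl ?_ (fun i => ?_) fun i => ?_
  · refine List.isChain_cons.2 ⟨fun y _ i hi _ => absurd (hall i) hi, List.isChain_singleton l⟩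
  · simp [hall i, hl]
  · rw [hall i]; exact .inr ⟨rfl, le_rfl⟩

/-- The passes are analysed independently, in the coordinates `J` and their negatives, each with its
own labelling; their lists share only `l` and `r`. -/
theorem programSpec_succ {I : Fin (n + 1) → Point} (hinj : Function.Injective I)
    (hgp : ∀ i j k, i ≠ j → i ≠ k → j ≠ k → cross (I j - I i) (I k - I i) ≠ 0) :
    ProgramSpec I (program (n + 1)) := by
  classical
  obtain ⟨J, F₀, F₁⟩ := exists_frame hinj hgp
  have hload := cheap_load (I := I) (List.finRange (n + 1))
  have hfirst := cheap_first (I := I) (flip := false) 0 (List.finRange (n + 1))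
  have hlast := cheap_first (I := I) (flip := true) 0 (List.finRange (n + 1))
  have hl : ∀ i, (J (res I (first false 0 (List.finRange (n + 1))))).1 ≤ (J i).1 := fun i =>
    F₀.res_first 0 _ i (.inr (List.mem_finRange i))
  have hr : ∀ i, (J i).1 ≤ (J (res I (first true 0 (List.finRange (n + 1))))).1 := fun i =>
    neg_le_neg_iff.1 (F₁.res_first 0 _ i (.inr (List.mem_finRange i)))
  have hprog : program (n + 1) = (do
      let all ← load (List.finRange (n + 1))
      let l ← first false 0 all
      let r ← first true 0 all
      if l = r then report false l r l
      else
        let (up, low) ← sides l r all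
        hull false l r (n + 1) (l :: r :: up) l r
        hull true l r (n + 1) (r :: l :: low) r l) := rfl
  set l := res I (first false 0 (List.finRange (n + 1))) with hl_def
  set r := res I (first true 0 (List.finRange (n + 1))) with hr_def
  by_cases hlr : l = r
  · have hall : ∀ i, i = l := fun i => F₀.inj _ _ (le_antisymm (hlr ▸ hr i) (hl i))
    obtain ⟨h1, h2⟩ := programSpec_of_subsingleton F₀ hall
    obtain ⟨c1, c2, -⟩ := report_spec (I := I) (flip := false) l l l
    have hw : writes I (program (n + 1)) = [(l, (-1, -1, -1))] := by
      rw [hprog]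
      simp only [writes_bind, res_load, ← hl_def, ← hr_def]
      rw [if_pos hlr, ← hlr, c2, hload.2.1, hfirst.2.1, hlast.2.1]
      rfl
    refine ⟨?_, ?_, ?_, [], [], _, _, labelling_nil, labelling_nil, ?_⟩
    · rw [hprog]
      simp only [hullOut_bind, res_load, ← hl_def, ← hr_def]
      rw [if_pos hlr, ← hlr, hload.1, hfirst.1, hlast.1]
      exact h1
    · rw [hw]
      simpa only [List.forall_mem_singleton] using Or.inl ⟨trivial, h2⟩
    · intro i
      rw [hw, hall i]
      exact ⟨_, List.mem_singleton_self _⟩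
    · rw [hprog]
      simp only [cost_bind, res_load, ← hl_def, ← hr_def]
      rw [if_pos hlr, ← hlr]
      have := hload.2.2
      have := hfirst.2.2
      have := hlast.2.2
      simp only [List.length_finRange] at *
      omega
  · have hsides := cheap_sides (I := I) l r (List.finRange (n + 1))
    have hres := F₀.res_sides l r (List.finRange (n + 1))
    set up := (List.finRange (n + 1)).filter fun x => ¬ (x = l ∨ x = r) ∧ Above J l r x with hup
    set low := (List.finRange (n + 1)).filter fun x => ¬ (x = l ∨ x = r) ∧ ¬ Above J l r x
      with hlow
    have hmem_up : ∀ x, x ∈ l :: r :: up ↔ x = l ∨ x = r ∨ Above J l r x := by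
      intro x
      simp only [List.mem_cons, hup, List.mem_filter, List.mem_finRange, true_and,
        decide_eq_true_eq]
      tauto
    have hmem_low : ∀ x, x ∈ r :: l :: low ↔ x = r ∨ x = l ∨ Above (fun i => - J i) r l x := by
      intro x
      rw [above_neg]
      simp only [List.mem_cons, hlow, List.mem_filter, List.mem_finRange, true_and,
        decide_eq_true_eq]
      by_cases h1 : x = l
      · simp [h1]
      by_cases h2 : x = r
      · simp [h2]
      have h3 : Above J r l x ↔ ¬ Above J l r x :=
        ⟨fun h h' => by rw [above_swap] at h; exact lt_asymm h h',
          F₀.above_swap_of_not_above hlr h1 h2⟩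
      rw [h3]
      tauto
    have hnd_up : (l :: r :: up).Nodup := by
      have : up.Nodup := (List.nodup_finRange _).filter _
      refine List.nodup_cons.2 ⟨?_, List.nodup_cons.2 ⟨?_, this⟩⟩ <;> simp [hlr, hup]
    have hnd_low : (r :: l :: low).Nodup := by
      have : low.Nodup := (List.nodup_finRange _).filter _
      refine List.nodup_cons.2 ⟨?_, List.nodup_cons.2 ⟨?_, this⟩⟩ <;> simp [Ne.symm hlr, hlow]
    have hN₀ : HullNode J (l :: r :: up) l r := F₀.hullNode hl hr hnd_up hmem_up
    have hN₁ : HullNode (fun i => - J i) (r :: l :: low) r l :=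
      F₁.hullNode (fun i => neg_le_neg (hr i)) (fun i => neg_le_neg (hl i)) hnd_low hmem_low
    have hlen : ∀ S : List (Fin (n + 1)), S.Nodup → S.length ≤ n + 1 := fun S hS => by
      simpa using hS.length_le_card
    obtain ⟨Q, q1, q2, q3, q4, q5, q6, q7, q8, q9, q10⟩ :=
      F₀.hull_output l r (n + 1) _ l r (hlen _ hnd_up) hN₀
    obtain ⟨R, r1, r2, r3, r4, r5, r6, r7, r8, r9, r10⟩ :=
      F₁.hull_output l r (n + 1) _ r l (hlen _ hnd_low) hN₁
    obtain ⟨path₁, p1, p2⟩ := F₀.exists_labelling l r (hlen _ hnd_up) hN₀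
    obtain ⟨path₂, p3, p4⟩ := F₁.exists_labelling l r (hlen _ hnd_low) hN₁
    have hcov : ∀ x, x ∈ l :: r :: up ∨ x ∈ r :: l :: low := fun x => by
      simp only [List.mem_cons, hup, hlow, List.mem_filter, List.mem_finRange, true_and,
        decide_eq_true_eq]
      tauto
    have hw : writes I (program (n + 1)) = writes I (hull false l r (n + 1) (l :: r :: up) l r) ++
        writes I (hull true l r (n + 1) (r :: l :: low) r l) := by
      rw [hprog]
      simp only [writes_bind, res_load, ← hl_def, ← hr_def]
      rw [if_neg hlr, hload.2.1, hfirst.2.1, hlast.2.1]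
      simp only [writes_bind, hres, hsides.2.1, List.nil_append]
    refine ⟨?_, ?_, ?_, _, _, path₁, path₂, p1, p3, ?_⟩
    · rw [hprog]
      simp only [hullOut_bind, res_load, ← hl_def, ← hr_def]
      rw [if_neg hlr, hload.1, hfirst.1, hlast.1]
      simp only [hullOut_bind, hres, hsides.1, List.nil_append]
      rw [q1, r1, if_neg (by simp), if_pos rfl, ← List.map_append]
      refine isHullList_append F₀ F₁ hlr hl q2 q4 q5 q6 q7 (fun x hx => (hmem_up x).1 (q3 hx))
        r2 r4 r5 r6 r7 (fun x hx => (hmem_low x).1 (r3 hx)) fun x hx => ?_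
      -- A point of either list is a reported vertex or strictly inside a triangle; the latter
      -- excludes hull points, so none is missed.
      rcases hcov x with h | h
      · refine .inl ((q10 x h).resolve_right ?_)
        rintro ⟨a, b, c, habc⟩
        exact F₀.not_onHull habc hx
      · refine .inr ((r10 x h).resolve_right ?_)
        rintro ⟨a, b, c, habc⟩
        exact F₁.not_onHull habc hx
    · intro w hw'
      rw [hw, List.mem_append] at hw'
      rcases hw' with h | h
      · rcases q8 w h with ⟨h1, h2⟩ | ⟨a, b, c, h1, h2⟩
        · exact .inl ⟨h1, F₀.onHull h2⟩
        · exact .inr ⟨a, b, c, h1, F₀.mem_interior h2, F₀.not_onHull h2⟩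
      · rcases r8 w h with ⟨h1, h2⟩ | ⟨a, b, c, h1, h2⟩
        · exact .inl ⟨h1, F₁.onHull h2⟩
        · exact .inr ⟨a, b, c, h1, F₁.mem_interior h2, F₁.not_onHull h2⟩
    · intro i
      simp only [hw, List.mem_append]
      rcases hcov i with h | h
      · obtain ⟨t, ht⟩ := q9 i h
        exact ⟨t, .inl ht⟩
      · obtain ⟨t, ht⟩ := r9 i h
        exact ⟨t, .inr ht⟩
    · have hc : cost I (program (n + 1)) = cost I (load (List.finRange (n + 1))) +
          (cost I (first false 0 (List.finRange (n + 1))) +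
          (cost I (first true 0 (List.finRange (n + 1))) +
          (cost I (sides l r (List.finRange (n + 1))) +
          (cost I (hull false l r (n + 1) (l :: r :: up) l r) +
          cost I (hull true l r (n + 1) (r :: l :: low) r l))))) := by
        rw [hprog]
        simp only [cost_bind, res_load, ← hl_def, ← hr_def]
        rw [if_neg hlr]
        simp only [cost_bind, hres]
      rw [hc]
      have := hload.2.2
      have := hfirst.2.2
      have := hlast.2.2
      have := hsides.2.2
      simp only [List.length_finRange] at *
      omega

end KMS

/-! ### Correctness and universal optimality -/

open KMS Prog

variable {P : Finset Point}

theorem programSpec (hP : GeneralPosition P) (I : InputArray P) :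
    ProgramSpec I.points (program P.card) := by
  have h : ∀ (n : ℕ) (J : Fin n → Point), Function.Injective J →
      (∀ i j k, i ≠ j → i ≠ k → j ≠ k → cross (J j - J i) (J k - J i) ≠ 0) →
      ProgramSpec J (program n) := by
    rintro (_ | n) J h1 h2
    exacts [programSpec_zero J, programSpec_succ h1 h2]
  have hinj := I.injective_points
  refine h _ _ hinj fun i j k hij hik hjk hc => ?_
  exact hP _ (I i).2 _ (I j).2 _ (I k).2 (hinj.ne hij) (hinj.ne hik) (hinj.ne hjk)
    (collinear_of_cross_eq_zero (hinj.ne hij) hc)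

/-- Every single write is valid for its point, so overwriting is harmless; it does happen at `l` and
`r`, which both passes report. -/
theorem kirkpatrickMcQueenSeidel_correct : kirkpatrickMcQueenSeidel.Correct := by
  intro P hP I
  have hS := programSpec hP I
  obtain ⟨o, hrun, hhull, hwit⟩ :=
    run_toMachine (I := I.points) (program P.card) (program P.card) (Output.empty P.card)
  have hW : ∀ i, ∃ t, (i, t) ∈ writes I.points (program P.card) ∧ o.witness i = some t := by
    intro i
    rcases applyWrites_witness (Output.empty P.card) (writes I.points (program P.card)) i with
      ⟨h, -⟩ | ⟨t, ht, h⟩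
    · obtain ⟨t, ht⟩ := hS.exists_write i
      exact absurd ht (h t)
    · exact ⟨t, ht, by rw [hwit, h]⟩
  choose W hW₁ hW₂ using hW
  refine ⟨_, o, W, hrun, ?_, hW₂, fun i => ⟨fun hi => ?_, fun hi => ?_⟩⟩
  · rw [hhull]
    exact hS.hull
  · rcases hS.write _ (hW₁ i) with ⟨h, -⟩ | ⟨a, b, c, -, -, h⟩
    exacts [h, absurd hi h]
  · rcases hS.write _ (hW₁ i) with ⟨-, h⟩ | ⟨a, b, c, h, h', -⟩
    exacts [absurd h hi, ⟨a, b, c, h, h'⟩]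

/-- A labelling of some entries of an array extends to a cap labelling. -/
theorem KMS.Labelling.sum_le {I : InputArray P} {S : List (Fin P.card)}
    {path : Fin P.card → List Bool} (h : Labelling I.points S path) {T : ℕ}
    (hT : ∀ path : {p : Point // p ∈ P} → List Bool, IsCapLabelling path →
      (∀ w, (Finset.univ.filter fun p => path p = w).card * 2 ^ w.length ≤ 4 * P.card) →
      ∑ p, (path p).length ≤ T) :
    (S.map fun x => (path x).length + 1).sum ≤ T := by
  classical
  have hlen : S.length ≤ P.card := by simpa using h.nodup.length_le_card
  -- Moving the tree one level down frees the root for the entries outside `S`. It also makes the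
  -- label lengths equal to the summands of the cost bound, and it doubles the count bound from 2|S|
  -- to at most 4n.
  let ext : Fin P.card → List Bool := fun x => if x ∈ S then true :: path x else []
  have hcard : ∀ w, (Finset.univ.filter fun p => ext (I.symm p) = w).card =
      (Finset.univ.filter fun x => ext x = w).card := fun w =>
    Finset.card_equiv I.symm fun p => by simp
  have hsum : ∑ p, (ext (I.symm p)).length = (S.map fun x => (path x).length + 1).sum := by
    rw [Equiv.sum_comp I.symm fun x => (ext x).length, ← List.sum_toFinset _ h.nodup,
      ← Finset.sum_subset (Finset.subset_univ S.toFinset) fun x _ hx => ?_]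
    · refine Finset.sum_congr rfl fun x hx => ?_
      simp [ext, List.mem_toFinset.1 hx]
    · rw [List.mem_toFinset] at hx
      simp [ext, hx]
  rw [← hsum]
  refine hT (fun p => ext (I.symm p)) (fun w => ?_) fun w => ?_
  · rcases w with _ | ⟨b, w⟩
    -- At the new root any direction works, since every label extends the empty one.
    · exact ⟨(1, 0), by simp, fun _ _ _ _ => List.nil_prefix⟩
    · obtain ⟨v, hv, hv'⟩ := h.dir w
      refine ⟨v, hv, fun p q hp hpq => ?_⟩
      by_cases hpS : I.symm p ∈ S
      · simp only [ext, if_pos hpS, List.cons.injEq] at hp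
        obtain ⟨rfl, hp⟩ := hp
        have h1 := hv' _ hpS hp (I.symm q) (by simpa [InputArray.points] using hpq)
        simp only [ext, if_pos h1.1]
        exact List.cons_prefix_cons.2 ⟨rfl, h1.2⟩
      · simp [ext, if_neg hpS] at hp
  · rw [hcard]
    rcases w with _ | ⟨b, w⟩
    · have := Finset.card_le_univ (Finset.univ.filter fun x => ext x = [])
      rw [Fintype.card_fin] at this
      simp only [List.length_nil, pow_zero]
      omega
    · have h1 : (Finset.univ.filter fun x => ext x = b :: w).card ≤
          S.countP fun x => path x = w := by
        rw [List.countP_eq_length_filter, ← List.toFinset_card_of_nodup (h.nodup.filter _)]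
        refine Finset.card_le_card fun x hx => ?_
        rw [Finset.mem_filter] at hx
        by_cases hxS : x ∈ S
        · simp only [ext, if_pos hxS, List.cons.injEq] at hx
          simp [hxS, hx.2.2]
        · simp [ext, hxS] at hx
      have h2 := h.count w
      have h3 := Nat.mul_le_mul_right (2 ^ w.length) h1
      rw [List.length_cons, pow_succ, ← mul_assoc]
      omega

end PlanarHull

theorem mainTheorem1 (𝒞 : Set PlanarHull.Comparison) (h𝒞 : PlanarHull.basicComparisons ⊆ 𝒞) :
    PlanarHull.UniversallyOptimal (PlanarHull.correctAlgorithms 𝒞)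
      PlanarHull.kirkpatrickMcQueenSeidel := by
  refine ⟨⟨PlanarHull.kirkpatrickMcQueenSeidel_usesOnly h𝒞,
    PlanarHull.kirkpatrickMcQueenSeidel_correct⟩, 440000, fun P hP A hA => ?_⟩
  obtain hT | ⟨T, hT⟩ : A.universal P = ⊤ ∨ ∃ T : ℕ, A.universal P = T := by
    cases h : A.universal P with
    | top => exact .inl rfl
    | coe T => exact .inr ⟨T, rfl⟩
  -- An infinite universal running time makes the right-hand side infinite, as the constant is
  -- nonzero.
  · rw [hT]
    exact le_of_le_of_eq le_top (by rfl)
  obtain ⟨hn, hsum⟩ := PlanarHull.lower_bound hP hA.2 hT.le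
  rw [hT]
  refine iSup_le fun I => ?_
  obtain ⟨o, hrun, -⟩ := PlanarHull.Prog.run_toMachine (I := I.points)
    (PlanarHull.KMS.program P.card) (PlanarHull.KMS.program P.card)
    (PlanarHull.Output.empty P.card)
  refine (PlanarHull.Algorithm.runningTime_le hrun).trans ?_
  obtain ⟨S₁, S₂, path₁, path₂, h1, h2, hc⟩ := (PlanarHull.programSpec hP I).cost
  have h1' := h1.sum_le hsum
  have h2' := h2.sum_le hsum
  -- Two passes contribute 12000 · 18 T each, and n < T bounds the remaining terms by 21 T.
  have : PlanarHull.Prog.cost I.points (PlanarHull.KMS.program P.card) + 1 ≤ 440000 * T := by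
    omega
  exact_mod_cast this
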